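/- Let $n\ge 1$. A partition in $n$ variables is a finite set $\lambda\subset\mathbb N^n$ such that $y\le a\in\lambda$ (componentwise) implies $y\in\lambda$; its size is $|\lambda|$. Write $\deg y=\sum_i y_i$, let $\lambda_{=j}$ and $\lambda_{\ge j}$ be the subsets of elements of degree $j$, respectively of degree at least $j$, put $h_\lambda(j)=|\lambda_{=j}|$, and let $\mathrm{Soc}(\lambda)$ be the set of maximal elements of $\lambda$. For $S\subset\mathbb N^n$ put $S^\perp=\{y : y\le a\text{ for some }a\in S\}$. Lattice points are identified with monomials in $x_1,\dots,x_n$, and $e_1,\dots,e_n$ are the canonical generators of $\mathbb N^n$. For $k,q,m\ge1$ an M-partition of type $(k,q,m)$ is a partition $\lambda$ in $k$ variables with $\mathrm{Soc}(\lambda)\subset\lambda_{\ge3}$, $h_\lambda(1)=k$, $h_\lambda(2)=q$ and $|\lambda_{\ge 3}|=m$ (so $|\lambda|=1+k+q+m$); $\alpha^k_{q,m}$ is their number, and $\alpha^k_{q,0}=0$ for $k,q\geq 1$. A partition $\lambda$ in $k\ge 1$ variables is hydral if $h_\lambda(1)=h_\lambda(2)=k$ and $\mathrm{Soc}(\lambda)\subset\lambda_{\ge3}$.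 For $k\ge2$ and $m\ge k-1$, an M-partition $\lambda$ of type $(k,k,m)$ is headstrong if there are nonnegative integers $\beta_1,\dots,\beta_k$ with sum $m-k+1$ and $\beta_1\ge\beta_i$ for all $i$, and a numbering $v_1,\dots,v_k$ of the variables, such that $$\lambda=\left(\{v_1^{\beta_1+2}\}\cup\{v_i v_1^{\beta_i+2} : i=2,\dots,k\}\right)^\perp .$$ For positive integers $k$ and $m\geq 0$, let $\delta_{k,m}$ be the number of M-partitions $\lambda$ of type $(k,k,m)$ with $\lambda_{=2}=\{e_1+e_i : i=1,\dots,k\}$ (so $\delta_{k,0}=0$). For an integer partition $\lambda=(\lambda_1\ge\dots\ge\lambda_s>0)$ of $d\ge0$ let $\mathsf t(\lambda)$ be the number of parts equal to $3$; let $\mathsf s(\lambda)$ be $\lambda$ with one part equal to $3$ removed (if $\mathsf t(\lambda)>0$); let $\mathsf u(\lambda)$ be $\lambda$ with one copy of the largest part removed; $\mathsf r(\lambda)=\sum_{i}\max(\lambda_i-1,1)$; $|\mathrm{Aut}(\lambda)|$ the product of the factorials of the multiplicities of the parts; and $$\mathsf f(\lambda)=\frac1{|\mathrm{Aut}(\lambda)|}\prod_{j=1}^s\binom{d-\sum_{i<j}\lambda_i}{\lambda_j}\lambda_j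 .$$ For $m\in\mathbb Z$ let $\mu(\lambda,m)=0$ if $m<\mathsf r(\lambda)$, and otherwise $\mu(\lambda,m)=\sum\prod_{j=1}^s\delta_{\lambda_j,i_j}$, the sum being over all tuples $(i_1,\dots,i_s)$ of nonnegative integers with $i_1+\dots+i_s=m$ and $i_j\le m-\sum_{l<j}i_l-\mathsf r(\mathsf u^{j}(\lambda))$ for $1\le j\le s-1$ (thus for the empty partition, $\mu(\varnothing,m)$ is $1$ if $m=0$ and $0$ otherwise). Put $\Psi_\lambda(t)=\sum_{m\ge0}\mu(\lambda,m)t^m\in\mathbb Q[[t]]$. Then the following hold. (1) A partition in $n$ variables is hydral if and only if it is an M-partition of type $(n,n,m)$ for some $m\ge1$; thus, for every $m\ge 0$, $\alpha^n_{n,m}$ is the number of hydral partitions in $n$ variables of size $1+2n+m$. (2) Let $m\ge1$. A partition $\lambda$ in $n$ variables is an M-partition of type $(n,n,m)$ if and only if there are a set partition $$\{1,\dots,n\}=\coprod_{i=1}^rA_i\amalg\coprod_{i=1}^sB_i\amalg\coprod_{i=1}^tC_i$$ with $A_i=\{a_i\}$, $|B_i|\ge2$ and $|C_i|=3$, nonnegative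 integers $m_1,\dots,m_r,n_1,\dots,n_s$ with $\sum_i m_i+\sum_i n_i=m-\left(r+t-s+\sum_i|B_i|\right)$ and, for each $i$, a headstrong M-partition $\pi_i$ of type $(|B_i|,|B_i|,n_i+|B_i|-1)$ in the variables indexed by $B_i$, such that $$\lambda=\bigcup_{i=1}^r\{x_{a_i}^{m_i+3}\}^\perp\cup\bigcup_{i=1}^s\pi_i\cup\bigcup_{i=1}^t\{x_ax_bx_c : C_i=\{a,b,c\}\}^\perp .$$ (3) For every $m\ge1$, $$\alpha^n_{n,m}=\sum_{\lambda\vdash n}\sum_{i=0}^{\mathsf t(\lambda)}\binom n{3i}\frac{(3i)!}{6^i\,i!}\,\mathsf f(\mathsf s^i(\lambda))\,\mu(\mathsf s^i(\lambda),m-i).$$ (4) In $\mathbb Q[[t]]$, $$\sum_{m\ge0}\alpha^n_{n,m}t^m=\sum_{\lambda\vdash n}\sum_{i=0}^{\mathsf t(\lambda)}\binom n{3i}\frac{(3i)!}{6^i\,i!}\,\mathsf f(\mathsf s^i(\lambda))\,\Psi_{\mathsf s^i(\lambda)}(t)\,t^i .$$ Each series $\Psi_{\mathsf s^i(\lambda)}(t)$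 occurring here is a rational function of $t$, and hence so is the left-hand side. -/

import Mathlib

open scoped Nat

namespace Hydral

section LatticePoints

variable {ι : Type*} [Fintype ι]

/-- The degree of a lattice point of `ℕ^ι`. -/
def deg (y : ι → ℕ) : ℕ := ∑ i, y i

/-- The canonical generator `e_i` of `ℕ^ι`. -/
def e [DecidableEq ι] (i : ι) : ι → ℕ := Pi.single i 1

/-- A finite set of lattice points of `ℕ^ι` is a `(|ι| - 1)`-dimensional partition if it contains
every lattice point below one of its elements. Its size is its cardinality. -/
def IsPartition (l : Finset (ι → ℕ)) : Prop := ∀ a ∈ l, ∀ y : ι → ℕ, y ≤ a → y ∈ l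

/-- The set `λ_{=j}` of elements of degree `j`. -/
def degEq (l : Finset (ι → ℕ)) (j : ℕ) : Finset (ι → ℕ) := l.filter fun y => deg y = j

/-- The set `λ_{≥j}` of elements of degree at least `j`. -/
def degGe (l : Finset (ι → ℕ)) (j : ℕ) : Finset (ι → ℕ) := l.filter fun y => j ≤ deg y

/-- The Hilbert–Samuel function of `λ`. -/
def hilb (l : Finset (ι → ℕ)) (j : ℕ) : ℕ := (degEq l j).card

/-- The socle of `λ`: the set of its maximal elements. -/
def socle (l : Finset (ι → ℕ)) : Set (ι → ℕ) := {y | y ∈ l ∧ ∀ a ∈ l, ¬ y < a}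

/-- The apolar partition `S^⊥`. -/
def apolar (S : Set (ι → ℕ)) : Set (ι → ℕ) := {y | ∃ a ∈ S, y ≤ a}

/-- Hydral partitions in `k = |ι|` variables. -/
def IsHydral (l : Finset (ι → ℕ)) : Prop :=
  IsPartition l ∧ hilb l 1 = Fintype.card ι ∧ hilb l 2 = Fintype.card ι ∧
    socle l ⊆ (degGe l 3 : Set (ι → ℕ))

/-- M-partitions of type `(k, q, m)`, where `k = |ι|`. -/
structure IsMPartition (l : Finset (ι → ℕ)) (q m : ℕ) : Prop where
  k_pos : 0 < Fintype.card ι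
  q_pos : 0 < q
  m_pos : 0 < m
  isPartition : IsPartition l
  size : l.card = 1 + Fintype.card ι + q + m
  socle_subset : socle l ⊆ (degGe l 3 : Set (ι → ℕ))
  hilb_one : hilb l 1 = Fintype.card ι
  hilb_two : hilb l 2 = q
  hilb_ge_three : (degGe l 3).card = m

/-- A headstrong composition of `m` into `n` nonnegative parts: the first part is at least all the
others. -/
def IsHeadstrongComposition {n : ℕ} [NeZero n] (α : Fin n → ℕ) (m : ℕ) : Prop :=
  ∑ i, α i = m ∧ ∀ i, α i ≤ α 0

/-- Headstrong M-partitions of type `(n, n, m)` in the `n = |ι|` variables indexed by `ι`, with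
`n ≥ 2` and `m ≥ n - 1`; `σ` numbers the variables, `σ 0` being the head. -/
def IsHeadstrong [DecidableEq ι] (l : Finset (ι → ℕ)) (m : ℕ) : Prop :=
  IsMPartition l (Fintype.card ι) m ∧ 2 ≤ Fintype.card ι ∧ Fintype.card ι ≤ m + 1 ∧
    ∃ (n : ℕ) (_ : NeZero n) (σ : Fin n ≃ ι) (α : Fin n → ℕ),
      IsHeadstrongComposition α (m + 1 - n) ∧
      (l : Set (ι → ℕ)) =
        apolar ({(α 0 + 2) • e (σ 0)} ∪
          {y | ∃ i : Fin n, i ≠ 0 ∧ y = e (σ i) + (α i + 2) • e (σ 0)})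

end LatticePoints

/-- The number `α^k_{q,m}` of M-partitions of type `(k, q, m)`, with the formal value
`α^0_{0,0} = 1`. -/
noncomputable def alpha (k q m : ℕ) : ℕ :=
  if k = 0 ∧ q = 0 ∧ m = 0 then 1
  else Nat.card {l : Finset (Fin k → ℕ) // IsMPartition l q m}

/-- The number `δ_{n,m}` of M-partitions of type `(n, n, m)` with
`λ_{=2} = {e_1 + e_i | i = 1, …, n}`. -/
noncomputable def delta (n m : ℕ) : ℕ :=
  Nat.card {l : Finset (Fin n → ℕ) // IsMPartition l n m ∧
    ∃ i₁ : Fin n, i₁.val = 0 ∧ degEq l 2 = Finset.univ.image fun i => e i₁ + e i}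

/-! ### Structure of hydral partitions -/

/-- Extension by zero of a lattice point in the variables of `B` to all variables. -/
def extendZero {k : ℕ} (B : Finset (Fin k)) (y : B → ℕ) : Fin k → ℕ :=
  fun j => if h : j ∈ B then y ⟨j, h⟩ else 0

/-- The combinatorial data describing a hydral partition of type `(k, k, m)`: a set partition of
the variables into singletons `A_i = {a_i}`, blocks `B_i` of size at least `2` and blocks `C_i` of
size `3`; nonnegative integers `m_i`, `n_i` summing to
`m - (r + t - s + ∑ |B_i|)`; and headstrong M-partitions `π_i` in the variables of `B_i` of type
`(|B_i|, |B_i|, n_i + |B_i| - 1)`. -/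
structure HydralData (k m : ℕ) where
  r : ℕ
  s : ℕ
  t : ℕ
  a : Fin r → Fin k
  B : Fin s → Finset (Fin k)
  C : Fin t → Finset (Fin k)
  disjoint : Pairwise fun i j : Fin r ⊕ Fin s ⊕ Fin t =>
    Disjoint (Sum.elim (fun i => {a i}) (Sum.elim B C) i)
      (Sum.elim (fun i => {a i}) (Sum.elim B C) j)
  cover : ∀ x : Fin k, (∃ i, x = a i) ∨ (∃ i, x ∈ B i) ∨ (∃ i, x ∈ C i)
  two_le_card_B : ∀ i, 2 ≤ (B i).card
  card_C : ∀ i, (C i).card = 3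
  mA : Fin r → ℕ
  nB : Fin s → ℕ
  sum_eq : (m : ℤ) - ((r : ℤ) + t - s + ∑ i, ((B i).card : ℤ)) =
    ∑ i, (mA i : ℤ) + ∑ i, (nB i : ℤ)
  pieces : ∀ i, Finset (B i → ℕ)
  headstrong : ∀ i, IsHeadstrong (pieces i) (nB i + (B i).card - 1)

/-- The union of the pure powers `{x_{a_i}^{m_i + 3}}^⊥`, of the headstrong M-partitions `π_i`, and
of the square-free cubics `{x_a x_b x_c}^⊥` with `C_i = {a, b, c}`. -/
def HydralData.shape {k m : ℕ} (D : HydralData k m) : Set (Fin k → ℕ) :=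
  (⋃ i, apolar {(D.mA i + 3) • e (D.a i)}) ∪
  (⋃ i, extendZero (D.B i) '' (D.pieces i : Set (D.B i → ℕ))) ∪
  (⋃ i, apolar {∑ j ∈ D.C i, e j})

/-! ### Auxiliary functions on linear partitions, seen as multisets of positive parts -/

/-- The parts in nonincreasing order. -/
def sortedParts (l : Multiset ℕ) : List ℕ := l.sort (· ≥ ·)

/-- `|Aut λ|`, the product of the factorials of the multiplicities. -/
def autCard (l : Multiset ℕ) : ℕ := ∏ x ∈ l.toFinset, (l.count x)!

/-- `t(λ)`, the multiplicity of the part `3`. -/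
def tFun (l : Multiset ℕ) : ℕ := l.count 3

/-- `s(λ)`, removing one part equal to `3`. -/
def sFun (l : Multiset ℕ) : Multiset ℕ := l.erase 3

/-- `f(λ)`. -/
def fFun (l : Multiset ℕ) : ℚ :=
  1 / (autCard l : ℚ) *
    ∏ j : Fin (sortedParts l).length,
      (((l.sum - ((sortedParts l).take j).sum).choose ((sortedParts l).get j) *
        (sortedParts l).get j : ℕ) : ℚ)

/-- `u(λ)`, removing one copy of the largest part. -/
def uFun (l : Multiset ℕ) : Multiset ℕ := l.erase l.sup

/-- `r(λ)`. -/
def rFun (l : Multiset ℕ) : ℕ := (l.map fun x => max (x - 1) 1).sum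

/-- The iterated sum in `μ(λ, m)`, where `L = (λ_1, …, λ_s)` lists the parts of `λ` in nonincreasing
order. It runs over the tuples `(i_1, …, i_s)` of nonnegative integers with sum `m` such that
`i_j ≤ m - (i_1 + ⋯ + i_{j-1}) - r(u^j(λ))` for `j = 1, …, s - 1`; for the empty partition it is
`1` if `m = 0` and `0` if `m > 0`. The index `j` below starts from `0`. -/
noncomputable def muSum (L : List ℕ) (m : ℕ) : ℕ :=
  ∑ i ∈ (Finset.piAntidiag (Finset.univ : Finset (Fin L.length)) m).filter
      (fun i => ∀ j : Fin L.length, j.val + 1 < L.length →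
        (i j : ℤ) ≤ (m : ℤ) - (∑ j' ∈ Finset.univ.filter (· < j), (i j' : ℤ)) -
          rFun (uFun^[j.val + 1] (L : Multiset ℕ))),
    ∏ j, delta (L.get j) (i j)

/-- `μ(λ, m)`, which is set to `0` for `m < r(λ)`. -/
noncomputable def mu (l : Multiset ℕ) (m : ℤ) : ℕ :=
  if m < rFun l then 0 else muSum (sortedParts l) m.toNat

/-- The series `Ψ_λ(t) = ∑_m μ(λ, m) t^m`. -/
noncomputable def Psi (l : Multiset ℕ) : PowerSeries ℚ := PowerSeries.mk fun m => (mu l m : ℚ)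

/-- A power series is rational if it is a quotient of two polynomials, the denominator having
nonzero constant term. -/
def IsRational (F : PowerSeries ℚ) : Prop :=
  ∃ P Q : Polynomial ℚ, Q.coeff 0 ≠ 0 ∧ F = (P : PowerSeries ℚ) * (Q : PowerSeries ℚ)⁻¹

/-- The coefficient `C(n, 3i) (3i)! / (6^i i!) f(s^i(λ))`. -/
def hydralCoeff (n : ℕ) (l : Multiset ℕ) (i : ℕ) : ℚ :=
  (n.choose (3 * i) : ℚ) * (((3 * i)! : ℚ) / (6 ^ i * (i ! : ℚ))) * fFun (sFun^[i] l)

end Hydral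

/-! Regard the variables as vertices of a graph whose edges are the elements of degree two, `e x + e
y` being a loop when `x = y`. Every edge lies below an element of degree three, hence belongs to a
triangle `x, y, z`, possibly with repeated vertices. The identity `2 e_x = (e_x + e_y) + (e_x + e_z)
- (e_y + e_z)` then shows that the edges span the space with basis the `e_x`. There are as many
edges as vertices, so the edges are linearly independent and `2 e_x` has only one expression in them
(`IsHydralOn.triangleRep_eq`). The negative term of that expression, when it does not cancel,
reveals the edge opposite to `x`. So a vertex either has one triangle up to order, or all its
triangles use a loop at it (`IsHydralOn.isTriangle_unique`). It follows that each connected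
component is a star whose head alone carries a loop, or a triangle without loops
(`IsHydralOn.exists_star`, `IsHydralOn.exists_cubic`).

The partition is the union of its restrictions to the components. On a loopless triangle only the
divisors of `xyz` survive. A star is determined by the largest power of the head that can multiply
each variable (`IsStarOn.exists_code`), and these exponents are exactly a shifted headstrong
composition. This is the structure statement.

For the count, removing the component of a chosen variable gives a recursion on the number of
variables (`card_isHydralOn_eq_sum`). It is solved by the exponential formula: `n!` times the sum,
over multisets of block types of total size `n`, of the product of the block weights divided by
`|Aut|` (`nat_mul_typeSum`). A star in `k` variables has weight `∑ δ_{k,m} t^m / (k-1)!`, from `k`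
heads over `k!`, and a cubic has weight `t/6`. Multisets with `i` cubics correspond to the pairs
`(λ, i)`, and `f(λ) = d! / (|Aut λ| ∏ (λ_j - 1)!)` matches the coefficients. The inequalities in `μ`
discard only zero terms, so `Ψ_λ` is the product of the series of the `δ_{λ_j,m}` (`Psi_eq`). Each
of these is rational, since for a fixed head exponent the other exponents run independently over an
interval. -/

set_option linter.unusedSectionVars false

namespace Hydral

/-! ### Lattice points, and hydral partitions relative to a set of variables -/

section Basic

variable {V : Type*} [Fintype V]

theorem deg_add (y z : V → ℕ) : deg (y + z) = deg y + deg z := by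
  simp [deg, Finset.sum_add_distrib]

theorem deg_smul (c : ℕ) (y : V → ℕ) : deg (c • y) = c * deg y := by
  simp [deg, Finset.mul_sum]

theorem deg_mono {y z : V → ℕ} (h : y ≤ z) : deg y ≤ deg z :=
  Finset.sum_le_sum fun i _ => h i

@[simp] theorem deg_zero : deg (0 : V → ℕ) = 0 := by simp [deg]

theorem deg_eq_zero {y : V → ℕ} : deg y = 0 ↔ y = 0 := by
  simp [deg, funext_iff]

theorem eq_of_le_of_deg_le {y z : V → ℕ} (h : y ≤ z) (hd : deg z ≤ deg y) : y = z := by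
  funext i
  have h1 := (Finset.sum_eq_sum_iff_of_le (s := Finset.univ) (f := y) (g := z)
    fun i _ => h i).1 (le_antisymm (deg_mono h) hd)
  exact h1 i (Finset.mem_univ i)

theorem mem_degEq {l : Finset (V → ℕ)} {j : ℕ} {y : V → ℕ} :
    y ∈ degEq l j ↔ y ∈ l ∧ deg y = j := by simp [degEq]

theorem mem_degGe {l : Finset (V → ℕ)} {j : ℕ} {y : V → ℕ} :
    y ∈ degGe l j ↔ y ∈ l ∧ j ≤ deg y := by simp [degGe]

variable [DecidableEq V]

@[simp] theorem deg_e (i : V) : deg (e i) = 1 := by simp [deg, e]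

theorem e_apply (i j : V) : e i j = if j = i then 1 else 0 := by simp [e, Pi.single_apply]

@[simp] theorem e_self (i : V) : e i i = 1 := by simp [e]

theorem e_ne {i j : V} (h : j ≠ i) : e i j = 0 := by simp [e_apply, h]

theorem e_injective : Function.Injective (e : V → V → ℕ) := fun i j h => by
  by_contra hij
  have := congrFun h i
  simp [e_apply, hij] at this

theorem e_ne_zero (i : V) : e i ≠ 0 := fun h => by
  have := congrFun h i
  simp at this

theorem e_le_iff {i : V} {y : V → ℕ} : e i ≤ y ↔ y i ≠ 0 := by
  constructor
  · intro h
    have h1 : e i i ≤ y i := h i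
    rw [e_self] at h1
    exact Nat.one_le_iff_ne_zero.1 h1
  · intro h j
    change e i j ≤ y j
    rw [e_apply]
    split_ifs with hj
    · subst hj; omega
    · exact Nat.zero_le _

theorem exists_add_e_le {y z : V → ℕ} (h : y ≤ z) (hd : deg y < deg z) :
    ∃ a, y + e a ≤ z := by
  by_contra! hc
  refine absurd (deg_mono (y := z) (z := y) fun i => ?_) (not_le.2 hd)
  change z i ≤ y i
  by_contra! hi
  refine hc i fun j => ?_
  change y j + e i j ≤ z j
  rw [e_apply]
  split_ifs with hj
  · subst hj; omega
  · simpa using h j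

theorem exists_eq_e {y : V → ℕ} (h : deg y = 1) : ∃ a, y = e a := by
  obtain ⟨a, ha⟩ := exists_add_e_le (y := 0) (z := y) (fun _ => Nat.zero_le _) (by simp [h])
  rw [zero_add] at ha
  exact ⟨a, (eq_of_le_of_deg_le ha (by simp [h])).symm⟩

theorem exists_eq_e_add_e {y : V → ℕ} (h : deg y = 2) : ∃ a b, y = e a + e b := by
  obtain ⟨a, ha⟩ := exists_add_e_le (y := 0) (z := y) (fun _ => Nat.zero_le _) (by simp [h])
  rw [zero_add] at ha
  obtain ⟨b, hb⟩ := exists_add_e_le ha (by simp [h])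
  exact ⟨a, b, (eq_of_le_of_deg_le hb (by simp [h, deg_add])).symm⟩

theorem e_add_e_le {a b : V} (hab : a ≠ b) {y : V → ℕ} (ha : y a ≠ 0) (hb : y b ≠ 0) :
    e a + e b ≤ y := fun j => by
  change e a j + e b j ≤ y j
  rw [e_apply, e_apply]
  split_ifs with h1 h2 h2
  · exact absurd (h1.symm.trans h2) hab
  · subst h1; omega
  · subst h2; omega
  · omega

theorem e_add_e_eq_iff {a b c d : V} :
    e a + e b = e c + e d ↔ (a = c ∧ b = d) ∨ (a = d ∧ b = c) := by
  constructor
  · intro h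
    have ha := congrFun h a
    have hb := congrFun h b
    have hc := congrFun h c
    have hd := congrFun h d
    simp only [Pi.add_apply, e_apply] at ha hb hc hd
    grind
  · rintro (⟨rfl, rfl⟩ | ⟨rfl, rfl⟩)
    · rfl
    · exact add_comm _ _

/-- The partition `l` uses exactly the variables of `S`, has as many elements of degree `2` as
variables, `m` elements of degree at least `3`, and each of its nonzero elements lies below one of
degree at least `3`. -/
structure IsHydralOn (S : Finset V) (l : Finset (V → ℕ)) (m : ℕ) : Prop where
  isPartition : IsPartition l
  zero_mem : 0 ∈ l
  support : ∀ y ∈ l, ∀ i, y i ≠ 0 → i ∈ S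
  e_mem : ∀ i ∈ S, e i ∈ l
  hilb_two : hilb l 2 = S.card
  exists_le : ∀ y ∈ l, y ≠ 0 → ∃ z ∈ l, y ≤ z ∧ 3 ≤ deg z
  card_degGe : (degGe l 3).card = m

theorem degEq_zero {l : Finset (V → ℕ)} (h0 : 0 ∈ l) : degEq l 0 = {0} := by
  ext y
  simp only [mem_degEq, deg_eq_zero, Finset.mem_singleton]
  exact ⟨fun h => h.2, fun h => ⟨h ▸ h0, h⟩⟩

theorem card_eq_of_zero_mem {l : Finset (V → ℕ)} (h0 : 0 ∈ l) :
    l.card = 1 + hilb l 1 + hilb l 2 + (degGe l 3).card := by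
  have h : ∀ j, (degGe l j).card = hilb l j + (degGe l (j + 1)).card := by
    intro j
    rw [hilb, ← Finset.card_union_of_disjoint]
    · congr 1
      ext y
      simp only [Finset.mem_union, mem_degEq, mem_degGe]
      grind
    · rw [Finset.disjoint_left]
      intro y h1 h2
      have := (mem_degEq.1 h1).2
      have := (mem_degGe.1 h2).2
      omega
  have hz : degGe l 0 = l := by ext y; simp [mem_degGe]
  have h3 := h 0
  have h4 := h 1
  have h5 := h 2
  rw [hz, hilb, degEq_zero h0, Finset.card_singleton] at h3
  simp only [zero_add, Nat.reduceAdd] at h3 h4 h5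
  omega

theorem degEq_one_subset (l : Finset (V → ℕ)) : degEq l 1 ⊆ Finset.univ.image e := by
  intro y hy
  obtain ⟨a, rfl⟩ := exists_eq_e (mem_degEq.1 hy).2
  simp

theorem IsHydralOn.hilb_one {l : Finset (V → ℕ)} {S : Finset V} {m : ℕ} (h : IsHydralOn S l m) :
    hilb l 1 = S.card := by
  rw [hilb, ← Finset.card_image_of_injective S e_injective]
  congr 1
  ext y
  simp only [mem_degEq, Finset.mem_image]
  constructor
  · rintro ⟨hy, hd⟩
    obtain ⟨a, rfl⟩ := exists_eq_e hd
    exact ⟨a, h.support _ hy a (by simp), rfl⟩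
  · rintro ⟨a, ha, rfl⟩
    exact ⟨h.e_mem a ha, deg_e a⟩

/-- In a finite set every element lies below a maximal one. Leaving out `0` loses nothing here,
since some `e i` lies above it, and it lets `{0}` count as the hydral partition in no variables, the
start of the recursion. -/
theorem socle_subset_iff [Nonempty V] {l : Finset (V → ℕ)} (he : ∀ i, e i ∈ l) :
    socle l ⊆ (degGe l 3 : Set (V → ℕ)) ↔ ∀ y ∈ l, y ≠ 0 → ∃ z ∈ l, y ≤ z ∧ 3 ≤ deg z := by
  constructor
  · intro h y hy _
    obtain ⟨z, hyz, hz⟩ := l.exists_le_maximal hy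
    have hs : z ∈ socle l := ⟨hz.1, fun a ha hza => (hz.not_gt ha) hza⟩
    exact ⟨z, hz.1, hyz, (mem_degGe.1 (h hs)).2⟩
  · rintro h y ⟨hy, hmax⟩
    rw [Finset.mem_coe, mem_degGe]
    refine ⟨hy, ?_⟩
    by_cases h0 : y = 0
    · subst h0
      let i : V := Classical.arbitrary V
      exact absurd (lt_of_le_of_ne (fun _ => Nat.zero_le _) (e_ne_zero i).symm) (hmax _ (he i))
    · obtain ⟨z, hz, hyz, h3⟩ := h y hy h0
      rcases hyz.lt_or_eq with h1 | rfl
      · exact absurd h1 (hmax z hz)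
      · exact h3

theorem e_mem_of_hilb_one {l : Finset (V → ℕ)} (h : hilb l 1 = Fintype.card V) (i : V) :
    e i ∈ l := by
  have h1 : degEq l 1 = Finset.univ.image e := by
    refine Finset.eq_of_subset_of_card_le (degEq_one_subset l) ?_
    rw [Finset.card_image_of_injective _ e_injective, Finset.card_univ, ← h, hilb]
  have : e i ∈ degEq l 1 := by simp [h1]
  exact (mem_degEq.1 this).1

theorem isHydral_iff [Nonempty V] {l : Finset (V → ℕ)} :
    IsHydral l ↔ IsHydralOn Finset.univ l (degGe l 3).card := by
  constructor
  · rintro ⟨hp, h1, h2, hs⟩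
    have he := e_mem_of_hilb_one h1
    exact ⟨hp, hp _ (he (Classical.arbitrary V)) 0 fun _ => Nat.zero_le _, by simp,
      fun i _ => he i, by simpa using h2, (socle_subset_iff he).1 hs, rfl⟩
  · intro h
    exact ⟨h.isPartition, by simpa using h.hilb_one, by simpa using h.hilb_two,
      (socle_subset_iff fun i => h.e_mem i (by simp)).2 h.exists_le⟩

theorem IsHydralOn.pos {l : Finset (V → ℕ)} {S : Finset V} {m : ℕ} (h : IsHydralOn S l m)
    (hS : S.Nonempty) : 0 < m := by
  obtain ⟨i, hi⟩ := hS
  obtain ⟨z, hz, -, h3⟩ := h.exists_le _ (h.e_mem i hi) (e_ne_zero i)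
  rw [← h.card_degGe]
  exact Finset.card_pos.2 ⟨z, mem_degGe.2 ⟨hz, h3⟩⟩

/-- From here on the argument uses `IsHydralOn`, which keeps the ambient variables fixed while the
set of variables in use varies, so that pieces can be cut out and glued without changing types. -/
theorem isMPartition_iff [Nonempty V] {l : Finset (V → ℕ)} {m : ℕ} :
    IsMPartition l (Fintype.card V) m ↔ IsHydralOn Finset.univ l m := by
  constructor
  · intro h
    have := isHydral_iff.1 ⟨h.isPartition, h.hilb_one, h.hilb_two, h.socle_subset⟩
    rwa [h.hilb_ge_three] at this
  · intro h
    have h' := h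
    rw [← h.card_degGe, ← isHydral_iff] at h'
    obtain ⟨hp, h1, h2, hs⟩ := h'
    refine ⟨Fintype.card_pos, Fintype.card_pos, h.pos Finset.univ_nonempty, hp, ?_, hs, h1, h2,
      h.card_degGe⟩
    rw [card_eq_of_zero_mem h.zero_mem, h1, h2, h.card_degGe]

theorem isHydral_iff_exists [Nonempty V] {l : Finset (V → ℕ)} :
    IsHydral l ↔ ∃ m, 1 ≤ m ∧ IsMPartition l (Fintype.card V) m := by
  constructor
  · intro h
    rw [isHydral_iff] at h
    exact ⟨_, h.pos Finset.univ_nonempty, isMPartition_iff.2 h⟩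
  · rintro ⟨m, -, h⟩
    exact ⟨h.isPartition, h.hilb_one, h.hilb_two, h.socle_subset⟩

theorem isMPartition_iff_isHydral_and_card [Nonempty V] {l : Finset (V → ℕ)} {m : ℕ} :
    IsMPartition l (Fintype.card V) m ↔
      IsHydral l ∧ l.card = 1 + 2 * Fintype.card V + m := by
  constructor
  · intro h
    exact ⟨⟨h.isPartition, h.hilb_one, h.hilb_two, h.socle_subset⟩, by rw [h.size]; ring⟩
  · rintro ⟨h, hc⟩
    rw [isHydral_iff] at h
    have hc' := card_eq_of_zero_mem h.zero_mem
    rw [h.hilb_one, h.hilb_two, Finset.card_univ] at hc'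
    have : (degGe l 3).card = m := by omega
    rw [isMPartition_iff]
    rwa [this] at h

end Basic

/-! ### Gluing and cutting along disjoint sets of variables -/

section Decomposition

variable {V : Type*} [Fintype V] [DecidableEq V]

theorem eq_zero_of_support_disjoint {S T : Finset V} (hST : Disjoint S T) {y : V → ℕ}
    (hS : ∀ i, y i ≠ 0 → i ∈ S) (hT : ∀ i, y i ≠ 0 → i ∈ T) : y = 0 := by
  funext i
  by_contra hi
  exact Finset.disjoint_left.1 hST (hS i hi) (hT i hi)

theorem isHydralOn_empty_iff {l : Finset (V → ℕ)} {m : ℕ} :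
    IsHydralOn ∅ l m ↔ l = {0} ∧ m = 0 := by
  constructor
  · intro h
    have hl : l = {0} := by
      ext y
      rw [Finset.mem_singleton]
      constructor
      · intro hy
        funext i
        by_contra hi
        simpa using h.support y hy i hi
      · rintro rfl
        exact h.zero_mem
    refine ⟨hl, ?_⟩
    rw [← h.card_degGe, hl, Finset.card_eq_zero, Finset.eq_empty_iff_forall_notMem]
    intro y hy
    obtain ⟨hy, h3⟩ := mem_degGe.1 hy
    rw [Finset.mem_singleton.1 hy, deg_zero] at h3
    omega
  · rintro ⟨rfl, rfl⟩
    refine ⟨?_, by simp, by simp, by simp, ?_, by simp, ?_⟩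
    · intro a ha y hy
      rw [Finset.mem_singleton] at ha ⊢
      subst ha
      exact le_antisymm hy fun _ => Nat.zero_le _
    · simp [hilb, degEq, Finset.filter_singleton]
    · simp [degGe, Finset.filter_singleton]

theorem degEq_union (l₁ l₂ : Finset (V → ℕ)) (j : ℕ) :
    degEq (l₁ ∪ l₂) j = degEq l₁ j ∪ degEq l₂ j := Finset.filter_union _ _ _

theorem degGe_union (l₁ l₂ : Finset (V → ℕ)) (j : ℕ) :
    degGe (l₁ ∪ l₂) j = degGe l₁ j ∪ degGe l₂ j := Finset.filter_union _ _ _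

theorem card_degGe_union {S T : Finset V} (hST : Disjoint S T) {l₁ l₂ : Finset (V → ℕ)}
    (h₁ : ∀ y ∈ l₁, ∀ i, y i ≠ 0 → i ∈ S) (h₂ : ∀ y ∈ l₂, ∀ i, y i ≠ 0 → i ∈ T) {j : ℕ}
    (hj : 0 < j) : (degGe (l₁ ∪ l₂) j).card = (degGe l₁ j).card + (degGe l₂ j).card := by
  rw [degGe_union, Finset.card_union_of_disjoint]
  rw [Finset.disjoint_left]
  intro y hy hy'
  obtain ⟨hy, hd⟩ := mem_degGe.1 hy
  obtain ⟨hy', -⟩ := mem_degGe.1 hy'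
  rw [eq_zero_of_support_disjoint hST (h₁ y hy) (h₂ y hy'), deg_zero] at hd
  omega

theorem hilb_union {S T : Finset V} (hST : Disjoint S T) {l₁ l₂ : Finset (V → ℕ)}
    (h₁ : ∀ y ∈ l₁, ∀ i, y i ≠ 0 → i ∈ S) (h₂ : ∀ y ∈ l₂, ∀ i, y i ≠ 0 → i ∈ T) {j : ℕ}
    (hj : 0 < j) : hilb (l₁ ∪ l₂) j = hilb l₁ j + hilb l₂ j := by
  rw [hilb, degEq_union, Finset.card_union_of_disjoint]
  · rfl
  rw [Finset.disjoint_left]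
  intro y hy hy'
  obtain ⟨hy, hd⟩ := mem_degEq.1 hy
  obtain ⟨hy', -⟩ := mem_degEq.1 hy'
  rw [eq_zero_of_support_disjoint hST (h₁ y hy) (h₂ y hy'), deg_zero] at hd
  omega

theorem IsHydralOn.union {S T : Finset V} (hST : Disjoint S T) {l₁ l₂ : Finset (V → ℕ)}
    {m₁ m₂ : ℕ} (h₁ : IsHydralOn S l₁ m₁) (h₂ : IsHydralOn T l₂ m₂) :
    IsHydralOn (S ∪ T) (l₁ ∪ l₂) (m₁ + m₂) where
  isPartition a ha y hy := by
    rw [Finset.mem_union] at ha ⊢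
    exact ha.imp (fun ha => h₁.isPartition a ha y hy) fun ha => h₂.isPartition a ha y hy
  zero_mem := Finset.mem_union_left _ h₁.zero_mem
  support y hy i hi := by
    rw [Finset.mem_union] at hy ⊢
    exact hy.imp (fun hy => h₁.support y hy i hi) fun hy => h₂.support y hy i hi
  e_mem i hi := by
    rw [Finset.mem_union] at hi ⊢
    exact hi.imp (fun hi => h₁.e_mem i hi) fun hi => h₂.e_mem i hi
  hilb_two := by
    rw [hilb_union hST h₁.support h₂.support two_pos, h₁.hilb_two, h₂.hilb_two,
      Finset.card_union_of_disjoint hST]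
  exists_le y hy h0 := by
    rcases Finset.mem_union.1 hy with hy | hy
    · obtain ⟨z, hz, h⟩ := h₁.exists_le y hy h0
      exact ⟨z, Finset.mem_union_left _ hz, h⟩
    · obtain ⟨z, hz, h⟩ := h₂.exists_le y hy h0
      exact ⟨z, Finset.mem_union_right _ hz, h⟩
  card_degGe := by
    rw [card_degGe_union hST h₁.support h₂.support three_pos, h₁.card_degGe, h₂.card_degGe]

/-- The inserted `0` changes the union only when `I` is empty, since each piece already contains
`0`. -/
theorem isHydralOn_biUnion {κ : Type*} [DecidableEq κ] (I : Finset κ) (S : κ → Finset V)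
    (hS : (I : Set κ).PairwiseDisjoint S) (l : κ → Finset (V → ℕ)) (m : κ → ℕ)
    (h : ∀ i ∈ I, IsHydralOn (S i) (l i) (m i)) :
    IsHydralOn (I.biUnion S) (insert 0 (I.biUnion l)) (∑ i ∈ I, m i) := by
  induction I using Finset.induction_on with
  | empty => simpa using isHydralOn_empty_iff.2 ⟨rfl, rfl⟩
  | insert a I ha ih =>
    have h1 := ih (hS.subset (by simp)) fun i hi => h i (Finset.mem_insert_of_mem hi)
    have hd : Disjoint (S a) (I.biUnion S) := by
      rw [Finset.disjoint_biUnion_right]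
      intro i hi
      exact hS (by simp) (by simp [hi]) (by rintro rfl; exact ha hi)
    have h2 := (h a (Finset.mem_insert_self a I)).union hd h1
    rwa [Finset.biUnion_insert, Finset.biUnion_insert, Finset.sum_insert ha,
      ← Finset.union_insert]

/-- The part of `l` in the variables of `B`. -/
def restrict (l : Finset (V → ℕ)) (B : Finset V) : Finset (V → ℕ) :=
  l.filter fun y => ∀ i, y i ≠ 0 → i ∈ B

theorem mem_restrict {l : Finset (V → ℕ)} {B : Finset V} {y : V → ℕ} :
    y ∈ restrict l B ↔ y ∈ l ∧ ∀ i, y i ≠ 0 → i ∈ B := by simp [restrict]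

/-- No element of degree two of `l` joins a variable of `B` to one outside `B`. -/
def IsSeparated (l : Finset (V → ℕ)) (B : Finset V) : Prop :=
  ∀ a ∈ B, ∀ b, e a + e b ∈ l → b ∈ B

/-- Two distinct variables occurring in `y` have their product below `y`; this is why separation,
tested in degree two only, controls elements of every degree. -/
theorem IsSeparated.mem_of_mem {l : Finset (V → ℕ)} {B : Finset V} (hB : IsSeparated l B)
    (hl : IsPartition l) {y : V → ℕ} (hy : y ∈ l) {a b : V} (ha : y a ≠ 0) (hb : y b ≠ 0)
    (haB : a ∈ B) : b ∈ B := by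
  by_cases hab : a = b
  · exact hab ▸ haB
  · exact hB a haB b (hl y hy _ (e_add_e_le hab ha hb))

theorem IsSeparated.restrict_union {S : Finset V} {l : Finset (V → ℕ)} {m : ℕ} {B : Finset V}
    (hB : IsSeparated l B) (h : IsHydralOn S l m) :
    restrict l B ∪ restrict l (S \ B) = l := by
  ext y
  simp only [Finset.mem_union, mem_restrict, ← and_or_left, and_iff_left_iff_imp]
  intro hy
  by_cases hex : ∃ a ∈ B, y a ≠ 0
  · obtain ⟨a, ha, hya⟩ := hex
    exact Or.inl fun i hi => hB.mem_of_mem h.isPartition hy hya hi ha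
  · push Not at hex
    exact Or.inr fun i hi => Finset.mem_sdiff.2 ⟨h.support y hy i hi, fun hiB => hi (hex i hiB)⟩

/-- By `hB`, an element that meets `B` stays inside `B`. So the element of degree at least three
above a nonzero `y` of the restriction again belongs to the restriction. -/
theorem isHydralOn_restrict {S : Finset V} {l : Finset (V → ℕ)} {m : ℕ} {B : Finset V}
    (h : IsHydralOn S l m) (hBS : B ⊆ S) (hB : ∀ y ∈ l, (∃ i ∈ B, y i ≠ 0) → ∀ i, y i ≠ 0 → i ∈ B)
    (h2 : hilb (restrict l B) 2 = B.card) :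
    IsHydralOn B (restrict l B) (degGe (restrict l B) 3).card where
  isPartition a ha y hy := by
    rw [mem_restrict] at ha ⊢
    refine ⟨h.isPartition a ha.1 y hy, fun i hi => ha.2 i ?_⟩
    have : y i ≤ a i := hy i
    omega
  zero_mem := mem_restrict.2 ⟨h.zero_mem, by simp⟩
  support y hy := (mem_restrict.1 hy).2
  e_mem i hi := mem_restrict.2 ⟨h.e_mem i (hBS hi), fun j hj => by
    rw [e_apply] at hj
    have : j = i := by by_contra hji; simp [hji] at hj
    exact this ▸ hi⟩
  hilb_two := h2
  exists_le y hy h0 := by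
    obtain ⟨hy, hs⟩ := mem_restrict.1 hy
    obtain ⟨z, hz, hyz, h3⟩ := h.exists_le y hy h0
    obtain ⟨i, hi⟩ := Function.ne_iff.1 h0
    refine ⟨z, mem_restrict.2 ⟨hz, hB z hz ⟨i, hs i hi, ?_⟩⟩, hyz, h3⟩
    have : y i ≤ z i := hyz i
    have : y i ≠ 0 := hi
    omega
  card_degGe := rfl

/-- The numbers of elements of degree two add up over `B` and its complement, so equality with the
number of variables on `B` passes to the complement by subtraction. -/
theorem IsSeparated.isHydralOn_restrict {S : Finset V} {l : Finset (V → ℕ)} {m : ℕ} {B : Finset V}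
    (hB : IsSeparated l B) (h : IsHydralOn S l m) (hBS : B ⊆ S)
    (h2 : hilb (restrict l B) 2 = B.card) :
    IsHydralOn B (restrict l B) (degGe (restrict l B) 3).card ∧
      IsHydralOn (S \ B) (restrict l (S \ B)) (degGe (restrict l (S \ B)) 3).card ∧
      (degGe (restrict l B) 3).card + (degGe (restrict l (S \ B)) 3).card = m := by
  have hs₁ : ∀ y ∈ restrict l B, ∀ i, y i ≠ 0 → i ∈ B := fun y hy => (mem_restrict.1 hy).2
  have hs₂ : ∀ y ∈ restrict l (S \ B), ∀ i, y i ≠ 0 → i ∈ S \ B :=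
    fun y hy => (mem_restrict.1 hy).2
  refine ⟨Hydral.isHydralOn_restrict h hBS ?_ h2, Hydral.isHydralOn_restrict h
    Finset.sdiff_subset ?_ ?_, ?_⟩
  · rintro y hy ⟨i, hi, hyi⟩ j hj
    exact hB.mem_of_mem h.isPartition hy hyi hj hi
  · rintro y hy ⟨i, hi, hyi⟩ j hj
    rw [Finset.mem_sdiff] at hi ⊢
    exact ⟨h.support y hy j hj, fun hjB => hi.2 (hB.mem_of_mem h.isPartition hy hj hyi hjB)⟩
  · have h3 := hilb_union (Finset.disjoint_sdiff (s := B) (t := S)) hs₁ hs₂ two_pos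
    rw [hB.restrict_union h, h.hilb_two, h2] at h3
    rw [Finset.card_sdiff_of_subset hBS]
    omega
  · rw [← card_degGe_union (Finset.disjoint_sdiff (s := B) (t := S)) hs₁ hs₂ three_pos,
      hB.restrict_union h, h.card_degGe]

theorem restrict_union_left {S T : Finset V} (hST : Disjoint S T) {l₁ l₂ : Finset (V → ℕ)}
    (h₁ : ∀ y ∈ l₁, ∀ i, y i ≠ 0 → i ∈ S) (h₂ : ∀ y ∈ l₂, ∀ i, y i ≠ 0 → i ∈ T) (h0 : 0 ∈ l₁) :
    restrict (l₁ ∪ l₂) S = l₁ := by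
  ext y
  rw [mem_restrict, Finset.mem_union]
  constructor
  · rintro ⟨hy | hy, hs⟩
    · exact hy
    · exact eq_zero_of_support_disjoint hST hs (h₂ y hy) ▸ h0
  · intro hy
    exact ⟨Or.inl hy, h₁ y hy⟩

theorem restrict_union_right {S T : Finset V} (hST : Disjoint S T) {l₁ l₂ : Finset (V → ℕ)}
    (h₁ : ∀ y ∈ l₁, ∀ i, y i ≠ 0 → i ∈ S) (h₂ : ∀ y ∈ l₂, ∀ i, y i ≠ 0 → i ∈ T) (h0 : 0 ∈ l₂) :
    restrict (l₁ ∪ l₂) T = l₂ := by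
  rw [Finset.union_comm]
  exact restrict_union_left hST.symm h₂ h₁ h0

end Decomposition

/-! ### Changing the ambient set of variables -/

section Transport

variable {V W : Type*} [Fintype V] [DecidableEq V] [Fintype W] [DecidableEq W]

/-- Extension by zero of a lattice point along an embedding of the sets of variables. -/
noncomputable def extendAlong (f : W ↪ V) (y : W → ℕ) : V → ℕ := Function.extend f y 0

@[simp] theorem extendAlong_apply (f : W ↪ V) (y : W → ℕ) (w : W) :
    extendAlong f y (f w) = y w := f.injective.extend_apply y 0 w

theorem extendAlong_of_notMem (f : W ↪ V) (y : W → ℕ) {v : V} (hv : ∀ w, f w ≠ v) :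
    extendAlong f y v = 0 :=
  Function.extend_apply' y (0 : V → ℕ) v fun ⟨w, hw⟩ => hv w hw

theorem extendAlong_injective (f : W ↪ V) : Function.Injective (extendAlong f) := fun y z h => by
  funext w
  rw [← extendAlong_apply f y, h, extendAlong_apply]

theorem exists_of_extendAlong_ne_zero {f : W ↪ V} {y : W → ℕ} {v : V}
    (h : extendAlong f y v ≠ 0) : ∃ w, f w = v ∧ y w ≠ 0 := by
  by_cases hv : ∃ w, f w = v
  · obtain ⟨w, rfl⟩ := hv
    exact ⟨w, rfl, by simpa using h⟩
  · push Not at hv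
    exact absurd (extendAlong_of_notMem f y hv) h

theorem extendAlong_comp {f : W ↪ V} {y : V → ℕ} (hy : ∀ i, y i ≠ 0 → i ∈ Set.range f) :
    extendAlong f (y ∘ f) = y := by
  funext v
  by_cases hv : ∃ w, f w = v
  · obtain ⟨w, rfl⟩ := hv
    simp
  · by_cases h0 : y v = 0
    · rw [h0]
      push Not at hv
      exact extendAlong_of_notMem f _ hv
    · exact absurd (hy v h0) hv

theorem deg_extendAlong (f : W ↪ V) (y : W → ℕ) : deg (extendAlong f y) = deg y := by
  rw [deg, deg, ← Finset.sum_subset (Finset.subset_univ (Finset.univ.map f))]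
  · simp
  · intro v _ hv
    refine extendAlong_of_notMem f y fun w hw => hv ?_
    simp [← hw]

theorem extendAlong_le_iff {f : W ↪ V} {y z : W → ℕ} :
    extendAlong f y ≤ extendAlong f z ↔ y ≤ z := by
  constructor
  · intro h w
    have := h (f w)
    simpa using this
  · intro h v
    by_cases hv : ∃ w, f w = v
    · obtain ⟨w, rfl⟩ := hv
      simpa using h w
    · push Not at hv
      rw [extendAlong_of_notMem f y hv]
      exact Nat.zero_le _

theorem extendAlong_e (f : W ↪ V) (w : W) : extendAlong f (e w) = e (f w) := by
  funext v
  by_cases hv : ∃ w, f w = v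
  · obtain ⟨w', rfl⟩ := hv
    simp [e_apply]
  · push Not at hv
    rw [extendAlong_of_notMem f _ hv, e_ne (hv w).symm]

theorem extendAlong_zero (f : W ↪ V) : extendAlong f 0 = 0 := by
  rw [← deg_eq_zero, deg_extendAlong, deg_zero]

theorem extendAlong_add (f : W ↪ V) (y z : W → ℕ) :
    extendAlong f (y + z) = extendAlong f y + extendAlong f z := by
  funext v
  by_cases hv : ∃ w, f w = v
  · obtain ⟨w', rfl⟩ := hv
    simp
  · push Not at hv
    simp [extendAlong_of_notMem f _ hv]

theorem le_extendAlong {f : W ↪ V} {y : V → ℕ} {z : W → ℕ} (h : y ≤ extendAlong f z) :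
    extendAlong f (y ∘ f) = y := by
  refine extendAlong_comp fun i hi => ?_
  have h1 : y i ≤ extendAlong f z i := h i
  obtain ⟨w, hw, -⟩ := exists_of_extendAlong_ne_zero (f := f) (y := z) (v := i) (by omega)
  exact ⟨w, hw⟩

theorem degEq_image_extendAlong (f : W ↪ V) (l : Finset (W → ℕ)) (j : ℕ) :
    degEq (l.image (extendAlong f)) j = (degEq l j).image (extendAlong f) := by
  simp only [degEq, Finset.filter_image, deg_extendAlong]

theorem degGe_image_extendAlong (f : W ↪ V) (l : Finset (W → ℕ)) (j : ℕ) :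
    degGe (l.image (extendAlong f)) j = (degGe l j).image (extendAlong f) := by
  simp only [degGe, Finset.filter_image, deg_extendAlong]

/-- Needed because `δ` and the pieces `π_i` live in their own variables, whereas the decomposition
takes place inside `V`. -/
theorem isHydralOn_image_extendAlong {f : W ↪ V} {l : Finset (W → ℕ)} {m : ℕ} :
    IsHydralOn (Finset.univ.map f) (l.image (extendAlong f)) m ↔
      IsHydralOn Finset.univ l m := by
  have hmem : ∀ y, extendAlong f y ∈ l.image (extendAlong f) ↔ y ∈ l := fun y => by
    rw [(extendAlong_injective f).mem_finset_image]
  have h2 : hilb (l.image (extendAlong f)) 2 = hilb l 2 := by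
    rw [hilb, degEq_image_extendAlong, Finset.card_image_of_injective _ (extendAlong_injective f),
      hilb]
  have h3 : (degGe (l.image (extendAlong f)) 3).card = (degGe l 3).card := by
    rw [degGe_image_extendAlong, Finset.card_image_of_injective _ (extendAlong_injective f)]
  constructor
  · intro h
    refine ⟨?_, ?_, by simp, ?_, ?_, ?_, ?_⟩
    · intro a ha y hy
      exact (hmem y).1 (h.isPartition _ ((hmem a).2 ha) _ (extendAlong_le_iff.2 hy))
    · rw [← hmem, extendAlong_zero]
      exact h.zero_mem
    · intro i _
      rw [← hmem, extendAlong_e]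
      exact h.e_mem _ (by simp)
    · rw [← h2, h.hilb_two, Finset.card_map]
    · intro y hy h0
      obtain ⟨z, hz, hyz, hd⟩ := h.exists_le _ ((hmem y).2 hy)
        (by rw [← extendAlong_zero f]; exact (extendAlong_injective f).ne h0)
      obtain ⟨z, hz', rfl⟩ := Finset.mem_image.1 hz
      rw [deg_extendAlong] at hd
      exact ⟨z, hz', extendAlong_le_iff.1 hyz, hd⟩
    · rw [← h3, h.card_degGe]
  · intro h
    refine ⟨?_, ?_, ?_, ?_, ?_, ?_, ?_⟩
    · intro a ha y hy
      obtain ⟨a, ha', rfl⟩ := Finset.mem_image.1 ha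
      have hy' := le_extendAlong hy
      rw [← hy', hmem]
      rw [← hy', extendAlong_le_iff] at hy
      exact h.isPartition _ ha' _ hy
    · rw [← extendAlong_zero f, hmem]
      exact h.zero_mem
    · intro y hy i hi
      obtain ⟨y, hy, rfl⟩ := Finset.mem_image.1 hy
      obtain ⟨w, rfl, -⟩ := exists_of_extendAlong_ne_zero hi
      simp
    · intro i hi
      obtain ⟨w, -, rfl⟩ := Finset.mem_map.1 hi
      rw [← extendAlong_e, hmem]
      exact h.e_mem w (by simp)
    · rw [h2, h.hilb_two, Finset.card_map]
    · intro y hy h0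
      obtain ⟨y, hy', rfl⟩ := Finset.mem_image.1 hy
      obtain ⟨z, hz, hyz, hd⟩ := h.exists_le y hy' fun h => h0 (by rw [h, extendAlong_zero])
      exact ⟨_, (hmem z).2 hz, extendAlong_le_iff.2 hyz, by rwa [deg_extendAlong]⟩
    · rw [h3, h.card_degGe]

theorem image_extendAlong_image_comp {f : W ↪ V} {l : Finset (V → ℕ)}
    (hl : ∀ y ∈ l, ∀ i, y i ≠ 0 → i ∈ Finset.univ.map f) :
    (l.image (· ∘ f)).image (extendAlong f) = l := by
  rw [Finset.image_image]
  refine (Finset.image_congr fun y hy => ?_).trans Finset.image_id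
  refine extendAlong_comp fun i hi => ?_
  simpa using hl y hy i hi

end Transport

/-! ### The graph of degree-two elements and its components -/

section Components

variable {V : Type*} [Fintype V] [DecidableEq V]

/-- A lattice point as a rational vector. -/
def toRat (y : V → ℕ) : V → ℚ := fun i => (y i : ℚ)

theorem toRat_add (y z : V → ℕ) : toRat (y + z) = toRat y + toRat z := by
  funext i
  simp [toRat]

/-- The three products of two of the variables `x`, `y`, `z` lie in `l`. -/
def IsTriangle (l : Finset (V → ℕ)) (x y z : V) : Prop :=
  e x + e y ∈ l ∧ e x + e z ∈ l ∧ e y + e z ∈ l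

theorem IsPartition.isTriangle {l : Finset (V → ℕ)} (hl : IsPartition l) {x y z : V}
    (h : e x + e y + e z ∈ l) : IsTriangle l x y z := by
  refine ⟨hl _ h _ fun i => ?_, hl _ h _ fun i => ?_, hl _ h _ fun i => ?_⟩ <;>
    simp only [Pi.add_apply] <;> omega

theorem IsHydralOn.exists_cube {S : Finset V} {l : Finset (V → ℕ)} {m : ℕ}
    (h : IsHydralOn S l m) {x y : V} (hxy : e x + e y ∈ l) : ∃ z, e x + e y + e z ∈ l := by
  have hd : deg (e x + e y) = 2 := by simp [deg_add]
  obtain ⟨z, hz, hle, h3⟩ := h.exists_le _ hxy fun h0 => by simp [h0] at hd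
  obtain ⟨a, ha⟩ := exists_add_e_le hle (by omega)
  exact ⟨a, h.isPartition z hz _ ha⟩

theorem IsHydralOn.exists_isTriangle_of_add_mem {S : Finset V} {l : Finset (V → ℕ)} {m : ℕ}
    (h : IsHydralOn S l m) {x y : V} (hxy : e x + e y ∈ l) : ∃ z, IsTriangle l x y z := by
  obtain ⟨z, hz⟩ := h.exists_cube hxy
  exact ⟨z, h.isPartition.isTriangle hz⟩

theorem IsHydralOn.exists_add_mem {S : Finset V} {l : Finset (V → ℕ)} {m : ℕ}
    (h : IsHydralOn S l m) {x : V} (hx : x ∈ S) : ∃ y, e x + e y ∈ l := by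
  obtain ⟨z, hz, hle, h3⟩ := h.exists_le _ (h.e_mem x hx) (e_ne_zero x)
  obtain ⟨a, ha⟩ := exists_add_e_le hle (by rw [deg_e]; omega)
  exact ⟨a, h.isPartition z hz _ ha⟩

theorem IsHydralOn.mem_of_add_mem {S : Finset V} {l : Finset (V → ℕ)} {m : ℕ}
    (h : IsHydralOn S l m) {x y : V} (hxy : e x + e y ∈ l) : x ∈ S ∧ y ∈ S :=
  ⟨h.support _ hxy x (by simp), h.support _ hxy y (by simp)⟩

theorem add_mem_degEq {l : Finset (V → ℕ)} {x y : V} :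
    e x + e y ∈ degEq l 2 ↔ e x + e y ∈ l := by
  simp [mem_degEq, deg_add]

/-- An edge at `x` extends to a triangle `x, y, z`, and `e_x` is half of the sum of the two edges at
`x` minus the opposite edge. -/
theorem IsHydralOn.toRat_e_mem_span {S : Finset V} {l : Finset (V → ℕ)} {m : ℕ}
    (h : IsHydralOn S l m) {x : V} (hx : x ∈ S) :
    toRat (e x) ∈ Submodule.span ℚ (Set.range fun y : degEq l 2 => toRat (y : V → ℕ)) := by
  obtain ⟨y, hy⟩ := h.exists_add_mem hx
  obtain ⟨z, h1, h2, h3⟩ := h.exists_isTriangle_of_add_mem hy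
  have hmem : ∀ a b, e a + e b ∈ l → toRat (e a) + toRat (e b) ∈
      Submodule.span ℚ (Set.range fun y : degEq l 2 => toRat (y : V → ℕ)) := by
    intro a b hab
    rw [← toRat_add]
    exact Submodule.subset_span ⟨⟨_, add_mem_degEq.2 hab⟩, rfl⟩
  have : toRat (e x) = (1 / 2 : ℚ) • ((toRat (e x) + toRat (e y)) + (toRat (e x) + toRat (e z)) -
      (toRat (e y) + toRat (e z))) := by
    funext i
    simp only [Pi.smul_apply, Pi.add_apply, Pi.sub_apply, smul_eq_mul]
    ring
  rw [this]
  exact Submodule.smul_mem _ _ (Submodule.sub_mem _ (Submodule.add_mem _ (hmem _ _ h1)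
    (hmem _ _ h2)) (hmem _ _ h3))

theorem linearIndependent_toRat_e (S : Finset V) :
    LinearIndependent ℚ fun x : S => toRat (e (x : V)) := by
  have h := (Pi.basisFun ℚ V).linearIndependent.comp (fun x : S => (x : V))
    Subtype.val_injective
  convert h using 1
  funext x i
  simp [toRat, e_apply, Pi.single_apply]

/-- The span of the edges contains `|S|` independent vectors, and there are only `|S|` edges. This
is where the equality of the Hilbert function in degrees one and two becomes a rigidity statement.
-/
theorem IsHydralOn.linearIndepOn {S : Finset V} {l : Finset (V → ℕ)} {m : ℕ}
    (h : IsHydralOn S l m) : LinearIndepOn ℚ toRat (degEq l 2 : Set (V → ℕ)) := by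
  have : LinearIndependent ℚ fun y : degEq l 2 => toRat (y : V → ℕ) := by
    rw [linearIndependent_iff_card_le_finrank_span, Fintype.card_coe]
    have h1 := finrank_span_eq_card (linearIndependent_toRat_e S)
    rw [Fintype.card_coe, ← h.hilb_two] at h1
    change hilb l 2 ≤ _
    rw [← h1, Set.finrank]
    refine Submodule.finrank_mono (Submodule.span_le.2 ?_)
    rintro _ ⟨x, rfl⟩
    exact h.toRat_e_mem_span x.2
  exact this

/-- The combination of elements of degree two that represents `2 e_x`. -/
noncomputable def triangleRep (x y z : V) : (V → ℕ) →₀ ℚ :=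
  Finsupp.single (e x + e y) 1 + Finsupp.single (e x + e z) 1 - Finsupp.single (e y + e z) 1

theorem linearCombination_triangleRep (x y z : V) :
    Finsupp.linearCombination ℚ toRat (triangleRep x y z) = (2 : ℚ) • toRat (e x) := by
  simp only [triangleRep, map_add, map_sub, Finsupp.linearCombination_single, toRat_add, one_smul]
  funext i
  simp only [Pi.smul_apply, Pi.add_apply, Pi.sub_apply, smul_eq_mul]
  ring

theorem IsTriangle.rep_mem_supported {l : Finset (V → ℕ)} {x y z : V} (h : IsTriangle l x y z) :
    triangleRep x y z ∈ Finsupp.supported ℚ ℚ (degEq l 2 : Set (V → ℕ)) := by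
  have hs : ∀ a b, e a + e b ∈ l → Finsupp.single (e a + e b) (1 : ℚ) ∈
      Finsupp.supported ℚ ℚ (degEq l 2 : Set (V → ℕ)) := fun a b hab =>
    Finsupp.single_mem_supported ℚ _ (add_mem_degEq.2 hab)
  exact Submodule.sub_mem _ (Submodule.add_mem _ (hs _ _ h.1) (hs _ _ h.2.1)) (hs _ _ h.2.2)

/-- Both combinations represent `2 e_x` in terms of linearly independent vectors. -/
theorem IsHydralOn.triangleRep_eq {S : Finset V} {l : Finset (V → ℕ)} {m : ℕ}
    (h : IsHydralOn S l m) {x y z y' z' : V} (h₁ : IsTriangle l x y z)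
    (h₂ : IsTriangle l x y' z') : triangleRep x y z = triangleRep x y' z' := by
  have h3 := linearIndepOn_iff.1 h.linearIndepOn (triangleRep x y z - triangleRep x y' z')
    (Submodule.sub_mem _ h₁.rep_mem_supported h₂.rep_mem_supported)
    (by rw [map_sub, linearCombination_triangleRep, linearCombination_triangleRep, sub_self])
  exact sub_eq_zero.1 h3

/-- The only negative summand sits at `e y + e z`; when `x` is `y` or `z` it cancels against one of
the positive ones. -/
theorem triangleRep_apply_nonneg {x y z a b : V}
    (h : e y + e z ≠ e a + e b ∨ x = y ∨ x = z) : 0 ≤ triangleRep x y z (e a + e b) := by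
  simp only [triangleRep, Finsupp.sub_apply, Finsupp.add_apply, Finsupp.single_apply]
  rcases h with h | rfl | rfl
  · rw [if_neg h]
    split_ifs <;> norm_num
  · split_ifs <;> norm_num
  · rw [add_comm (e y) (e x)]
    split_ifs <;> norm_num

theorem triangleRep_apply_neg {x y z : V} (hy : x ≠ y) (hz : x ≠ z) :
    triangleRep x y z (e y + e z) < 0 := by
  simp only [triangleRep, Finsupp.sub_apply, Finsupp.add_apply, Finsupp.single_apply,
    e_add_e_eq_iff]
  grind

/-- The representation of `2 e_x` does not depend on the triangle. If `x` is not one of `y`, `z`, it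
is negative precisely at the opposite edge, which therefore has to be the opposite edge of the other
triangle too. The last alternative covers the case where both triangles use the loop at `x`. -/
theorem IsHydralOn.isTriangle_unique {S : Finset V} {l : Finset (V → ℕ)} {m : ℕ}
    (h : IsHydralOn S l m) {x y z y' z' : V} (h₁ : IsTriangle l x y z)
    (h₂ : IsTriangle l x y' z') :
    (y = y' ∧ z = z') ∨ (y = z' ∧ z = y') ∨ ((x = y ∨ x = z) ∧ (x = y' ∨ x = z')) := by
  have key : ∀ {y z y' z' : V}, IsTriangle l x y z → IsTriangle l x y' z' →
      x ≠ y → x ≠ z → (y = y' ∧ z = z') ∨ (y = z' ∧ z = y') := by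
    intro y z y' z' h₁ h₂ hy hz
    have h3 := triangleRep_apply_neg hy hz
    rw [h.triangleRep_eq h₁ h₂] at h3
    by_contra hc
    rw [← e_add_e_eq_iff] at hc
    exact absurd (triangleRep_apply_nonneg (Or.inl (Ne.symm hc))) (not_le.2 h3)
  by_cases ha : x = y ∨ x = z
  · by_cases hb : x = y' ∨ x = z'
    · exact Or.inr (Or.inr ⟨ha, hb⟩)
    · push Not at hb
      rcases key h₂ h₁ hb.1 hb.2 with h4 | h4
      · exact Or.inl ⟨h4.1.symm, h4.2.symm⟩
      · exact Or.inr (Or.inl ⟨h4.2.symm, h4.1.symm⟩)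
  · push Not at ha
    rcases key h₁ h₂ ha.1 ha.2 with h4 | h4
    · exact Or.inl h4
    · exact Or.inr (Or.inl h4)

/-- A loop at `w` would give `w` the triangle `w, w, w` besides the triangle `w, v, v`, whose
opposite edge avoids `w`. -/
theorem IsHydralOn.not_loop {S : Finset V} {l : Finset (V → ℕ)} {m : ℕ}
    (h : IsHydralOn S l m) {v w : V} (hv : e v + e v ∈ l) (hw : e v + e w ∈ l) (hvw : w ≠ v) :
    e w + e w ∉ l := fun hww => by
  rw [add_comm] at hw
  have := h.isTriangle_unique (x := w) (y := v) (z := v) (y' := w) (z' := w) ⟨hw, hw, hv⟩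
    ⟨hww, hww, hww⟩
  tauto

/-- The triangle `w, v, v` is the only one at `w`, and every edge at `w` lies in a triangle. -/
theorem IsHydralOn.eq_of_add_mem {S : Finset V} {l : Finset (V → ℕ)} {m : ℕ}
    (h : IsHydralOn S l m) {v w u : V} (hv : e v + e v ∈ l) (hw : e v + e w ∈ l) (hvw : w ≠ v)
    (hu : e w + e u ∈ l) : u = v := by
  have hl := h.not_loop hv hw hvw
  rw [add_comm] at hw
  obtain ⟨z, hz⟩ := h.exists_isTriangle_of_add_mem hu
  rcases h.isTriangle_unique hz (y' := v) (z' := v) ⟨hw, hw, hv⟩ with h1 | h1 | h1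
  · exact h1.1
  · exact h1.1
  · tauto

/-- The variables of `B` are joined to the head `v` and to nothing else. -/
def IsStarOn (B : Finset V) (v : V) (l : Finset (V → ℕ)) (m : ℕ) : Prop :=
  IsHydralOn B l m ∧ v ∈ B ∧ degEq l 2 = B.image fun i => e v + e i

/-- The square-free cubic in the three variables of `B`, with its divisors. -/
def IsCubicOn (B : Finset V) (l : Finset (V → ℕ)) (m : ℕ) : Prop :=
  B.card = 3 ∧ m = 1 ∧ l = Finset.Iic (∑ i ∈ B, e i)

/-- A connected piece of a hydral partition: a star with a given head, or a square-free cubic. -/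
def IsBlock (B : Finset V) : Option V → Finset (V → ℕ) → ℕ → Prop
  | some v => IsStarOn B v
  | none => IsCubicOn B

theorem sum_e_apply (B : Finset V) (i : V) : (∑ j ∈ B, e j) i = if i ∈ B then 1 else 0 := by
  rw [Finset.sum_apply]
  simp [e_apply]

theorem card_image_head (B : Finset V) (v : V) :
    (B.image fun i => e v + e i).card = B.card :=
  Finset.card_image_of_injective _ fun _ _ h => e_injective (add_left_cancel h)

theorem IsCubicOn.isHydralOn {B : Finset V} {l : Finset (V → ℕ)} {m : ℕ}
    (h : IsCubicOn B l m) : IsHydralOn B l m := by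
  obtain ⟨hB, rfl, rfl⟩ := h
  obtain ⟨a, b, c, hab, hac, hbc, rfl⟩ := Finset.card_eq_three.1 hB
  have hsum : ∑ i ∈ ({a, b, c} : Finset V), e i = e a + e b + e c := by
    rw [Finset.sum_insert (by simp [hab, hac]), Finset.sum_insert (by simp [hbc]),
      Finset.sum_singleton, add_assoc]
  have h1 : ∀ y : V → ℕ, y ≤ ∑ i ∈ ({a, b, c} : Finset V), e i → ∀ i, y i ≠ 0 →
      i ∈ ({a, b, c} : Finset V) ∧ y i = 1 := by
    intro y hy i hi
    have h2 : y i ≤ (∑ j ∈ ({a, b, c} : Finset V), e j) i := hy i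
    rw [sum_e_apply] at h2
    split_ifs at h2 with h3
    · exact ⟨h3, by omega⟩
    · omega
  have hd3 : deg (∑ i ∈ ({a, b, c} : Finset V), e i) = 3 := by
    simp [hsum, deg_add]
  refine ⟨?_, ?_, ?_, ?_, ?_, ?_, ?_⟩
  · intro a ha y hy
    rw [Finset.mem_Iic] at ha ⊢
    exact hy.trans ha
  · exact Finset.mem_Iic.2 fun _ => Nat.zero_le _
  · intro y hy i hi
    exact (h1 y (Finset.mem_Iic.1 hy) i hi).1
  · intro i hi
    rw [Finset.mem_Iic, e_le_iff, sum_e_apply, if_pos hi]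
    exact one_ne_zero
  · rw [hB, hilb]
    have : degEq (Finset.Iic (∑ i ∈ ({a, b, c} : Finset V), e i)) 2 =
        {e a + e b, e a + e c, e b + e c} := by
      ext y
      rw [mem_degEq, Finset.mem_Iic]
      constructor
      · rintro ⟨hy, hd⟩
        obtain ⟨x, z, rfl⟩ := exists_eq_e_add_e hd
        have hx := h1 _ hy x (by simp)
        have hz := h1 _ hy z (by simp)
        simp only [Pi.add_apply, e_apply, Finset.mem_insert, Finset.mem_singleton] at hx hz
        simp only [Finset.mem_insert, Finset.mem_singleton, e_add_e_eq_iff]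
        grind
      · intro hy
        rw [hsum]
        simp only [Finset.mem_insert, Finset.mem_singleton] at hy
        rcases hy with rfl | rfl | rfl
        · exact ⟨fun i => by simp only [Pi.add_apply]; omega, by simp [deg_add]⟩
        · exact ⟨fun i => by simp only [Pi.add_apply]; omega, by simp [deg_add]⟩
        · exact ⟨fun i => by simp only [Pi.add_apply]; omega, by simp [deg_add]⟩
    rw [this]
    refine Finset.card_eq_three.2 ⟨_, _, _, ?_, ?_, ?_, rfl⟩ <;> rw [Ne, e_add_e_eq_iff] <;> grind
  · intro y hy _
    exact ⟨_, Finset.mem_Iic.2 le_rfl, Finset.mem_Iic.1 hy, hd3.ge⟩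
  · rw [Finset.card_eq_one]
    refine ⟨∑ i ∈ ({a, b, c} : Finset V), e i, ?_⟩
    ext y
    rw [mem_degGe, Finset.mem_Iic, Finset.mem_singleton]
    constructor
    · rintro ⟨hy, hd⟩
      exact eq_of_le_of_deg_le hy (by rw [hd3]; exact hd)
    · rintro rfl
      exact ⟨le_rfl, hd3.ge⟩

theorem IsBlock.isHydralOn {B : Finset V} {c : Option V} {l : Finset (V → ℕ)} {m : ℕ}
    (h : IsBlock B c l m) : IsHydralOn B l m := by
  cases c with
  | none => exact IsCubicOn.isHydralOn h
  | some v => exact h.1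

/-- Each neighbour of the looped vertex `v` other than `v` has `v` as its only neighbour, so the
neighbourhood of `v` is closed and all its edges pass through `v`. -/
theorem IsHydralOn.exists_star {S : Finset V} {l : Finset (V → ℕ)} {m : ℕ}
    (h : IsHydralOn S l m) {v : V} (hv : e v + e v ∈ l) :
    let B := S.filter fun b => e v + e b ∈ l
    IsSeparated l B ∧ IsStarOn B v (restrict l B) (degGe (restrict l B) 3).card := by
  intro B
  have hmem : ∀ b, b ∈ B ↔ e v + e b ∈ l := fun b => by
    rw [Finset.mem_filter]
    exact ⟨fun hb => hb.2, fun hb => ⟨(h.mem_of_add_mem hb).2, hb⟩⟩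
  have hsep : IsSeparated l B := by
    intro a ha b hab
    rw [hmem] at ha ⊢
    by_cases hav : a = v
    · rwa [hav] at hab
    · rw [h.eq_of_add_mem hv ha hav hab]
      exact hv
  have h2 : degEq (restrict l B) 2 = B.image fun i => e v + e i := by
    ext y
    rw [mem_degEq, mem_restrict, Finset.mem_image]
    constructor
    · rintro ⟨⟨hy, hs⟩, hd⟩
      obtain ⟨a, b, rfl⟩ := exists_eq_e_add_e hd
      have ha := (hmem a).1 (hs a (by simp))
      by_cases hav : a = v
      · exact ⟨b, hs b (by simp), by rw [hav]⟩
      · rw [h.eq_of_add_mem hv ha hav hy]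
        exact ⟨a, (hmem a).2 ha, add_comm _ _⟩
    · rintro ⟨b, hb, rfl⟩
      refine ⟨⟨(hmem b).1 hb, fun i hi => ?_⟩, by simp [deg_add]⟩
      simp only [Pi.add_apply, e_apply] at hi
      have : i = v ∨ i = b := by by_contra! hc; simp [hc] at hi
      rcases this with rfl | rfl
      · exact (hmem _).2 hv
      · exact hb
  refine ⟨hsep, ?_, (hmem v).2 hv, h2⟩
  refine (hsep.isHydralOn_restrict h (Finset.filter_subset _ _) ?_).1
  rw [hilb, h2, card_image_head]

/-- Without loops, uniqueness of the triangle at each of the three vertices forbids edges leaving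
the triangle. An exponent of two or more would produce a loop, so every element supported on the
triangle divides `xyz`. -/
theorem IsHydralOn.exists_cubic {S : Finset V} {l : Finset (V → ℕ)} {m : ℕ}
    (h : IsHydralOn S l m) {x y z : V} (hxyz : e x + e y + e z ∈ l) (hx : e x + e x ∉ l)
    (hy : e y + e y ∉ l) (hz : e z + e z ∉ l) :
    ({x, y, z} : Finset V) ⊆ S ∧ IsSeparated l {x, y, z} ∧
      IsCubicOn {x, y, z} (restrict l {x, y, z}) 1 := by
  have ht := h.isPartition.isTriangle hxyz
  obtain ⟨h1, h2, h3⟩ := ht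
  have hxy : x ≠ y := by rintro rfl; exact hx h1
  have hxz : x ≠ z := by rintro rfl; exact hx h2
  have hyz : y ≠ z := by rintro rfl; exact hy h3
  have key : ∀ {x y z : V}, IsTriangle l x y z → x ≠ y → x ≠ z → ∀ b, e x + e b ∈ l →
      b = y ∨ b = z := by
    intro x y z ht hxy hxz b hb
    obtain ⟨z', hz'⟩ := h.exists_isTriangle_of_add_mem hb
    have := h.isTriangle_unique ht hz'
    tauto
  have hsum : ∑ i ∈ ({x, y, z} : Finset V), e i = e x + e y + e z := by
    rw [Finset.sum_insert (by simp [hxy, hxz]), Finset.sum_insert (by simp [hyz]),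
      Finset.sum_singleton, add_assoc]
  refine ⟨?_, ?_, ?_, rfl, ?_⟩
  · intro i hi
    simp only [Finset.mem_insert, Finset.mem_singleton] at hi
    rcases hi with rfl | rfl | rfl
    · exact (h.mem_of_add_mem h1).1
    · exact (h.mem_of_add_mem h1).2
    · exact (h.mem_of_add_mem h2).2
  · intro a ha b hab
    simp only [Finset.mem_insert, Finset.mem_singleton] at ha ⊢
    rcases ha with rfl | rfl | rfl
    · exact Or.inr (key ⟨h1, h2, h3⟩ hxy hxz b hab)
    · have := key (x := a) (y := x) (z := z) ⟨by rwa [add_comm], h3, h2⟩ hxy.symm hyz b hab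
      tauto
    · have := key (x := a) (y := x) (z := y) ⟨by rwa [add_comm], by rwa [add_comm], h1⟩
        hxz.symm hyz.symm b hab
      tauto
  · exact Finset.card_eq_three.2 ⟨x, y, z, hxy, hxz, hyz, rfl⟩
  · ext w
    rw [mem_restrict, Finset.mem_Iic]
    constructor
    · rintro ⟨hw, hs⟩ i
      change w i ≤ _
      rw [sum_e_apply]
      by_cases hi : w i = 0
      · omega
      · rw [if_pos (hs i hi)]
        by_contra! h4
        have h5 : e i + e i ∈ l := h.isPartition w hw _ fun j => by
          change e i j + e i j ≤ w j
          rw [e_apply]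
          split_ifs with hj
          · subst hj; omega
          · omega
        have := hs i hi
        simp only [Finset.mem_insert, Finset.mem_singleton] at this
        rcases this with rfl | rfl | rfl <;> contradiction
    · intro hw
      refine ⟨h.isPartition _ hxyz _ (hsum ▸ hw), fun i hi => ?_⟩
      have h6 : w i ≤ (∑ j ∈ ({x, y, z} : Finset V), e j) i := hw i
      rw [sum_e_apply] at h6
      by_contra h7
      rw [if_neg h7] at h6
      omega

/-- Every variable of a hydral partition lies in a separated block. -/
theorem IsHydralOn.exists_block {S : Finset V} {l : Finset (V → ℕ)} {m : ℕ}
    (h : IsHydralOn S l m) {x : V} (hx : x ∈ S) :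
    ∃ B, x ∈ B ∧ B ⊆ S ∧ IsSeparated l B ∧ ∃ c i, IsBlock B c (restrict l B) i := by
  -- Either `x` is joined to a looped vertex, possibly itself, and lies in its star, or every
  -- triangle through `x` is loopless, since its vertices are all joined to `x`.
  by_cases hlp : ∃ v, e v + e v ∈ l ∧ e v + e x ∈ l
  · obtain ⟨v, hv, hvx⟩ := hlp
    obtain ⟨h1, h2⟩ := h.exists_star hv
    exact ⟨_, Finset.mem_filter.2 ⟨hx, hvx⟩, Finset.filter_subset _ _, h1, some v, _, h2⟩
  · push Not at hlp
    obtain ⟨y, hy⟩ := h.exists_add_mem hx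
    obtain ⟨z, hz⟩ := h.exists_cube hy
    obtain ⟨h1, h2, h3⟩ := h.isPartition.isTriangle hz
    obtain ⟨h4, h5, h6⟩ := h.exists_cubic hz (fun hxx => hlp x hxx hxx)
      (fun hyy => hlp y hyy (by rwa [add_comm])) fun hzz => hlp z hzz (by rwa [add_comm])
    exact ⟨{x, y, z}, by simp, h4, h5, none, _, h6⟩

end Components

/-! ### Removing the block of one variable -/

section Recursion

variable {V : Type*} [Fintype V] [DecidableEq V]

/-- A block is connected: any two vertices are joined through the head of the star, or directly in
the triangle. So a separated set that meets it contains it. -/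
theorem IsBlock.subset_of_isSeparated {B B' : Finset V} {c : Option V} {l : Finset (V → ℕ)} {i : ℕ}
    (h : IsBlock B c (restrict l B) i) (hs : IsSeparated l B') {x : V} (hx : x ∈ B)
    (hx' : x ∈ B') : B ⊆ B' := by
  intro b hb
  cases c with
  | some v =>
    obtain ⟨h, hv, h2⟩ := h
    have hmem : ∀ b ∈ B, e v + e b ∈ l := fun b hb => by
      have : e v + e b ∈ degEq (restrict l B) 2 := by
        rw [h2]
        exact Finset.mem_image_of_mem _ hb
      exact (mem_restrict.1 (mem_degEq.1 this).1).1
    have hvB : v ∈ B' := hs x hx' v (by rw [add_comm]; exact hmem x hx)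
    exact hs v hvB b (hmem b hb)
  | none =>
    obtain ⟨-, -, h2⟩ := h
    by_cases hxb : x = b
    · exact hxb ▸ hx'
    · have : e x + e b ∈ restrict l B := by
        rw [h2, Finset.mem_Iic]
        refine e_add_e_le hxb ?_ ?_
        · rw [sum_e_apply, if_pos hx]
          exact one_ne_zero
        · rw [sum_e_apply, if_pos hb]
          exact one_ne_zero
      exact hs x hx' b (mem_restrict.1 this).1

/-- A star has exactly one loop, at its head, and a square-free cubic has none. -/
theorem IsBlock.index_unique {B : Finset V} {c c' : Option V} {l : Finset (V → ℕ)} {i i' : ℕ}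
    (h : IsBlock B c l i) (h' : IsBlock B c' l i') : c = c' := by
  have hsc : ∀ v i i', IsStarOn B v l i → ¬ IsCubicOn B l i' := by
    rintro v i i' ⟨-, hv, h2⟩ ⟨-, -, h3⟩
    have : e v + e v ∈ degEq l 2 := by
      rw [h2]
      exact Finset.mem_image_of_mem _ hv
    have := (mem_degEq.1 this).1
    rw [h3, Finset.mem_Iic] at this
    have h4 : (e v + e v) v ≤ (∑ i ∈ B, e i) v := this v
    rw [sum_e_apply, if_pos hv, Pi.add_apply, e_self] at h4
    omega
  cases c with
  | none =>
    cases c' with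
    | none => rfl
    | some v' => exact absurd h (hsc v' _ _ h')
  | some v =>
    cases c' with
    | none => exact absurd h' (hsc v _ _ h)
    | some v' =>
      obtain ⟨-, hv, h2⟩ := h
      obtain ⟨-, hv', h3⟩ := h'
      have : e v + e v ∈ degEq l 2 := by
        rw [h2]
        exact Finset.mem_image_of_mem _ hv
      rw [h3, Finset.mem_image] at this
      obtain ⟨a, -, ha⟩ := this
      rw [e_add_e_eq_iff] at ha
      rcases ha with ha | ha <;> rw [ha.1]

/-- The multiples of `e i` by `0, …, y i` are distinct elements of `l`. This confines partitions of
given size to a box and bounds the exponents along the head of a star. -/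
theorem IsPartition.apply_lt_card {l : Finset (V → ℕ)} (hl : IsPartition l) {y : V → ℕ}
    (hy : y ∈ l) (i : V) : y i < l.card := by
  have hinj : Function.Injective fun a : ℕ => a • e i := fun a b hab => by
    have := congrFun hab i
    simpa using this
  have h1 : (Finset.range (y i + 1)).image (fun a => a • e i) ⊆ l := by
    intro z hz
    obtain ⟨a, ha, rfl⟩ := Finset.mem_image.1 hz
    refine hl y hy _ fun j => ?_
    change a • e i j ≤ y j
    rw [e_apply]
    rw [Finset.mem_range] at ha
    split_ifs with hj
    · subst hj
      rw [smul_eq_mul]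
      omega
    · simp
  have h2 := Finset.card_le_card h1
  rw [Finset.card_image_of_injective _ hinj, Finset.card_range] at h2
  omega

/-- Finiteness is what allows `Nat.card` of a dependent sum to be expanded as a sum of
cardinalities. -/
instance finite_isHydralOn (S : Finset V) (m : ℕ) :
    Finite {l : Finset (V → ℕ) // IsHydralOn S l m} := by
  have hfin : Set.Finite {l : Finset (V → ℕ) | IsHydralOn S l m} := by
    refine Set.Finite.subset (Finset.finite_toSet (Finset.powerset
      (Fintype.piFinset fun _ : V => Finset.range (1 + S.card + S.card + m)))) ?_
    intro l hl
    rw [Finset.mem_coe, Finset.mem_powerset]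
    intro y hy
    rw [Fintype.mem_piFinset]
    intro i
    have h1 := hl.isPartition.apply_lt_card hy i
    rw [card_eq_of_zero_mem hl.zero_mem, hl.hilb_one, hl.hilb_two, hl.card_degGe] at h1
    exact Finset.mem_range.2 h1
  exact hfin.to_subtype

instance finite_isBlock (B : Finset V) (c : Option V) (m : ℕ) :
    Finite {l : Finset (V → ℕ) // IsBlock B c l m} :=
  Finite.of_injective (β := {l : Finset (V → ℕ) // IsHydralOn B l m})
    (fun l => ⟨l.1, IsBlock.isHydralOn l.2⟩) fun l l' h => by
      have := congrArg Subtype.val h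
      exact Subtype.ext this

theorem isSeparated_union {S T : Finset V} (hST : Disjoint S T) {l₁ l₂ : Finset (V → ℕ)}
    (h₁ : ∀ y ∈ l₁, ∀ i, y i ≠ 0 → i ∈ S) (h₂ : ∀ y ∈ l₂, ∀ i, y i ≠ 0 → i ∈ T) :
    IsSeparated (l₁ ∪ l₂) S := by
  intro a ha b hab
  rcases Finset.mem_union.1 hab with h | h
  · exact h₁ _ h b (by simp)
  · exact absurd (h₂ _ h a (by simp)) (Finset.disjoint_left.1 hST ha)

/-- Hydral partitions are obtained by adding to the block of a given variable a hydral partition in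
the remaining variables. -/
theorem card_isHydralOn_eq_sum {S : Finset V} {x : V} (hx : x ∈ S) (m : ℕ) :
    Nat.card {l : Finset (V → ℕ) // IsHydralOn S l m} =
      ∑ B ∈ S.powerset.filter (x ∈ ·), ∑ c : Option V, ∑ p ∈ Finset.HasAntidiagonal.antidiagonal m,
        Nat.card {l : Finset (V → ℕ) // IsBlock B c l p.1} *
          Nat.card {l : Finset (V → ℕ) // IsHydralOn (S \ B) l p.2} := by
  let κ := {B : Finset V // B ∈ S.powerset.filter (x ∈ ·)} × Option V ×
    {p : ℕ × ℕ // p ∈ Finset.HasAntidiagonal.antidiagonal m}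
  let F : (Σ k : κ, {l : Finset (V → ℕ) // IsBlock k.1.1 k.2.1 l k.2.2.1.1} ×
      {l : Finset (V → ℕ) // IsHydralOn (S \ k.1.1) l k.2.2.1.2}) →
      {l : Finset (V → ℕ) // IsHydralOn S l m} := fun q =>
    ⟨q.2.1.1 ∪ q.2.2.1, by
      have h := q.2.1.2.isHydralOn.union Finset.disjoint_sdiff q.2.2.2
      have hB := Finset.mem_powerset.1 (Finset.mem_filter.1 q.1.1.2).1
      rwa [Finset.union_sdiff_of_subset hB, Finset.HasAntidiagonal.mem_antidiagonal.1 q.1.2.2.2] at h⟩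
  have hF : Function.Bijective F := by
    constructor
    · rintro ⟨⟨⟨B, hB⟩, c, ⟨⟨i, j⟩, hij⟩⟩, ⟨l₁, h₁⟩, ⟨l₂, h₂⟩⟩
        ⟨⟨⟨B', hB'⟩, c', ⟨⟨i', j'⟩, hij'⟩⟩, ⟨l₁', h₁'⟩, ⟨l₂', h₂'⟩⟩ heq
      simp only at h₁ h₂ h₁' h₂'
      have heq : l₁ ∪ l₂ = l₁' ∪ l₂' := congrArg Subtype.val heq
      have hx₁ := (Finset.mem_filter.1 hB).2
      have hx₂ := (Finset.mem_filter.1 hB').2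
      have hd := Finset.disjoint_sdiff (s := B) (t := S)
      have hd' := Finset.disjoint_sdiff (s := B') (t := S)
      have hs := isSeparated_union hd h₁.isHydralOn.support h₂.support
      have hs' := isSeparated_union hd' h₁'.isHydralOn.support h₂'.support
      have hr := restrict_union_left hd h₁.isHydralOn.support h₂.support h₁.isHydralOn.zero_mem
      have hr' := restrict_union_left hd' h₁'.isHydralOn.support h₂'.support
        h₁'.isHydralOn.zero_mem
      have hr₂ := restrict_union_right hd h₁.isHydralOn.support h₂.support h₂.zero_mem
      have hr₂' := restrict_union_right hd' h₁'.isHydralOn.support h₂'.support h₂'.zero_mem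
      rw [← heq] at hr' hs' hr₂'
      -- Both blocks contain `x` and both are separated in the common union, so connectedness puts
      -- each inside the other. The two pieces are then recovered by restriction.
      have hBB : B = B' := by
        refine Finset.Subset.antisymm ?_ ?_
        · exact IsBlock.subset_of_isSeparated (by rw [hr]; exact h₁) hs' hx₁ hx₂
        · exact IsBlock.subset_of_isSeparated (by rw [hr']; exact h₁') hs hx₂ hx₁
      subst hBB
      have hl : l₁ = l₁' := hr.symm.trans hr'
      have hl₂ : l₂ = l₂' := hr₂.symm.trans hr₂'
      subst hl hl₂
      have hc := h₁.index_unique h₁'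
      subst hc
      have hi : i = i' := by rw [← h₁.isHydralOn.card_degGe, h₁'.isHydralOn.card_degGe]
      have hj : j = j' := by rw [← h₂.card_degGe, h₂'.card_degGe]
      subst hi hj
      rfl
    · rintro ⟨l, hl⟩
      obtain ⟨B, hxB, hBS, hs, c, i, hb⟩ := hl.exists_block hx
      obtain ⟨h1, h2, h3⟩ := hs.isHydralOn_restrict hl hBS hb.isHydralOn.hilb_two
      rw [hb.isHydralOn.card_degGe] at h3
      refine ⟨⟨⟨⟨B, by simp [hBS, hxB]⟩, c, ⟨(i, _), Finset.HasAntidiagonal.mem_antidiagonal.2 h3⟩⟩,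
        ⟨restrict l B, hb⟩, ⟨restrict l (S \ B), h2⟩⟩, ?_⟩
      exact Subtype.ext (hs.restrict_union hl)
  rw [← Nat.card_eq_of_bijective F hF, Nat.card_sigma]
  simp only [Nat.card_prod]
  rw [Fintype.sum_prod_type, ← Finset.sum_coe_sort (S.powerset.filter (x ∈ ·))]
  refine Finset.sum_congr rfl fun B _ => ?_
  rw [Fintype.sum_prod_type]
  refine Finset.sum_congr rfl fun c _ => ?_
  rw [← Finset.sum_coe_sort (Finset.HasAntidiagonal.antidiagonal m)]

theorem card_isBlock_none (B : Finset V) (i : ℕ) :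
    Nat.card {l : Finset (V → ℕ) // IsBlock B none l i} =
      if B.card = 3 ∧ i = 1 then 1 else 0 := by
  split_ifs with h
  · rw [Nat.card_eq_one_iff_unique]
    refine ⟨⟨fun a b => Subtype.ext ?_⟩, ⟨⟨_, h.1, h.2, rfl⟩⟩⟩
    rw [a.2.2.2, b.2.2.2]
  · have : IsEmpty {l : Finset (V → ℕ) // IsBlock B none l i} :=
      ⟨fun l => h ⟨l.2.1, l.2.2.1⟩⟩
    exact Nat.card_of_isEmpty

theorem isStarOn_image_extendAlong {W : Type*} [Fintype W] [DecidableEq W] {f : W ↪ V}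
    {l : Finset (W → ℕ)} {w : W} {m : ℕ} :
    IsStarOn (Finset.univ.map f) (f w) (l.image (extendAlong f)) m ↔
      IsStarOn Finset.univ w l m := by
  rw [IsStarOn, IsStarOn, isHydralOn_image_extendAlong, degEq_image_extendAlong]
  have : (Finset.univ.map f).image (fun i => e (f w) + e i) =
      (Finset.univ.image fun i => e w + e i).image (extendAlong f) := by
    rw [Finset.image_image, Finset.map_eq_image, Finset.image_image]
    refine Finset.image_congr fun i _ => ?_
    simp [extendAlong_add, extendAlong_e]
  rw [this, (Finset.image_injective (extendAlong_injective f)).eq_iff]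
  simp

theorem card_isStarOn_map {W : Type*} [Fintype W] [DecidableEq W] (f : W ↪ V) (w : W) (m : ℕ) :
    Nat.card {l : Finset (V → ℕ) // IsStarOn (Finset.univ.map f) (f w) l m} =
      Nat.card {l : Finset (W → ℕ) // IsStarOn Finset.univ w l m} := by
  symm
  refine Nat.card_eq_of_bijective (fun l => ⟨l.1.image (extendAlong f),
    isStarOn_image_extendAlong.2 l.2⟩) ⟨fun l l' h => ?_, fun l => ?_⟩
  · have := congrArg Subtype.val h
    exact Subtype.ext (Finset.image_injective (extendAlong_injective f) this)
  · have h := image_extendAlong_image_comp l.2.1.support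
    refine ⟨⟨l.1.image (· ∘ f), ?_⟩, Subtype.ext h⟩
    rw [← isStarOn_image_extendAlong (f := f), h]
    exact l.2

theorem delta_succ (k m : ℕ) : delta (k + 1) m =
    Nat.card {l : Finset (Fin (k + 1) → ℕ) // IsStarOn Finset.univ 0 l m} := by
  refine Nat.card_congr (Equiv.subtypeEquivRight fun l => ?_)
  have h := isMPartition_iff (V := Fin (k + 1)) (l := l) (m := m)
  rw [Fintype.card_fin] at h
  rw [h, IsStarOn]
  refine and_congr_right fun _ => ?_
  constructor
  · rintro ⟨i, hi, h2⟩
    have : i = 0 := Fin.ext hi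
    subst this
    exact ⟨Finset.mem_univ _, h2⟩
  · rintro ⟨-, h2⟩
    exact ⟨0, rfl, h2⟩

theorem card_isStarOn {B : Finset V} {v : V} (hv : v ∈ B) (m : ℕ) :
    Nat.card {l : Finset (V → ℕ) // IsStarOn B v l m} = delta B.card m := by
  obtain ⟨k, hk⟩ : ∃ k, B.card = k + 1 :=
    ⟨B.card - 1, by have := Finset.card_pos.2 ⟨v, hv⟩; omega⟩
  let g : Fin (k + 1) ≃ B := (B.equivFinOfCardEq hk).symm
  -- The swap makes `v` the variable numbered `0`, which is the head in the definition of `delta`.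
  let g' : Fin (k + 1) ≃ B := (Equiv.swap 0 (g.symm ⟨v, hv⟩)).trans g
  let f : Fin (k + 1) ↪ V := g'.toEmbedding.trans (Function.Embedding.subtype _)
  have hf0 : f 0 = v := by simp [f, g']
  have hfB : Finset.univ.map f = B := by
    ext b
    simp only [Finset.mem_map, Finset.mem_univ, true_and]
    constructor
    · rintro ⟨i, rfl⟩
      exact (g' i).2
    · intro hb
      exact ⟨g'.symm ⟨b, hb⟩, by simp [f]⟩
  rw [hk, delta_succ, ← card_isStarOn_map f 0 m, hf0, hfB]

theorem card_isBlock_some (B : Finset V) (v : V) (i : ℕ) :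
    Nat.card {l : Finset (V → ℕ) // IsBlock B (some v) l i} =
      if v ∈ B then delta B.card i else 0 := by
  split_ifs with h
  · exact card_isStarOn h i
  · have : IsEmpty {l : Finset (V → ℕ) // IsBlock B (some v) l i} := ⟨fun l => h l.2.2.1⟩
    exact Nat.card_of_isEmpty

/-- The generating function of the hydral partitions in the variables of `S`. -/
noncomputable def hydralSeries (S : Finset V) : PowerSeries ℚ :=
  PowerSeries.mk fun m => (Nat.card {l : Finset (V → ℕ) // IsHydralOn S l m} : ℚ)

/-- The generating function of the numbers `δ_{k,m}`. -/
noncomputable def deltaSeries (k : ℕ) : PowerSeries ℚ := PowerSeries.mk fun m => (delta k m : ℚ)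

theorem hydralSeries_empty : hydralSeries (∅ : Finset V) = 1 := by
  ext m
  rw [hydralSeries, PowerSeries.coeff_mk, PowerSeries.coeff_one]
  split_ifs with h
  · rw [Nat.cast_eq_one, Nat.card_eq_one_iff_unique]
    refine ⟨⟨fun a b => Subtype.ext ?_⟩, ⟨⟨_, isHydralOn_empty_iff.2 ⟨rfl, h⟩⟩⟩⟩
    rw [(isHydralOn_empty_iff.1 a.2).1, (isHydralOn_empty_iff.1 b.2).1]
  · have : IsEmpty {l : Finset (V → ℕ) // IsHydralOn ∅ l m} :=
      ⟨fun l => h (isHydralOn_empty_iff.1 l.2).2⟩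
    rw [Nat.card_of_isEmpty, Nat.cast_zero]

/-- Summing over block indices, each of the `|B|` possible heads contributes the series of `δ`, and
a three-element block contributes one cubic, with a single element of degree at least three. -/
theorem hydralSeries_eq_sum {S : Finset V} {x : V} (hx : x ∈ S) :
    hydralSeries S = ∑ B ∈ S.powerset.filter (x ∈ ·),
      ((B.card : PowerSeries ℚ) * deltaSeries B.card +
        if B.card = 3 then PowerSeries.X else 0) * hydralSeries (S \ B) := by
  have hblock : ∀ B : Finset V, (∑ c : Option V, PowerSeries.mk fun i =>
      (Nat.card {l : Finset (V → ℕ) // IsBlock B c l i} : ℚ)) =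
      (B.card : PowerSeries ℚ) * deltaSeries B.card +
        if B.card = 3 then PowerSeries.X else 0 := by
    intro B
    rw [Fintype.sum_option, add_comm]
    congr 1
    · have : ∀ v : V, (PowerSeries.mk fun i =>
          (Nat.card {l : Finset (V → ℕ) // IsBlock B (some v) l i} : ℚ)) =
          if v ∈ B then deltaSeries B.card else 0 := by
        intro v
        ext i
        rw [PowerSeries.coeff_mk, card_isBlock_some]
        split_ifs <;> simp [deltaSeries]
      rw [Finset.sum_congr rfl fun v _ => this v, Finset.sum_ite_mem, Finset.univ_inter,
        Finset.sum_const, nsmul_eq_mul]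
    · ext i
      rw [PowerSeries.coeff_mk, card_isBlock_none]
      by_cases h3 : B.card = 3
      · simp [h3, PowerSeries.coeff_X]
      · simp [h3]
  ext m
  rw [hydralSeries, PowerSeries.coeff_mk, card_isHydralOn_eq_sum hx, map_sum, Nat.cast_sum]
  refine Finset.sum_congr rfl fun B _ => ?_
  rw [← hblock, Finset.sum_mul, map_sum, Nat.cast_sum]
  refine Finset.sum_congr rfl fun c _ => ?_
  rw [PowerSeries.coeff_mul, Nat.cast_sum]
  refine Finset.sum_congr rfl fun p _ => ?_
  rw [Nat.cast_mul, PowerSeries.coeff_mk, hydralSeries, PowerSeries.coeff_mk]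

theorem sum_powerset_filter_mem {M : Type*} [AddCommMonoid M] {S : Finset V} {x : V} (hx : x ∈ S)
    (g : ℕ → M) : ∑ B ∈ S.powerset.filter (x ∈ ·), g B.card =
      ∑ k ∈ Finset.range S.card, (S.card - 1).choose k • g (k + 1) := by
  have hc : (S.erase x).card + 1 = S.card := Finset.card_erase_add_one hx
  have h1 := Finset.sum_powerset_apply_card (fun k => g (k + 1)) (x := S.erase x)
  rw [← Finset.card_erase_of_mem hx, ← hc, ← h1]
  symm
  refine Finset.sum_bij' (fun B _ => insert x B) (fun B _ => B.erase x) ?_ ?_ ?_ ?_ ?_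
  · intro B hB
    rw [Finset.mem_powerset] at hB
    rw [Finset.mem_filter, Finset.mem_powerset]
    exact ⟨Finset.insert_subset hx (hB.trans (Finset.erase_subset _ _)),
      Finset.mem_insert_self _ _⟩
  · intro B hB
    rw [Finset.mem_filter, Finset.mem_powerset] at hB
    exact Finset.mem_powerset.2 (Finset.erase_subset_erase x hB.1)
  · intro B hB
    rw [Finset.mem_powerset] at hB
    exact Finset.erase_insert fun h => Finset.notMem_erase x S (hB h)
  · intro B hB
    exact Finset.insert_erase (Finset.mem_filter.1 hB).2
  · intro B hB
    rw [Finset.mem_powerset] at hB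
    rw [Finset.card_insert_of_notMem fun h => Finset.notMem_erase x S (hB h)]

/-- The generating function of hydral partitions is the solution of the recursion that removes the
block of a variable. -/
theorem hydralSeries_eq_of_recursion (H : ℕ → PowerSeries ℚ) (h0 : H 0 = 1)
    (hH : ∀ n, H (n + 1) = ∑ k ∈ Finset.range (n + 1), n.choose k •
      ((((k + 1 : ℕ) : PowerSeries ℚ) * deltaSeries (k + 1) +
        if k + 1 = 3 then PowerSeries.X else 0) * H (n - k))) (S : Finset V) :
    hydralSeries S = H S.card := by
  induction S using Finset.strongInduction with
  | H S ih =>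
    rcases S.eq_empty_or_nonempty with rfl | ⟨x, hx⟩
    · rw [hydralSeries_empty, Finset.card_empty, h0]
    · obtain ⟨n, hn⟩ : ∃ n, S.card = n + 1 :=
        ⟨S.card - 1, by have := Finset.card_pos.2 ⟨x, hx⟩; omega⟩
      rw [hydralSeries_eq_sum hx]
      have h1 : ∀ B ∈ S.powerset.filter (x ∈ ·),
          ((B.card : PowerSeries ℚ) * deltaSeries B.card +
            if B.card = 3 then PowerSeries.X else 0) * hydralSeries (S \ B) =
          (fun k : ℕ => ((k : PowerSeries ℚ) * deltaSeries k +
            if k = 3 then PowerSeries.X else 0) * H (S.card - k)) B.card := by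
        intro B hB
        rw [Finset.mem_filter, Finset.mem_powerset] at hB
        rw [ih (S \ B) (Finset.sdiff_ssubset hB.1 ⟨x, hB.2⟩), Finset.card_sdiff_of_subset hB.1]
      rw [Finset.sum_congr rfl h1]
      refine (sum_powerset_filter_mem hx (fun k : ℕ => ((k : PowerSeries ℚ) * deltaSeries k +
        if k = 3 then PowerSeries.X else 0) * H (S.card - k))).trans ?_
      rw [hn, hH n]
      refine Finset.sum_congr rfl fun k _ => ?_
      rw [Nat.add_sub_cancel, Nat.add_sub_add_right]

end Recursion

/-! ### Stars and their exponents -/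

section Stars

variable {V : Type*} [Fintype V] [DecidableEq V]

/-- The partition generated by the elements `e_w + (γ_w + 1) e_v`. -/
def starSet (v : V) (γ : V → ℕ) : Finset (V → ℕ) :=
  insert 0 (Finset.univ.biUnion fun w => (Finset.range (γ w + 2)).image fun a => e w + a • e v)

theorem mem_starSet {v : V} {γ : V → ℕ} {y : V → ℕ} :
    y ∈ starSet v γ ↔ y = 0 ∨ ∃ w a, a ≤ γ w + 1 ∧ y = e w + a • e v := by
  simp only [starSet, Finset.mem_insert, Finset.mem_biUnion, Finset.mem_univ, true_and,
    Finset.mem_image, Finset.mem_range]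
  refine or_congr_right (exists_congr fun w => exists_congr fun a => ?_)
  constructor
  · rintro ⟨h, rfl⟩
    exact ⟨by omega, rfl⟩
  · rintro ⟨h, rfl⟩
    exact ⟨by omega, rfl⟩

theorem deg_e_add_smul_e (v w : V) (a : ℕ) : deg (e w + a • e v) = 1 + a := by
  rw [deg_add, deg_smul, deg_e, deg_e, mul_one]

theorem e_add_smul_e_apply (v w i : V) (a : ℕ) :
    (e w + a • e v) i = (if i = w then 1 else 0) + if i = v then a else 0 := by
  simp [e_apply]

theorem e_add_smul_e_le {v w w' : V} {a b : ℕ} (hab : a ≤ b) (h : w = w' ∨ w = v ∧ a < b) :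
    e w + a • e v ≤ e w' + b • e v := fun i => by
  change (e w + a • e v) i ≤ (e w' + b • e v) i
  rw [e_add_smul_e_apply, e_add_smul_e_apply]
  rcases h with rfl | ⟨rfl, h⟩ <;> split_ifs <;> omega

theorem e_add_smul_e_inj {v w w' : V} {a a' : ℕ} :
    e w + a • e v = e w' + a' • e v ↔ w = w' ∧ a = a' := by
  constructor
  · intro h
    have ha : a = a' := by
      have := congrArg deg h
      rw [deg_e_add_smul_e, deg_e_add_smul_e] at this
      omega
    subst ha
    exact ⟨e_injective (add_right_cancel h), rfl⟩
  · rintro ⟨rfl, rfl⟩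
    rfl

theorem e_add_smul_e_mem_starSet {v w : V} {γ : V → ℕ} {a : ℕ} :
    e w + a • e v ∈ starSet v γ ↔ a ≤ γ w + 1 := by
  rw [mem_starSet]
  constructor
  · rintro (h | ⟨w', a', ha, h⟩)
    · have := congrArg deg h
      rw [deg_e_add_smul_e, deg_zero] at this
      omega
    · obtain ⟨rfl, rfl⟩ := e_add_smul_e_inj.1 h
      exact ha
  · intro h
    exact Or.inr ⟨w, a, h, rfl⟩

theorem starSet_injective (v : V) : Function.Injective (starSet v) := by
  have key : ∀ γ γ' : V → ℕ, starSet v γ = starSet v γ' → ∀ w, γ w ≤ γ' w := by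
    intro γ γ' h w
    have h1 : e w + (γ w + 1) • e v ∈ starSet v γ := e_add_smul_e_mem_starSet.2 le_rfl
    rw [h, e_add_smul_e_mem_starSet] at h1
    omega
  intro γ γ' h
  funext w
  exact le_antisymm (key _ _ h w) (key _ _ h.symm w)

/-- The exponents describing a star with head `v` and `m` elements of degree at least three. -/
structure IsStarCode (v : V) (γ : V → ℕ) (m : ℕ) : Prop where
  one_le : ∀ w, w ≠ v → 1 ≤ γ w
  exists_one_le : ∃ w, 1 ≤ γ w
  le_head : ∀ w, γ w ≤ γ v + 1
  sum_eq : ∑ w, γ w = m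

theorem smul_e_mem_starSet {v : V} {γ : V → ℕ} {a : ℕ} (h : a ≤ γ v + 2) :
    a • e v ∈ starSet v γ := by
  rcases Nat.eq_zero_or_pos a with rfl | ha
  · rw [zero_smul]
    exact mem_starSet.2 (Or.inl rfl)
  · obtain ⟨b, rfl⟩ : ∃ b, a = 1 + b := ⟨a - 1, by omega⟩
    rw [add_smul, one_smul, e_add_smul_e_mem_starSet]
    omega

/-- The bound `γ w ≤ γ v + 1` is closure under division: removing `e w` from the top element `e w +
(γ w + 1) e v` leaves a power of the head, and those go up to exponent `γ v + 2`. The elements of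
degree at least three are the `e w + a e v` with `2 ≤ a ≤ γ w + 1`, which are `γ w` in number for
each `w`. -/
theorem IsStarCode.isStarOn {v : V} {γ : V → ℕ} {m : ℕ} (h : IsStarCode v γ m) :
    IsStarOn Finset.univ v (starSet v γ) m := by
  have h2 : degEq (starSet v γ) 2 = Finset.univ.image fun i => e v + e i := by
    ext y
    rw [mem_degEq, Finset.mem_image]
    constructor
    · rintro ⟨hy, hd⟩
      rcases mem_starSet.1 hy with rfl | ⟨w, a, ha, rfl⟩
      · simp at hd
      · rw [deg_e_add_smul_e] at hd
        obtain rfl : a = 1 := by omega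
        exact ⟨w, Finset.mem_univ _, by rw [one_smul, add_comm]⟩
    · rintro ⟨w, -, rfl⟩
      refine ⟨?_, by simp [deg_add]⟩
      rw [add_comm, ← one_smul ℕ (e v), e_add_smul_e_mem_starSet]
      omega
  refine ⟨⟨?_, ?_, by simp, ?_, ?_, ?_, ?_⟩, Finset.mem_univ v, h2⟩
  · intro a ha y hy
    rcases mem_starSet.1 ha with rfl | ⟨w, a, hle, rfl⟩
    · rwa [le_antisymm hy fun _ => Nat.zero_le _]
    have hy' : ∀ i, y i ≤ (if i = w then 1 else 0) + if i = v then a else 0 := fun i => by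
      rw [← e_add_smul_e_apply]
      exact hy i
    by_cases hw : w ≠ v ∧ y w ≠ 0
    · have : y = e w + y v • e v := by
        funext i
        rw [e_add_smul_e_apply]
        have := hy' i
        have := hy' w
        have := hw.2
        grind
      rw [this, e_add_smul_e_mem_starSet]
      have := hy' v
      rw [if_neg (Ne.symm hw.1), if_pos rfl] at this
      omega
    · have h3 : y = y v • e v := by
        funext i
        simp only [Pi.smul_apply, e_apply, smul_eq_mul]
        have := hy' i
        grind
      rw [h3]
      apply smul_e_mem_starSet
      have h4 := hy' v
      have := h.le_head w
      rw [if_pos rfl] at h4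
      split_ifs at h4 with h5
      · subst h5; omega
      · omega
  · exact mem_starSet.2 (Or.inl rfl)
  · intro i _
    rw [← add_zero (e i), ← zero_smul ℕ (e v), e_add_smul_e_mem_starSet]
    omega
  · rw [hilb, h2, card_image_head]
  · intro y hy h0
    rcases mem_starSet.1 hy with rfl | ⟨w, a, hle, rfl⟩
    · exact absurd rfl h0
    by_cases hw : w ≠ v ∨ 1 ≤ γ v
    · refine ⟨e w + (γ w + 1) • e v, e_add_smul_e_mem_starSet.2 le_rfl,
        e_add_smul_e_le hle (Or.inl rfl), ?_⟩
      rw [deg_e_add_smul_e]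
      have : 1 ≤ γ w := by
        by_cases hwv : w = v
        · rcases hw with hw | hw
          · exact absurd hwv hw
          · rwa [hwv]
        · exact h.one_le w hwv
      omega
    -- Here the head itself stops at degree two, so its powers are placed below the top element of
    -- another variable `u`, in which the head has exponent `γ u + 1 ≥ 2`.
    · push Not at hw
      obtain ⟨rfl, hγ⟩ := hw
      obtain ⟨u, hu⟩ := h.exists_one_le
      refine ⟨e u + (γ u + 1) • e w, e_add_smul_e_mem_starSet.2 le_rfl,
        e_add_smul_e_le (by omega) (Or.inr ⟨rfl, by omega⟩), ?_⟩
      rw [deg_e_add_smul_e]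
      omega
  · have h3 : degGe (starSet v γ) 3 = (Finset.univ.sigma fun w => Finset.Icc 2 (γ w + 1)).image
        fun p => e p.1 + p.2 • e v := by
      ext y
      rw [mem_degGe, Finset.mem_image]
      constructor
      · rintro ⟨hy, hd⟩
        rcases mem_starSet.1 hy with rfl | ⟨w, a, ha, rfl⟩
        · simp at hd
        · rw [deg_e_add_smul_e] at hd
          refine ⟨⟨w, a⟩, ?_, rfl⟩
          simp only [Finset.mem_sigma, Finset.mem_univ, Finset.mem_Icc, true_and]
          omega
      · rintro ⟨⟨w, a⟩, hp, rfl⟩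
        simp only [Finset.mem_sigma, Finset.mem_univ, Finset.mem_Icc, true_and] at hp
        refine ⟨e_add_smul_e_mem_starSet.2 hp.2, ?_⟩
        change 3 ≤ deg (e w + a • e v)
        rw [deg_e_add_smul_e]
        omega
    rw [h3, Finset.card_image_of_injective, Finset.card_sigma, ← h.sum_eq]
    · refine Finset.sum_congr rfl fun w _ => ?_
      rw [Nat.card_Icc]
      omega
    · rintro ⟨w, a⟩ ⟨w', a'⟩ hp
      obtain ⟨rfl, rfl⟩ := e_add_smul_e_inj.1 hp
      rfl

theorem IsStarOn.add_mem_iff {B : Finset V} {v : V} {l : Finset (V → ℕ)} {m : ℕ}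
    (h : IsStarOn B v l m) {a b : V} :
    e a + e b ∈ l ↔ (a = v ∧ b ∈ B) ∨ (b = v ∧ a ∈ B) := by
  rw [← add_mem_degEq, h.2.2, Finset.mem_image]
  constructor
  · rintro ⟨i, hi, h1⟩
    rcases e_add_e_eq_iff.1 h1 with ⟨rfl, rfl⟩ | ⟨rfl, rfl⟩
    · exact Or.inl ⟨rfl, hi⟩
    · exact Or.inr ⟨rfl, hi⟩
  · rintro (⟨rfl, hi⟩ | ⟨rfl, hi⟩)
    · exact ⟨b, hi, rfl⟩
    · exact ⟨a, hi, add_comm _ _⟩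

/-- All edges pass through `v`, so a nonzero element contains at most one variable besides `v`, and
that one with exponent one. The partition is then read off from the largest power of `v` allowed
next to each variable. -/
theorem IsStarOn.exists_code {v : V} {l : Finset (V → ℕ)} {m : ℕ}
    (h : IsStarOn Finset.univ v l m) : ∃ γ, IsStarCode v γ m ∧ l = starSet v γ := by
  have hl := h.1.isPartition
  have hadd : ∀ {a b : V}, e a + e b ∈ l ↔ a = v ∨ b = v := by
    intro a b
    rw [h.add_mem_iff]
    simp
  -- Searching up to `l.card` is enough by `apply_lt_card`.
  let b : V → ℕ := fun w => Nat.findGreatest (fun a => e w + a • e v ∈ l) l.card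
  have hb : ∀ w a, e w + a • e v ∈ l ↔ a ≤ b w := by
    intro w a
    constructor
    · intro ha
      refine Nat.le_findGreatest ?_ ha
      have h1 := hl.apply_lt_card ha v
      rw [e_add_smul_e_apply, if_pos rfl] at h1
      omega
    · intro ha
      have h1 : e w + b w • e v ∈ l :=
        Nat.findGreatest_spec (P := fun a => e w + a • e v ∈ l) (m := 0) (Nat.zero_le _)
          (by simpa using h.1.e_mem w (Finset.mem_univ w))
      exact hl _ h1 _ (e_add_smul_e_le ha (Or.inl rfl))
  have hb1 : ∀ w, 1 ≤ b w := fun w => by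
    rw [← hb, one_smul, hadd]
    exact Or.inr rfl
  -- The cubic above `e w + e v` can only be obtained by multiplying by the head, because `w` has no
  -- other neighbour.
  have hb2 : ∀ w, w ≠ v → 2 ≤ b w := fun w hw => by
    obtain ⟨z, hz⟩ := h.1.exists_cube (x := w) (y := v) (hadd.2 (Or.inr rfl))
    have hz' := (hl.isTriangle hz).2.1
    rw [hadd] at hz'
    rcases hz' with rfl | rfl
    · exact absurd rfl hw
    · rwa [← hb, two_smul, ← add_assoc]
  have hset : l = starSet v fun w => b w - 1 := by
    ext y
    rw [mem_starSet]
    constructor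
    · intro hy
      by_cases h0 : y = 0
      · exact Or.inl h0
      right
      by_cases hw : ∃ w, w ≠ v ∧ y w ≠ 0
      · obtain ⟨w, hwv, hyw⟩ := hw
        have h1 : y w = 1 := by
          by_contra h2
          have h3 : e w + e w ∈ l := hl y hy _ fun i => by
            change e w i + e w i ≤ y i
            rw [e_apply]
            split_ifs with hi
            · subst hi; omega
            · omega
          rw [hadd] at h3
          tauto
        have h2 : ∀ i, i ≠ v → i ≠ w → y i = 0 := by
          intro i hi hiw
          by_contra hyi
          have := hadd.1 (hl y hy _ (e_add_e_le hiw hyi hyw))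
          tauto
        have h3 : y = e w + y v • e v := by
          funext i
          rw [e_add_smul_e_apply]
          have := h2 i
          grind
        refine ⟨w, y v, ?_, h3⟩
        rw [h3, hb] at hy
        omega
      · push Not at hw
        have h3 : y = y v • e v := by
          funext i
          simp only [Pi.smul_apply, e_apply, smul_eq_mul]
          have := hw i
          grind
        have hyv : y v ≠ 0 := fun h4 => h0 (by rw [h3, h4, zero_smul])
        have h4 : y = e v + (y v - 1) • e v := by
          rw [← succ_nsmul', Nat.sub_add_cancel (by omega)]
          exact h3
        refine ⟨v, y v - 1, ?_, h4⟩
        rw [h4, hb] at hy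
        omega
    · rintro (rfl | ⟨w, a, ha, rfl⟩)
      · exact h.1.zero_mem
      · rw [hb]
        have := hb1 w
        omega
  have hcode : IsStarCode v (fun w => b w - 1) (∑ w, (b w - 1)) := by
    refine ⟨fun w hw => ?_, ?_, fun w => ?_, rfl⟩
    · have := hb2 w hw
      omega
    · obtain ⟨z, hz⟩ := h.1.exists_cube (x := v) (y := v) (hadd.2 (Or.inr rfl))
      rw [add_comm, ← two_smul ℕ (e v), hb] at hz
      exact ⟨z, by omega⟩
    · have h1 := (hb w (b w)).2 le_rfl
      have h2 : e v + (b w - 1) • e v ∈ l := by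
        rw [← succ_nsmul', Nat.sub_add_cancel (hb1 w)]
        exact hl _ h1 _ fun i => by simp
      rw [hb] at h2
      have := hb1 v
      omega
  -- The sum of the exponents is identified with `m` by counting the elements of degree at least
  -- three in the star set.
  refine ⟨_, ?_, hset⟩
  have h1 := hcode.isStarOn.1.card_degGe
  rw [← hset, h.1.card_degGe] at h1
  rwa [h1]

theorem delta_succ_eq_card_isStarCode (k m : ℕ) :
    delta (k + 1) m = Nat.card {γ : Fin (k + 1) → ℕ // IsStarCode 0 γ m} := by
  rw [delta_succ]
  symm
  refine Nat.card_eq_of_bijective (fun γ => ⟨starSet 0 γ.1, γ.2.isStarOn⟩)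
    ⟨fun γ γ' h => ?_, fun l => ?_⟩
  · exact Subtype.ext (starSet_injective 0 (congrArg Subtype.val h))
  · obtain ⟨γ, hγ, h⟩ := l.2.exists_code
    exact ⟨⟨γ, hγ⟩, Subtype.ext h.symm⟩

/-- Each variable other than the head has exponent at least one, and some exponent is positive even
when the head is alone. These thresholds are the summands of `rFun`. -/
theorem delta_eq_zero {k m : ℕ} (hk : 0 < k) (hm : m < max (k - 1) 1) : delta k m = 0 := by
  obtain ⟨k, rfl⟩ : ∃ j, k = j + 1 := ⟨k - 1, by omega⟩
  rw [delta_succ_eq_card_isStarCode]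
  have : IsEmpty {γ : Fin (k + 1) → ℕ // IsStarCode 0 γ m} := by
    refine ⟨fun ⟨γ, hγ⟩ => ?_⟩
    have h1 : k ≤ m := by
      rw [← hγ.sum_eq, Fin.sum_univ_succ]
      have := Finset.sum_le_sum (s := Finset.univ) (f := fun _ : Fin k => 1)
        (g := fun i => γ i.succ) fun i _ => hγ.one_le _ (Fin.succ_ne_zero i)
      simp only [Finset.sum_const, Finset.card_univ, Fintype.card_fin, smul_eq_mul, mul_one]
        at this
      omega
    have h2 : 1 ≤ m := by
      obtain ⟨w, hw⟩ := hγ.exists_one_le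
      rw [← hγ.sum_eq]
      exact hw.trans (Finset.single_le_sum (f := γ) (fun _ _ => Nat.zero_le _)
        (Finset.mem_univ w))
    rw [Nat.add_sub_cancel] at hm
    omega
  exact Nat.card_of_isEmpty

end Stars

/-! ### Rationality of the generating functions of stars -/

section Rational

open PowerSeries

theorem isRational_iff {F : PowerSeries ℚ} : IsRational F ↔
    ∃ P Q : Polynomial ℚ, Q.coeff 0 ≠ 0 ∧ (Q : PowerSeries ℚ) * F = P := by
  refine exists_congr fun P => exists_congr fun Q => and_congr_right fun hQ => ?_
  have hQ' : constantCoeff (Q : PowerSeries ℚ) ≠ 0 := by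
    rw [← coeff_zero_eq_constantCoeff_apply, Polynomial.coeff_coe]
    exact hQ
  rw [PowerSeries.eq_mul_inv_iff_mul_eq hQ', mul_comm]

theorem isRational_coe (P : Polynomial ℚ) : IsRational (P : PowerSeries ℚ) :=
  isRational_iff.2 ⟨P, 1, by simp, by simp⟩

theorem IsRational.mul {F G : PowerSeries ℚ} (hF : IsRational F) (hG : IsRational G) :
    IsRational (F * G) := by
  obtain ⟨P, Q, hQ, h⟩ := isRational_iff.1 hF
  obtain ⟨P', Q', hQ', h'⟩ := isRational_iff.1 hG
  refine isRational_iff.2 ⟨P * P', Q * Q', ?_, ?_⟩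
  · rw [Polynomial.mul_coeff_zero]
    exact mul_ne_zero hQ hQ'
  · rw [Polynomial.coe_mul, Polynomial.coe_mul, ← h, ← h']
    ring

theorem IsRational.add {F G : PowerSeries ℚ} (hF : IsRational F) (hG : IsRational G) :
    IsRational (F + G) := by
  obtain ⟨P, Q, hQ, h⟩ := isRational_iff.1 hF
  obtain ⟨P', Q', hQ', h'⟩ := isRational_iff.1 hG
  refine isRational_iff.2 ⟨P * Q' + P' * Q, Q * Q', ?_, ?_⟩
  · rw [Polynomial.mul_coeff_zero]
    exact mul_ne_zero hQ hQ'
  · rw [Polynomial.coe_mul, Polynomial.coe_add, Polynomial.coe_mul, Polynomial.coe_mul, ← h, ← h']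
    ring

theorem isRational_X_pow (n : ℕ) : IsRational (X ^ n : PowerSeries ℚ) := by
  have := isRational_coe (Polynomial.X ^ n)
  rwa [Polynomial.coe_pow, Polynomial.coe_X] at this

theorem isRational_C (a : ℚ) : IsRational (C a : PowerSeries ℚ) := by
  have := isRational_coe (Polynomial.C a)
  rwa [Polynomial.coe_C] at this

theorem isRational_sum {κ : Type*} (I : Finset κ) (F : κ → PowerSeries ℚ)
    (h : ∀ i ∈ I, IsRational (F i)) : IsRational (∑ i ∈ I, F i) :=
  Finset.sum_induction F IsRational (fun _ _ => IsRational.add)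
    (by simpa using isRational_C 0) h

theorem IsRational.of_mul {F : PowerSeries ℚ} (Q : Polynomial ℚ) (hQ : Q.coeff 0 ≠ 0)
    (h : IsRational ((Q : PowerSeries ℚ) * F)) : IsRational F := by
  obtain ⟨P', Q', hQ', h'⟩ := isRational_iff.1 h
  refine isRational_iff.2 ⟨P', Q' * Q, ?_, ?_⟩
  · rw [Polynomial.mul_coeff_zero]
    exact mul_ne_zero hQ' hQ
  · rw [Polynomial.coe_mul, mul_assoc, h']

/-- The formal sum `∑_g X^g P_g`. -/
noncomputable def diagSum (P : ℕ → PowerSeries ℚ) : PowerSeries ℚ :=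
  -- Stopping at `g = m` is harmless: the factor `X ^ g` kills the coefficient for larger `g`.
  mk fun m => ∑ g ∈ Finset.range (m + 1), coeff m (X ^ g * P g)

theorem diagSum_sub (P P' : ℕ → PowerSeries ℚ) :
    diagSum (fun g => P g - P' g) = diagSum P - diagSum P' := by
  ext m
  simp [diagSum, mul_sub]

theorem diagSum_mul_left (A : PowerSeries ℚ) (P : ℕ → PowerSeries ℚ) :
    diagSum (fun g => A * P g) = A * diagSum P := by
  ext m
  rw [diagSum, coeff_mk, coeff_mul]
  have h1 : ∀ p ∈ Finset.HasAntidiagonal.antidiagonal m, coeff p.1 A * coeff p.2 (diagSum P) =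
      ∑ g ∈ Finset.range (m + 1), coeff p.1 A * coeff p.2 (X ^ g * P g) := by
    intro p hp
    have hp := Finset.HasAntidiagonal.mem_antidiagonal.1 hp
    rw [diagSum, coeff_mk, ← Finset.mul_sum]
    congr 1
    refine Finset.sum_subset (Finset.range_subset_range.2 (by omega)) fun g _ hg => ?_
    rw [coeff_X_pow_mul', if_neg]
    rw [Finset.mem_range] at hg
    omega
  rw [Finset.sum_congr rfl h1, Finset.sum_comm]
  refine Finset.sum_congr rfl fun g _ => ?_
  rw [← coeff_mul, mul_left_comm]

theorem diagSum_succ (P : ℕ → PowerSeries ℚ) :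
    diagSum P = P 0 + X * diagSum fun g => P (g + 1) := by
  ext m
  rw [diagSum, coeff_mk, Finset.sum_range_succ', pow_zero, one_mul, map_add, add_comm]
  congr 1
  cases m with
  | zero => simp
  | succ m =>
    rw [coeff_succ_X_mul, diagSum, coeff_mk]
    refine Finset.sum_congr rfl fun g _ => ?_
    rw [pow_succ', mul_assoc, coeff_succ_X_mul]

/-- The sum is the geometric series `1 / (1 - X^(j+1))`; shifting the index gives the equation that
proves it. -/
theorem isRational_diagSum_pow (j : ℕ) : IsRational (diagSum fun g => X ^ (j * g)) := by
  refine isRational_iff.2 ⟨1, 1 - Polynomial.X ^ (j + 1), by simp, ?_⟩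
  have h := diagSum_succ fun g => (X : PowerSeries ℚ) ^ (j * g)
  have h2 : (fun g => (X : PowerSeries ℚ) ^ (j * (g + 1))) = fun g => X ^ j * X ^ (j * g) := by
    funext g
    rw [← pow_add]
    congr 1
    ring
  rw [h2, diagSum_mul_left, mul_zero, pow_zero] at h
  rw [Polynomial.coe_sub, Polynomial.coe_one, Polynomial.coe_pow, Polynomial.coe_X, sub_mul,
    one_mul]
  nth_rewrite 1 [h]
  ring

/-- Multiplying by `1 - X` turns one factor `1 + ⋯ + X^g` into `1 - X^(g+1)`, leaving two sums with
exponent `k`, one for `j` and one for `j + 1`. Hence the induction keeps `j` free. -/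
theorem isRational_diagSum_geom (k j : ℕ) :
    IsRational (diagSum fun g => X ^ (j * g) * (∑ i ∈ Finset.range (g + 1), X ^ i) ^ k) := by
  induction k generalizing j with
  | zero => simpa using isRational_diagSum_pow j
  | succ k ih =>
    refine IsRational.of_mul (1 - Polynomial.X) (by simp) ?_
    have h1 : (fun g => (1 - X : PowerSeries ℚ) * (X ^ (j * g) *
        (∑ i ∈ Finset.range (g + 1), X ^ i) ^ (k + 1))) =
        fun g => X ^ (j * g) * (∑ i ∈ Finset.range (g + 1), X ^ i) ^ k -
          X * (X ^ ((j + 1) * g) * (∑ i ∈ Finset.range (g + 1), X ^ i) ^ k) := by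
      funext g
      have hg : (1 - X : PowerSeries ℚ) * ∑ i ∈ Finset.range (g + 1), X ^ i = 1 - X ^ (g + 1) :=
        mul_neg_geom_sum X (g + 1)
      rw [pow_succ', mul_left_comm, ← mul_assoc (1 - X), hg]
      ring
    rw [Polynomial.coe_sub, Polynomial.coe_one, Polynomial.coe_X, ← diagSum_mul_left, h1,
      diagSum_sub, diagSum_mul_left, sub_eq_add_neg]
    refine (ih j).add ?_
    have h2 : -(X * diagSum fun g => X ^ ((j + 1) * g) *
        (∑ i ∈ Finset.range (g + 1), (X : PowerSeries ℚ) ^ i) ^ k) = C (-1) * X ^ 1 *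
        diagSum fun g => X ^ ((j + 1) * g) * (∑ i ∈ Finset.range (g + 1), X ^ i) ^ k := by
      rw [map_neg, map_one]
      ring
    rw [h2]
    exact ((isRational_C _).mul (isRational_X_pow 1)).mul (ih (j + 1))

theorem coeff_sum_X_pow_pow (k g m : ℕ) :
    coeff m ((X : PowerSeries ℚ) ^ g * (∑ a ∈ Finset.Icc 1 (g + 1), (X : PowerSeries ℚ) ^ a) ^ k) =
      ((Fintype.piFinset fun _ : Fin k => Finset.Icc 1 (g + 1)).filter
        fun p => g + ∑ i, p i = m).card := by
  have h1 := Finset.prod_univ_sum (fun _ : Fin k => Finset.Icc 1 (g + 1))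
    fun _ a => (X : PowerSeries ℚ) ^ a
  rw [Finset.prod_const, Finset.card_univ, Fintype.card_fin] at h1
  rw [h1, Finset.mul_sum, map_sum, Finset.card_filter, Nat.cast_sum]
  refine Finset.sum_congr rfl fun p _ => ?_
  rw [Finset.prod_pow_eq_pow_sum, ← pow_add, coeff_X_pow]
  by_cases h : g + ∑ i, p i = m
  · simp [h]
  · simp [h, Ne.symm h]

/-- The index `g` is the exponent of the head; the other `k + 1` exponents range independently over
`[1, g + 1]`. Having at least one of them makes the condition that some exponent be positive
automatic, so one variable is treated separately. -/
theorem deltaSeries_add_two (k : ℕ) : deltaSeries (k + 2) =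
    diagSum fun g => (∑ a ∈ Finset.Icc 1 (g + 1), (X : PowerSeries ℚ) ^ a) ^ (k + 1) := by
  ext m
  rw [deltaSeries, coeff_mk, diagSum, coeff_mk]
  simp only [coeff_sum_X_pow_pow]
  rw [← Nat.cast_sum, Nat.cast_inj, ← Finset.card_sigma, delta_succ_eq_card_isStarCode,
    ← Nat.card_eq_finsetCard]
  symm
  refine Nat.card_eq_of_bijective (fun q => ⟨Fin.cons q.1.1 q.1.2, ?_⟩) ⟨fun q q' h => ?_,
    fun γ => ?_⟩
  · obtain ⟨⟨g, p⟩, hq⟩ := q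
    simp only [Finset.mem_sigma, Finset.mem_range, Finset.mem_filter, Fintype.mem_piFinset,
      Finset.mem_Icc] at hq
    refine ⟨?_, ⟨1, ?_⟩, ?_, ?_⟩
    · intro w hw
      obtain ⟨i, rfl⟩ := Fin.exists_succ_eq.2 hw
      simpa using (hq.2.1 i).1
    · rw [show (1 : Fin (k + 1 + 1)) = Fin.succ 0 from rfl, Fin.cons_succ]
      exact (hq.2.1 0).1
    · intro w
      refine Fin.cases ?_ (fun i => ?_) w
      · exact Nat.le_succ _
      · simpa using (hq.2.1 i).2
    · rw [Fin.sum_univ_succ]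
      simpa using hq.2.2
  · obtain ⟨⟨g, p⟩, hq⟩ := q
    obtain ⟨⟨g', p'⟩, hq'⟩ := q'
    have h : (Fin.cons g p : Fin (k + 1 + 1) → ℕ) = Fin.cons g' p' := congrArg Subtype.val h
    obtain ⟨rfl, rfl⟩ := Fin.cons_injective2 h
    rfl
  · obtain ⟨γ, hγ⟩ := γ
    refine ⟨⟨⟨γ 0, Fin.tail γ⟩, ?_⟩, Subtype.ext (Fin.cons_self_tail γ)⟩
    have hs := hγ.sum_eq
    rw [Fin.sum_univ_succ] at hs
    simp only [Finset.mem_sigma, Finset.mem_range, Finset.mem_filter, Fintype.mem_piFinset,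
      Finset.mem_Icc]
    refine ⟨by omega, fun i => ⟨hγ.one_le _ (Fin.succ_ne_zero i), hγ.le_head _⟩, hs⟩

theorem delta_one (m : ℕ) : delta 1 m = if m = 0 then 0 else 1 := by
  rw [delta_succ_eq_card_isStarCode]
  split_ifs with hm
  · have : IsEmpty {γ : Fin (0 + 1) → ℕ // IsStarCode 0 γ m} := by
      refine ⟨fun ⟨γ, hγ⟩ => ?_⟩
      obtain ⟨w, hw⟩ := hγ.exists_one_le
      have := hγ.sum_eq
      rw [hm, Finset.sum_eq_zero_iff] at this
      have := this w (Finset.mem_univ w)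
      omega
    exact Nat.card_of_isEmpty
  · rw [Nat.card_eq_one_iff_unique]
    refine ⟨⟨fun a b => Subtype.ext ?_⟩, ⟨⟨fun _ => m, ?_, ⟨0, by omega⟩, by simp, by simp⟩⟩⟩
    · funext i
      have ha := a.2.sum_eq
      have hb := b.2.sum_eq
      simp only [Fin.sum_univ_succ, Finset.univ_eq_empty, Finset.sum_empty, add_zero] at ha hb
      rw [Fin.fin_one_eq_zero i, ha, hb]
    · intro w _
      omega

theorem isRational_deltaSeries {k : ℕ} (hk : 0 < k) : IsRational (deltaSeries k) := by
  match k, hk with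
  | 1, _ =>
    refine isRational_iff.2 ⟨Polynomial.X, 1 - Polynomial.X, by simp, ?_⟩
    rw [Polynomial.coe_sub, Polynomial.coe_one, Polynomial.coe_X, sub_mul, one_mul]
    ext m
    rw [map_sub]
    rcases m with _ | _ | m
    · simp [deltaSeries, delta_one]
    · rw [coeff_succ_X_mul]
      simp [deltaSeries, delta_one]
    · rw [coeff_succ_X_mul]
      simp [deltaSeries, delta_one, coeff_X]
  | k + 2, _ =>
    rw [deltaSeries_add_two]
    have h : (fun g => (∑ a ∈ Finset.Icc 1 (g + 1), (X : PowerSeries ℚ) ^ a) ^ (k + 1)) =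
        fun g => X ^ (k + 1) * (X ^ (0 * g) *
          (∑ i ∈ Finset.range (g + 1), (X : PowerSeries ℚ) ^ i) ^ (k + 1)) := by
      funext g
      rw [zero_mul, pow_zero, one_mul, ← mul_pow, Finset.mul_sum]
      congr 1
      refine Finset.sum_nbij' (fun a => a - 1) (fun i => i + 1) ?_ ?_ ?_ ?_ ?_
      · intro a ha
        rw [Finset.mem_Icc] at ha
        rw [Finset.mem_range]
        omega
      · intro i hi
        rw [Finset.mem_range] at hi
        rw [Finset.mem_Icc]
        omega
      · intro a ha
        rw [Finset.mem_Icc] at ha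
        omega
      · intro i _
        omega
      · intro a ha
        rw [Finset.mem_Icc] at ha
        rw [← pow_succ', Nat.sub_add_cancel ha.1]
    rw [h, diagSum_mul_left]
    exact (isRational_X_pow _).mul (isRational_diagSum_geom _ _)

end Rational

/-! ### Evaluation of `μ` and `Ψ` -/

section Mu

open PowerSeries

theorem uFun_coe_cons {a : ℕ} {L : List ℕ} (h : (a :: L).Pairwise (· ≥ ·)) :
    uFun ((a :: L : List ℕ) : Multiset ℕ) = L := by
  have hs : ((a :: L : List ℕ) : Multiset ℕ).sup = a := by
    apply le_antisymm
    · refine Multiset.sup_le.2 fun b hb => ?_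
      rw [Multiset.mem_coe, List.mem_cons] at hb
      rcases hb with rfl | hb
      · exact le_rfl
      · exact (List.pairwise_cons.1 h).1 b hb
    · exact Multiset.le_sup (by simp)
  rw [uFun, hs, ← Multiset.cons_coe, Multiset.erase_cons_head]

theorem uFun_iterate_coe (j : ℕ) {L : List ℕ} (h : L.Pairwise (· ≥ ·)) :
    uFun^[j] (L : Multiset ℕ) = (L.drop j : List ℕ) := by
  induction j generalizing L with
  | zero => simp
  | succ j ih =>
    rw [Function.iterate_succ_apply]
    cases L with
    | nil =>
      rw [show uFun ((([] : List ℕ)) : Multiset ℕ) = (([] : List ℕ) : Multiset ℕ) from rfl,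
        ih List.Pairwise.nil]
      simp
    | cons a L => rw [uFun_coe_cons h, ih (List.pairwise_cons.1 h).2, List.drop_succ_cons]

theorem sum_map_drop (g : ℕ → ℕ) (L : List ℕ) (k : ℕ) :
    ((L.drop k).map g).sum = ∑ j : Fin L.length, if k ≤ j.val then g (L.get j) else 0 := by
  induction L generalizing k with
  | nil => simp
  | cons a L ih =>
    simp only [List.length_cons]
    rw [Fin.sum_univ_succ]
    cases k with
    | zero =>
      have := ih 0
      simp only [List.drop_zero, Nat.zero_le, if_true] at this
      rw [List.drop_zero, List.map_cons, List.sum_cons, this]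
      simp
    | succ k =>
      rw [List.drop_succ_cons, ih k]
      simp

theorem le_of_prod_delta_ne_zero {L : List ℕ} (hL : ∀ x ∈ L, 0 < x) {i : Fin L.length → ℕ}
    (h : ∏ j, delta (L.get j) (i j) ≠ 0) (j : Fin L.length) :
    max (L.get j - 1) 1 ≤ i j := by
  by_contra! hj
  exact h (Finset.prod_eq_zero (Finset.mem_univ j) (delta_eq_zero (hL _ (List.get_mem _ _)) hj))

theorem coeff_prod_map_deltaSeries (L : List ℕ) (m : ℕ) :
    coeff m (L.map deltaSeries).prod =
      ((∑ i ∈ Finset.piAntidiag (Finset.univ : Finset (Fin L.length)) m,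
        ∏ j, delta (L.get j) (i j) : ℕ) : ℚ) := by
  rw [← Fin.prod_univ_fun_getElem, coeff_prod, Nat.cast_sum]
  refine Finset.sum_bij' (fun f _ => (f : Fin L.length → ℕ))
    (fun f _ => Finsupp.equivFunOnFinite.symm f) ?_ ?_ ?_ ?_ ?_
  · intro f hf
    rw [Finset.mem_finsuppAntidiag] at hf
    rw [Finset.mem_piAntidiag]
    exact ⟨hf.1, by simp⟩
  · intro f hf
    rw [Finset.mem_piAntidiag] at hf
    rw [Finset.mem_finsuppAntidiag]
    exact ⟨by simpa using hf.1, by simp⟩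
  · intro f _
    ext
    simp
  · intro f _
    simp
  · intro f _
    simp [deltaSeries]

/-- The inequalities on the `i_j` are redundant: a nonzero product forces every `i_k` to be at least
`max (λ_k - 1) 1`. The entries after `j` then sum to at least `r(u^j(λ))`, which is the required
bound on `i_j`. -/
theorem muSum_eq {L : List ℕ} (hL : ∀ x ∈ L, 0 < x) (hs : L.Pairwise (· ≥ ·)) (m : ℕ) :
    (muSum L m : ℚ) = coeff m (L.map deltaSeries).prod := by
  rw [coeff_prod_map_deltaSeries, muSum]
  congr 1
  refine Finset.sum_filter_of_ne fun i hi hne j _ => ?_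
  have hle := le_of_prod_delta_ne_zero hL hne
  rw [Finset.mem_piAntidiag] at hi
  rw [uFun_iterate_coe _ hs, rFun, Multiset.map_coe, Multiset.sum_coe, sum_map_drop]
  have h1 : ∑ k : Fin L.length, (if j.val + 1 ≤ k.val then max (L.get k - 1) 1 else 0) +
      (∑ k ∈ Finset.univ.filter (· < j), i k + i j) ≤ m := by
    have h2 : i j = ∑ k : Fin L.length, if k = j then i k else 0 := by simp
    rw [← hi.1, Finset.sum_filter]
    nth_rewrite 1 [h2]
    rw [← Finset.sum_add_distrib, ← Finset.sum_add_distrib]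
    refine Finset.sum_le_sum fun k _ => ?_
    have h3 := hle k
    rcases lt_trichotomy k j with h | h | h
    · rw [if_neg (by rw [Fin.lt_def] at h; omega), if_pos h, if_neg h.ne]
      omega
    · subst h
      simp
    · rw [if_pos (by rw [Fin.lt_def] at h; omega), if_neg h.not_gt, if_neg h.ne']
      omega
  have h4 : ((∑ k : Fin L.length, (if j.val + 1 ≤ k.val then max (L.get k - 1) 1 else 0) : ℕ) : ℤ) +
      (∑ k ∈ Finset.univ.filter (· < j), (i k : ℤ) + i j) ≤ m := by
    exact_mod_cast h1
  linarith

theorem sortedParts_coe (l : Multiset ℕ) : ((sortedParts l : List ℕ) : Multiset ℕ) = l :=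
  Multiset.sort_eq l _

theorem mem_sortedParts {l : Multiset ℕ} {x : ℕ} : x ∈ sortedParts l ↔ x ∈ l := by
  rw [← Multiset.mem_coe, sortedParts_coe]

theorem prod_map_sortedParts {M : Type*} [CommMonoid M] (g : ℕ → M) (l : Multiset ℕ) :
    ((sortedParts l).map g).prod = (l.map g).prod := by
  rw [← Multiset.prod_coe, ← Multiset.map_coe, sortedParts_coe]

/-- The cut-off below `r(λ)` is redundant for the same reason: all products of `δ` vanish there. -/
theorem mu_natCast {l : Multiset ℕ} (hl : ∀ x ∈ l, 0 < x) (m : ℕ) :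
    (mu l m : ℚ) = coeff m (l.map deltaSeries).prod := by
  have hL : ∀ x ∈ sortedParts l, 0 < x := fun x hx => hl x (mem_sortedParts.1 hx)
  have h := muSum_eq hL (Multiset.pairwise_sort l _) m
  rw [prod_map_sortedParts] at h
  rw [← h, mu, Int.toNat_natCast, Nat.cast_inj]
  split_ifs with hm
  · rw [Nat.cast_lt] at hm
    symm
    rw [muSum]
    refine Finset.sum_eq_zero fun i hi => ?_
    by_contra hne
    have hle := le_of_prod_delta_ne_zero hL hne
    have h1 := (Finset.mem_piAntidiag.1 (Finset.mem_filter.1 hi).1).1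
    have h2 := Finset.sum_le_sum (s := Finset.univ) fun j _ => hle j
    have h3 := sum_map_drop (fun x => max (x - 1) 1) (sortedParts l) 0
    simp only [List.drop_zero, Nat.zero_le, if_true] at h3
    rw [h1, ← h3, ← Multiset.sum_coe, ← Multiset.map_coe, sortedParts_coe] at h2
    exact absurd hm (not_lt.2 h2)
  · rfl

theorem Psi_eq {l : Multiset ℕ} (hl : ∀ x ∈ l, 0 < x) : Psi l = (l.map deltaSeries).prod := by
  ext m
  rw [Psi, coeff_mk, mu_natCast hl]

theorem mu_eq_zero_of_neg (l : Multiset ℕ) {m : ℤ} (hm : m < 0) : mu l m = 0 := by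
  rw [mu, if_pos (hm.trans_le (Nat.cast_nonneg _))]

theorem isRational_Psi {l : Multiset ℕ} (hl : ∀ x ∈ l, 0 < x) : IsRational (Psi l) := by
  rw [Psi_eq hl]
  refine Multiset.prod_induction IsRational _ (fun _ _ => IsRational.mul) ?_ ?_
  · simpa using isRational_C 1
  · intro F hF
    obtain ⟨x, hx, rfl⟩ := Multiset.mem_map.1 hF
    exact isRational_deltaSeries (hl x hx)

end Mu

/-! ### Closed forms for `f` and `|Aut|` -/

section Coefficients

/-- A telescoping multinomial coefficient, each step using `a · (a - 1)! = a!`. -/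
theorem prod_choose_mul (L : List ℕ) (hL : ∀ x ∈ L, 0 < x) (d : ℕ) (hd : L.sum ≤ d) :
    (∏ j : Fin L.length, ((d - (L.take j).sum).choose (L.get j) * L.get j)) *
      (L.map fun x => (x - 1)!).prod * (d - L.sum)! = d ! := by
  induction L generalizing d with
  | nil => simp
  | cons a L ih =>
    rw [List.sum_cons] at hd
    have ha : 0 < a := hL a (by simp)
    have h1 := ih (fun x hx => hL x (by simp [hx])) (d - a) (by omega)
    have h2 := Nat.choose_mul_factorial_mul_factorial (n := d) (k := a) (by omega)
    have h3 : a ! = a * (a - 1)! := (Nat.mul_factorial_pred ha.ne').symm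
    simp only [List.length_cons]
    rw [Fin.prod_univ_succ]
    simp only [Fin.val_zero, List.take_zero, List.sum_nil, Nat.sub_zero, List.get_cons_zero,
      Fin.val_succ, List.take_succ_cons, List.sum_cons, List.get_cons_succ', ← Nat.sub_sub,
      List.map_cons, List.prod_cons]
    rw [← h2, ← h1, h3]
    ring

theorem autCard_pos (l : Multiset ℕ) : 0 < autCard l :=
  Finset.prod_pos fun _ _ => Nat.factorial_pos _

/-- In this form the order of the parts no longer appears, and each part contributes a separate
factor, as the exponential formula requires. -/
theorem fFun_eq {l : Multiset ℕ} (hl : ∀ x ∈ l, 0 < x) :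
    fFun l = (l.sum ! : ℚ) / (autCard l * ((l.map fun x => (x - 1)!).prod : ℕ)) := by
  have hsum : (sortedParts l).sum = l.sum := by rw [← Multiset.sum_coe, sortedParts_coe]
  have h := prod_choose_mul (sortedParts l) (fun x hx => hl x (mem_sortedParts.1 hx)) l.sum
    hsum.le
  rw [hsum, Nat.sub_self, Nat.factorial_zero, mul_one, prod_map_sortedParts] at h
  have hp : (l.map fun x => (x - 1)!).prod ≠ 0 := by
    rw [Ne, Multiset.prod_eq_zero_iff]
    intro h0
    obtain ⟨x, -, hx⟩ := Multiset.mem_map.1 h0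
    exact Nat.factorial_ne_zero _ hx
  have ha : (autCard l : ℚ) ≠ 0 := Nat.cast_ne_zero.2 (autCard_pos l).ne'
  have hp' : (((l.map fun x => (x - 1)!).prod : ℕ) : ℚ) ≠ 0 := Nat.cast_ne_zero.2 hp
  rw [fFun, ← Nat.cast_prod, ← h, Nat.cast_mul]
  field_simp

theorem autCard_eq_prod {l : Multiset ℕ} {s : Finset ℕ} (hs : l.toFinset ⊆ s) :
    autCard l = ∏ x ∈ s, (l.count x)! := by
  refine Finset.prod_subset hs fun x _ hx => ?_
  rw [Multiset.mem_toFinset] at hx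
  rw [Multiset.count_eq_zero_of_notMem hx, Nat.factorial_zero]

theorem autCard_cons (x : ℕ) (l : Multiset ℕ) :
    autCard (x ::ₘ l) = (l.count x + 1) * autCard l := by
  have hx : x ∉ l.toFinset.erase x := Finset.notMem_erase x _
  have h1 : (x ::ₘ l).toFinset ⊆ insert x (l.toFinset.erase x) := by
    intro y hy
    simp only [Multiset.toFinset_cons, Finset.mem_insert, Finset.mem_erase] at hy ⊢
    tauto
  have h2 : l.toFinset ⊆ insert x (l.toFinset.erase x) := by
    intro y hy
    simp only [Finset.mem_insert, Finset.mem_erase]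
    tauto
  rw [autCard_eq_prod h1, autCard_eq_prod h2, Finset.prod_insert hx, Finset.prod_insert hx,
    Multiset.count_cons_self, Nat.factorial_succ, mul_assoc]
  congr 2
  refine Finset.prod_congr rfl fun y hy => ?_
  rw [Multiset.count_cons_of_ne (Finset.ne_of_mem_erase hy)]

theorem autCard_replicate_zero_add (i : ℕ) {l : Multiset ℕ} (hl : 0 ∉ l) :
    autCard (Multiset.replicate i 0 + l) = i ! * autCard l := by
  induction i with
  | zero => simp
  | succ i ih =>
    rw [Multiset.replicate_succ, Multiset.cons_add, autCard_cons, ih, Multiset.count_add,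
      Multiset.count_replicate_self, Multiset.count_eq_zero_of_notMem hl, Nat.factorial_succ]
    ring

theorem sFun_iterate (i : ℕ) (l : Multiset ℕ) : sFun^[i] l = l - Multiset.replicate i 3 := by
  induction i generalizing l with
  | zero => simp
  | succ i ih =>
    rw [Function.iterate_succ_apply, ih, sFun, Multiset.replicate_succ, Multiset.sub_cons]

end Coefficients

/-! ### The exponential formula -/

section Exponential

open PowerSeries

/-- The number of variables of a block with a given code: `0` stands for the square-free cubics and
`k > 0` for the stars in `k` variables. -/
def blockSize (x : ℕ) : ℕ := if x = 0 then 3 else x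

/-- The weight of a block in the exponential generating function. -/
noncomputable def blockWeight (x : ℕ) : PowerSeries ℚ :=
  if x = 0 then C (1 / 6) * X else C (1 / ((x - 1)! : ℚ)) * deltaSeries x

/-- The weight of a multiset of blocks. -/
noncomputable def typeWeight (M : Multiset ℕ) : PowerSeries ℚ :=
  C (1 / (autCard M : ℚ)) * (M.map blockWeight).prod

/-- The multisets of blocks with `n` variables. -/
def blockTypes (n : ℕ) : Finset (Multiset ℕ) :=
  -- Blocks have size at least one and at least their code, so codes and multiplicities are at most
  -- `n`, and `n` copies of each code suffice.
  ((n • Multiset.range (n + 1)).powerset.toFinset).filter fun M => (M.map blockSize).sum = n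

theorem blockSize_pos (x : ℕ) : 0 < blockSize x := by
  rw [blockSize]
  split_ifs <;> omega

theorem le_blockSize (x : ℕ) : x ≤ blockSize x := by
  rw [blockSize]
  split_ifs <;> omega

theorem mem_blockTypes {n : ℕ} {M : Multiset ℕ} :
    M ∈ blockTypes n ↔ (M.map blockSize).sum = n := by
  rw [blockTypes, Finset.mem_filter, and_iff_right_iff_imp]
  rintro rfl
  rw [Multiset.mem_toFinset, Multiset.mem_powerset, Multiset.le_iff_count]
  intro x
  by_cases hx : x ∈ M
  · have h1 : blockSize x ≤ (M.map blockSize).sum :=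
      Multiset.single_le_sum (fun _ _ => Nat.zero_le _) _ (Multiset.mem_map_of_mem _ hx)
    have h2 := le_blockSize x
    rw [Multiset.count_nsmul, Multiset.count_eq_one_of_mem (Multiset.nodup_range _)
      (Multiset.mem_range.2 (by omega)), mul_one]
    have h3 : M.card ≤ (M.map blockSize).sum := by
      have := Multiset.card_nsmul_le_sum (s := M.map blockSize) (a := 1) (by
        intro y hy
        obtain ⟨z, -, rfl⟩ := Multiset.mem_map.1 hy
        exact blockSize_pos z)
      simpa using this
    exact (Multiset.count_le_card x M).trans h3
  · rw [Multiset.count_eq_zero_of_notMem hx]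
    exact Nat.zero_le _

/-- Erasing one copy of `x` divides `|Aut|` by the multiplicity of `x`, which the factor `count`
compensates. -/
theorem count_mul_typeWeight {x : ℕ} {M : Multiset ℕ} (hx : x ∈ M) :
    (M.count x : PowerSeries ℚ) * typeWeight M = blockWeight x * typeWeight (M.erase x) := by
  obtain ⟨M', rfl⟩ := Multiset.exists_cons_of_mem hx
  rw [Multiset.erase_cons_head, Multiset.count_cons_self, typeWeight, typeWeight, autCard_cons,
    Multiset.map_cons, Multiset.prod_cons]
  have h : ((M'.count x + 1 : ℕ) : PowerSeries ℚ) *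
      C (1 / (((M'.count x + 1) * autCard M' : ℕ) : ℚ)) = C (1 / (autCard M' : ℚ)) := by
    rw [← map_natCast (C (R := ℚ)), ← map_mul]
    congr 1
    have h1 : ((M'.count x + 1 : ℕ) : ℚ) ≠ 0 := Nat.cast_ne_zero.2 (Nat.succ_ne_zero _)
    have h2 : (autCard M' : ℚ) ≠ 0 := Nat.cast_ne_zero.2 (autCard_pos M').ne'
    rw [Nat.cast_mul]
    field_simp
  rw [← mul_assoc, h]
  ring

/-- The exponential generating function in the number of variables. -/
noncomputable def typeSum (n : ℕ) : PowerSeries ℚ := ∑ M ∈ blockTypes n, typeWeight M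

/-- The coefficient form of `F' = G' F` for `F = exp G`: writing `n` as the sum of the sizes of the
blocks marks a block, which is then erased. -/
theorem nat_mul_typeSum (n : ℕ) : (n : PowerSeries ℚ) * typeSum n =
    ∑ x ∈ (Finset.range (n + 1)).filter (blockSize · ≤ n),
      (blockSize x : PowerSeries ℚ) * blockWeight x * typeSum (n - blockSize x) := by
  have h1 : ∀ M ∈ blockTypes n, (n : PowerSeries ℚ) * typeWeight M =
      ∑ x ∈ M.toFinset, (blockSize x : PowerSeries ℚ) * blockWeight x *
        typeWeight (M.erase x) := by
    intro M hM
    rw [mem_blockTypes] at hM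
    nth_rewrite 1 [← hM]
    rw [Finset.sum_multiset_map_count, Nat.cast_sum, Finset.sum_mul]
    refine Finset.sum_congr rfl fun x hx => ?_
    rw [mul_assoc, ← count_mul_typeWeight (Multiset.mem_toFinset.1 hx), smul_eq_mul, Nat.cast_mul]
    ring
  simp only [typeSum]
  rw [Finset.mul_sum, Finset.sum_congr rfl h1]
  simp only [Finset.mul_sum]
  rw [Finset.sum_sigma', Finset.sum_sigma']
  refine Finset.sum_bij' (fun p _ => ⟨p.2, p.1.erase p.2⟩) (fun p _ => ⟨p.1 ::ₘ p.2, p.1⟩)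
    ?_ ?_ ?_ ?_ ?_
  · rintro ⟨M, x⟩ hp
    simp only [Finset.mem_sigma, mem_blockTypes, Multiset.mem_toFinset] at hp
    obtain ⟨hM, hx⟩ := hp
    obtain ⟨M', rfl⟩ := Multiset.exists_cons_of_mem hx
    rw [Multiset.map_cons, Multiset.sum_cons] at hM
    have := le_blockSize x
    simp only [Finset.mem_sigma, Finset.mem_filter, Finset.mem_range, mem_blockTypes,
      Multiset.erase_cons_head]
    omega
  · rintro ⟨x, M⟩ hp
    simp only [Finset.mem_sigma, Finset.mem_filter, Finset.mem_range, mem_blockTypes] at hp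
    simp only [Finset.mem_sigma, mem_blockTypes, Multiset.mem_toFinset, Multiset.map_cons,
      Multiset.sum_cons, Multiset.mem_cons_self, and_true]
    omega
  · rintro ⟨M, x⟩ hp
    simp only [Finset.mem_sigma, Multiset.mem_toFinset] at hp
    simp [Multiset.cons_erase hp.2]
  · rintro ⟨x, M⟩ _
    simp
  · rintro ⟨M, x⟩ _
    rfl

theorem typeSum_zero : typeSum 0 = 1 := by
  have : blockTypes 0 = {0} := by
    ext M
    rw [mem_blockTypes, Finset.mem_singleton]
    constructor
    · intro h
      refine Multiset.eq_zero_of_forall_notMem fun x hx => ?_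
      have h1 : blockSize x ≤ (M.map blockSize).sum :=
        Multiset.single_le_sum (fun _ _ => Nat.zero_le _) _ (Multiset.mem_map_of_mem _ hx)
      have := blockSize_pos x
      omega
    · rintro rfl
      simp
  simp [typeSum, this, typeWeight, autCard]

theorem factorial_mul_C_inv {n k : ℕ} (hk : k ≤ n) :
    (n ! : PowerSeries ℚ) * C (1 / (k ! : ℚ)) = (n.choose k : PowerSeries ℚ) * ((n - k)! : ℕ) := by
  rw [← map_natCast (C (R := ℚ)) (n !), ← map_natCast (C (R := ℚ)) (n.choose k),
    ← map_natCast (C (R := ℚ)) ((n - k)!), ← map_mul, ← map_mul]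
  congr 1
  rw [← Nat.choose_mul_factorial_mul_factorial hk]
  have : (k ! : ℚ) ≠ 0 := Nat.cast_ne_zero.2 (Nat.factorial_ne_zero k)
  push_cast
  field_simp

/-- This is the recursion of the hydral series. For stars `n!/k! = C(n,k) (n-k)!`; for cubics the
size `3` times the weight `1/6` is `1/2!`, which gives the term `k = 2`. -/
theorem factorial_mul_typeSum_succ (n : ℕ) :
    ((n + 1)! : PowerSeries ℚ) * typeSum (n + 1) = ∑ k ∈ Finset.range (n + 1), n.choose k •
      ((((k + 1 : ℕ) : PowerSeries ℚ) * deltaSeries (k + 1) +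
        if k + 1 = 3 then X else 0) * (((n - k)! : PowerSeries ℚ) * typeSum (n - k))) := by
  have h := nat_mul_typeSum (n + 1)
  have h1 : ((n + 1)! : PowerSeries ℚ) * typeSum (n + 1) =
      (n ! : PowerSeries ℚ) * (((n + 1 : ℕ) : PowerSeries ℚ) * typeSum (n + 1)) := by
    rw [Nat.factorial_succ, Nat.cast_mul]
    ring
  have hstar : ∀ k ∈ Finset.range (n + 1), (if blockSize (k + 1) ≤ n + 1 then
      (blockSize (k + 1) : PowerSeries ℚ) * blockWeight (k + 1) *
        typeSum (n + 1 - blockSize (k + 1)) else 0) =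
      ((k + 1 : ℕ) : PowerSeries ℚ) * C (1 / (k ! : ℚ)) * deltaSeries (k + 1) *
        typeSum (n - k) := by
    intro k hk
    rw [Finset.mem_range] at hk
    have hs : blockSize (k + 1) = k + 1 := by simp [blockSize]
    have hw : blockWeight (k + 1) = C (1 / (k ! : ℚ)) * deltaSeries (k + 1) := by
      simp [blockWeight]
    rw [hs, hw, if_pos (by omega), Nat.add_sub_add_right]
    ring
  -- Peeling off the index `0` separates the cubics from the stars, whose codes are `k + 1`.
  rw [h1, h, Finset.sum_filter, Finset.sum_range_succ', Finset.sum_congr rfl hstar, mul_add,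
    Finset.mul_sum]
  simp only [add_mul, nsmul_eq_mul, mul_add, Finset.sum_add_distrib]
  congr 1
  · refine Finset.sum_congr rfl fun k hk => ?_
    rw [Finset.mem_range] at hk
    have := factorial_mul_C_inv (n := n) (k := k) (by omega)
    calc _ = ((n ! : PowerSeries ℚ) * C (1 / (k ! : ℚ))) * ((k + 1 : ℕ) : PowerSeries ℚ) *
          deltaSeries (k + 1) * typeSum (n - k) := by ring
      _ = _ := by rw [this]; ring
  · have h0 : blockSize 0 = 3 := rfl
    have hw : blockWeight 0 = C (1 / 6) * X := by simp [blockWeight]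
    rw [h0, hw]
    by_cases hn : 2 ≤ n
    · rw [if_pos (by omega), Finset.sum_eq_single 2]
      · have := factorial_mul_C_inv (n := n) (k := 2) hn
        have h3 : ((3 : ℕ) : PowerSeries ℚ) * C (1 / 6) = C (1 / (2 ! : ℚ)) := by
          rw [← map_natCast (C (R := ℚ)), ← map_mul]
          congr 1
          norm_num
        rw [if_pos rfl, show n + 1 - 3 = n - 2 by omega]
        calc _ = (n ! : PowerSeries ℚ) * (((3 : ℕ) : PowerSeries ℚ) * C (1 / 6)) * X *
              typeSum (n - 2) := by ring
          _ = _ := by rw [h3, this]; ring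
      · intro k _ hk
        rw [if_neg (by omega)]
        ring
      · intro h2
        rw [Finset.mem_range] at h2
        omega
    · rw [if_neg (by omega), mul_zero]
      symm
      refine Finset.sum_eq_zero fun k hk => ?_
      rw [Finset.mem_range] at hk
      rw [if_neg (by omega)]
      ring

theorem hydralSeries_eq_factorial_mul {V : Type*} [Fintype V] [DecidableEq V] (S : Finset V) :
    hydralSeries S = (S.card ! : PowerSeries ℚ) * typeSum S.card :=
  hydralSeries_eq_of_recursion (fun n => (n ! : PowerSeries ℚ) * typeSum n)
    (by simp [typeSum_zero]) factorial_mul_typeSum_succ S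

theorem prod_map_blockWeight {l : Multiset ℕ} (hl : ∀ x ∈ l, 0 < x) :
    (l.map blockWeight).prod =
      C (1 / (((l.map fun x => (x - 1)!).prod : ℕ) : ℚ)) * (l.map deltaSeries).prod := by
  induction l using Multiset.induction_on with
  | empty => simp
  | cons a l ih =>
    have ha : a ≠ 0 := (hl a (by simp)).ne'
    rw [Multiset.map_cons, Multiset.prod_cons, ih fun x hx => hl x (by simp [hx])]
    simp only [Multiset.map_cons, Multiset.prod_cons]
    rw [blockWeight, if_neg ha, Nat.cast_mul, ← one_div_mul_one_div, map_mul]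
    ring

/-- Both scalar factors equal `n! / (6^i i! |Aut λ'| ∏ (λ'_j - 1)!)` with `λ' = s^i(λ)`. The `i`
cubics supply `6^i`, `i!` and `X^i`. -/
theorem hydralCoeff_mul_Psi {n i : ℕ} {l : Multiset ℕ} (hl : ∀ x ∈ sFun^[i] l, 0 < x)
    (hn : (sFun^[i] l).sum + 3 * i = n) :
    C (hydralCoeff n l i) * Psi (sFun^[i] l) * X ^ i =
      (n ! : PowerSeries ℚ) * typeWeight (Multiset.replicate i 0 + sFun^[i] l) := by
  set l' := sFun^[i] l with hl'
  have h0 : 0 ∉ l' := fun h => (hl 0 h).ne rfl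
  rw [typeWeight, autCard_replicate_zero_add i h0, Multiset.map_add, Multiset.prod_add,
    Multiset.map_replicate, Multiset.prod_replicate, prod_map_blockWeight hl, Psi_eq hl,
    hydralCoeff, ← hl', fFun_eq hl, blockWeight, if_pos rfl, mul_pow, ← map_pow,
    ← map_natCast (C (R := ℚ)) (n !)]
  have hc : (n.choose (3 * i) : ℚ) * (((3 * i)! : ℚ) / (6 ^ i * (i ! : ℚ))) *
      ((l'.sum ! : ℚ) / (autCard l' * ((l'.map fun x => (x - 1)!).prod : ℕ))) =
      (n ! : ℚ) * ((1 / ((i ! * autCard l' : ℕ) : ℚ)) * ((1 / 6) ^ i *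
        (1 / (((l'.map fun x => (x - 1)!).prod : ℕ) : ℚ)))) := by
    have h1 := Nat.choose_mul_factorial_mul_factorial (n := n) (k := 3 * i) (by omega)
    rw [show n - 3 * i = l'.sum by omega] at h1
    rw [← h1]
    push_cast
    simp only [div_eq_mul_inv, mul_inv, one_mul, inv_pow]
    ring
  rw [hc]
  simp only [map_mul]
  ring

theorem pos_of_mem_sFun_iterate {n : ℕ} (l : n.Partition) (i : ℕ) :
    ∀ x ∈ sFun^[i] l.parts, 0 < x := by
  intro x hx
  rw [sFun_iterate] at hx
  exact l.parts_pos (Multiset.mem_of_le (Multiset.sub_le_self _ _) hx)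

theorem sFun_iterate_add {i : ℕ} {l : Multiset ℕ} (hi : i ≤ tFun l) :
    sFun^[i] l + Multiset.replicate i 3 = l := by
  rw [sFun_iterate]
  exact Multiset.sub_add_cancel (Multiset.le_count_iff_replicate_le.1 hi)

theorem sum_sFun_iterate {n : ℕ} (l : n.Partition) {i : ℕ} (hi : i ≤ tFun l.parts) :
    (sFun^[i] l.parts).sum + 3 * i = n := by
  have h := congrArg Multiset.sum (sFun_iterate_add hi)
  rw [Multiset.sum_add, Multiset.sum_replicate, l.parts_sum, smul_eq_mul] at h
  omega

theorem map_blockSize_of_pos {l : Multiset ℕ} (hl : ∀ x ∈ l, 0 < x) : l.map blockSize = l := by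
  conv_rhs => rw [← Multiset.map_id l]
  refine Multiset.map_congr rfl fun x hx => ?_
  rw [blockSize, if_neg (hl x hx).ne', id]

/-- A pair `(λ, i)` amounts to declaring `i` of the parts `3` of `λ` to be cubics, that is, to a
multiset of block codes in which `0` occurs `i` times. Turning the zeros back into threes is the
inverse. -/
theorem sum_hydralCoeff_mul_Psi (n : ℕ) :
    ∑ l : n.Partition, ∑ i ∈ Finset.range (tFun l.parts + 1),
      C (hydralCoeff n l.parts i) * Psi (sFun^[i] l.parts) * X ^ i =
      (n ! : PowerSeries ℚ) * typeSum n := by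
  rw [typeSum, Finset.mul_sum, Finset.sum_sigma']
  refine Finset.sum_bij (fun p _ => Multiset.replicate p.2 0 + sFun^[p.2] p.1.parts) ?_ ?_ ?_ ?_
  · rintro ⟨l, i⟩ hp
    simp only [Finset.mem_sigma, Finset.mem_univ, true_and, Finset.mem_range] at hp
    rw [mem_blockTypes, Multiset.map_add, Multiset.sum_add, Multiset.map_replicate,
      map_blockSize_of_pos (pos_of_mem_sFun_iterate l i), Multiset.sum_replicate]
    have := sum_sFun_iterate l (i := i) (by omega)
    rw [show blockSize 0 = 3 from rfl, smul_eq_mul]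
    simp only
    omega
  · rintro ⟨l, i⟩ hp ⟨l', i'⟩ hp' heq
    simp only [Finset.mem_sigma, Finset.mem_univ, true_and, Finset.mem_range] at hp hp' heq
    have h0 : ∀ (l : n.Partition) i, (Multiset.replicate i 0 + sFun^[i] l.parts).count 0 = i := by
      intro l i
      rw [Multiset.count_add, Multiset.count_replicate_self, Multiset.count_eq_zero_of_notMem,
        add_zero]
      intro h
      exact (pos_of_mem_sFun_iterate l i 0 h).ne rfl
    have hi : i = i' := by rw [← h0 l i, heq, h0]
    subst hi
    have hl := add_left_cancel heq
    have : l.parts = l'.parts := by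
      rw [← sFun_iterate_add (l := l.parts) (i := i) (by omega), hl, sFun_iterate_add (by omega)]
    have hll : l = l' := Nat.Partition.ext this
    subst hll
    rfl
  · intro M hM
    rw [mem_blockTypes] at hM
    let N := M.filter (· ≠ 0)
    have hN : Multiset.replicate (M.count 0) 0 + N = M := by
      have := Multiset.filter_add_not (· = 0) M
      rwa [Multiset.filter_eq'] at this
    have hNpos : ∀ x ∈ N, 0 < x := fun x hx => Nat.pos_of_ne_zero (Multiset.mem_filter.1 hx).2
    have hsum : N.sum + 3 * M.count 0 = n := by
      have h := hM
      rw [← hN, Multiset.map_add, Multiset.sum_add, Multiset.map_replicate,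
        map_blockSize_of_pos hNpos, Multiset.sum_replicate, show blockSize 0 = 3 from rfl,
        smul_eq_mul] at h
      omega
    let l : n.Partition := ⟨N + Multiset.replicate (M.count 0) 3, by
      intro x hx
      rcases Multiset.mem_add.1 hx with hx | hx
      · exact hNpos x hx
      · rw [Multiset.eq_of_mem_replicate hx]
        omega, by
      rw [Multiset.sum_add, Multiset.sum_replicate, smul_eq_mul]
      omega⟩
    refine ⟨⟨l, M.count 0⟩, ?_, ?_⟩
    · simp only [Finset.mem_sigma, Finset.mem_univ, true_and, Finset.mem_range, tFun, l,
        Multiset.count_add, Multiset.count_replicate_self]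
      omega
    · simp only [sFun_iterate, l]
      rw [Multiset.add_sub_cancel_right, hN]
  · rintro ⟨l, i⟩ hp
    simp only [Finset.mem_sigma, Finset.mem_univ, true_and, Finset.mem_range] at hp
    exact hydralCoeff_mul_Psi (pos_of_mem_sFun_iterate l i) (sum_sFun_iterate l (Nat.lt_succ_iff.1 hp))

end Exponential

/-! ### From components to the structure statement -/

section Structure

variable {V : Type*} [Fintype V] [DecidableEq V]

theorem smul_e_apply (a : V) (c : ℕ) (i : V) : (c • e a) i = if i = a then c else 0 := by
  simp [e_apply]

theorem smul_e_injective (a : V) : Function.Injective fun c : ℕ => c • e a := fun c d h => by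
  have := congrFun h a
  simpa using this

theorem Iic_smul_e (a : V) (c : ℕ) :
    Finset.Iic (c • e a) = (Finset.range (c + 1)).image fun b => b • e a := by
  ext y
  rw [Finset.mem_Iic, Finset.mem_image]
  constructor
  · intro hy
    have hy' : ∀ i, y i ≤ if i = a then c else 0 := fun i => by
      rw [← smul_e_apply]
      exact hy i
    refine ⟨y a, ?_, ?_⟩
    · have := hy' a
      rw [if_pos rfl] at this
      exact Finset.mem_range.2 (by omega)
    · funext i
      rw [smul_e_apply]
      have := hy' i
      grind
  · rintro ⟨b, hb, rfl⟩ i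
    rw [Finset.mem_range] at hb
    change (b • e a) i ≤ (c • e a) i
    rw [smul_e_apply, smul_e_apply]
    split_ifs <;> omega

/-- Such a partition has `1 + 1 + 1 + m` elements, all powers of one variable with exponent less
than this number, so it contains all of them. -/
theorem isHydralOn_singleton_iff {a : V} {l : Finset (V → ℕ)} {m : ℕ} :
    IsHydralOn {a} l m ↔ 1 ≤ m ∧ l = Finset.Iic ((m + 2) • e a) := by
  constructor
  · intro h
    have hc := card_eq_of_zero_mem h.zero_mem
    rw [h.hilb_one, h.hilb_two, h.card_degGe, Finset.card_singleton] at hc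
    refine ⟨h.pos (Finset.singleton_nonempty a), ?_⟩
    rw [Iic_smul_e]
    refine Finset.eq_of_subset_of_card_le (fun y hy => ?_) ?_
    · rw [Finset.mem_image]
      refine ⟨y a, Finset.mem_range.2 ?_, ?_⟩
      · have := h.isPartition.apply_lt_card hy a
        omega
      · funext i
        rw [smul_e_apply]
        split_ifs with hi
        · rw [hi]
        · by_contra h0
          exact hi (Finset.mem_singleton.1 (h.support y hy i (Ne.symm h0)))
    · rw [Finset.card_image_of_injective _ (smul_e_injective a), Finset.card_range]
      omega
  · rintro ⟨hm, rfl⟩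
    have hmem : ∀ y, y ∈ Finset.Iic ((m + 2) • e a) ↔ ∃ b ≤ m + 2, b • e a = y := fun y => by
      rw [Iic_smul_e, Finset.mem_image]
      simp only [Finset.mem_range, Nat.lt_succ_iff]
    have hdeg : ∀ b : ℕ, deg (b • e a) = b := fun b => by rw [deg_smul, deg_e, mul_one]
    refine ⟨?_, ?_, ?_, ?_, ?_, ?_, ?_⟩
    · intro z hz y hy
      rw [Finset.mem_Iic] at hz ⊢
      exact hy.trans hz
    · exact Finset.mem_Iic.2 fun _ => Nat.zero_le _
    · intro y hy i hi
      obtain ⟨b, -, rfl⟩ := (hmem y).1 hy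
      rw [smul_e_apply] at hi
      rw [Finset.mem_singleton]
      by_contra hia
      simp [hia] at hi
    · intro i hi
      rw [Finset.mem_singleton.1 hi, hmem]
      exact ⟨1, by omega, one_smul _ _⟩
    · rw [Finset.card_singleton, hilb, Finset.card_eq_one]
      refine ⟨2 • e a, ?_⟩
      ext y
      rw [mem_degEq, hmem, Finset.mem_singleton]
      constructor
      · rintro ⟨⟨b, -, rfl⟩, hd⟩
        rw [hdeg] at hd
        rw [hd]
      · rintro rfl
        exact ⟨⟨2, by omega, rfl⟩, hdeg 2⟩
    · intro y hy _
      exact ⟨_, Finset.mem_Iic.2 le_rfl, Finset.mem_Iic.1 hy, by rw [hdeg]; omega⟩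
    · have : degGe (Finset.Iic ((m + 2) • e a)) 3 =
          (Finset.Icc 3 (m + 2)).image fun b => b • e a := by
        ext y
        rw [mem_degGe, hmem, Finset.mem_image]
        constructor
        · rintro ⟨⟨b, hb, rfl⟩, hd⟩
          rw [hdeg] at hd
          exact ⟨b, Finset.mem_Icc.2 ⟨hd, hb⟩, rfl⟩
        · rintro ⟨b, hb, rfl⟩
          rw [Finset.mem_Icc] at hb
          exact ⟨⟨b, hb.2, rfl⟩, by rw [hdeg]; exact hb.1⟩
      rw [this, Finset.card_image_of_injective _ (smul_e_injective a), Nat.card_Icc]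
      omega

theorem apolar_singleton (z : V → ℕ) : apolar {z} = (Finset.Iic z : Set (V → ℕ)) := by
  ext y
  simp [apolar]

theorem IsStarOn.isHeadstrong {v : V} {l : Finset (V → ℕ)} {m : ℕ}
    (h : IsStarOn Finset.univ v l m) (hV : 2 ≤ Fintype.card V) : IsHeadstrong l m := by
  have : Nonempty V := ⟨v⟩
  obtain ⟨γ, hγ, rfl⟩ := h.exists_code
  obtain ⟨n, hn⟩ : ∃ n, Fintype.card V = n + 1 := ⟨Fintype.card V - 1, by omega⟩
  let σ₀ : Fin (n + 1) ≃ V := (Fintype.equivFinOfCardEq hn).symm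
  let σ : Fin (n + 1) ≃ V := (Equiv.swap 0 (σ₀.symm v)).trans σ₀
  have hσ0 : σ 0 = v := by simp [σ]
  have hσ : ∀ j : Fin n, σ j.succ ≠ v := fun j hj => by
    rw [← hσ0] at hj
    exact Fin.succ_ne_zero j (σ.injective hj)
  -- The composition keeps the exponent of the head and lowers the others by one, which turns `γ w ≤
  -- γ v + 1` into the headstrong condition and the total `m` into `m - n`.
  let α : Fin (n + 1) → ℕ := Fin.cons (γ v) fun j => γ (σ j.succ) - 1
  have hα0 : α 0 = γ v := rfl
  have hαs : ∀ j : Fin n, α j.succ + 1 = γ (σ j.succ) := fun j =>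
    Nat.sub_add_cancel (hγ.one_le _ (hσ j))
  have hsum : ∑ j, α j + n = m := by
    rw [← hγ.sum_eq, ← σ.sum_comp, Fin.sum_univ_succ, Fin.sum_univ_succ, hσ0, hα0]
    simp only [← hαs, Finset.sum_add_distrib, Finset.sum_const, Finset.card_univ,
      Fintype.card_fin, smul_eq_mul, mul_one, add_assoc]
  refine ⟨isMPartition_iff.2 h.1, hV, by omega, n + 1, inferInstance, σ, α, ⟨by omega, ?_⟩, ?_⟩
  · intro i
    refine Fin.cases le_rfl (fun j => ?_) i
    have := hγ.le_head (σ j.succ)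
    have := hαs j
    omega
  · ext y
    rw [hσ0, Finset.mem_coe]
    constructor
    · intro hy
      rcases mem_starSet.1 hy with rfl | ⟨w, a, ha, rfl⟩
      · exact ⟨_, Or.inl rfl, fun _ => Nat.zero_le _⟩
      · by_cases hw : w = v
        · subst hw
          refine ⟨_, Or.inl rfl, ?_⟩
          rw [← succ_nsmul', hα0]
          exact fun i => Nat.mul_le_mul_right _ (by omega)
        · obtain ⟨i, rfl⟩ := σ.surjective w
          have hi : i ≠ 0 := by rintro rfl; exact hw hσ0
          refine ⟨_, Or.inr ⟨i, hi, rfl⟩, ?_⟩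
          obtain ⟨j, rfl⟩ := Fin.exists_succ_eq.2 hi
          have := hαs j
          exact e_add_smul_e_le (by omega) (Or.inl rfl)
    · rintro ⟨z, hz, hyz⟩
      refine h.1.isPartition z ?_ y hyz
      rcases hz with rfl | ⟨i, hi, rfl⟩
      · exact smul_e_mem_starSet (by rw [hα0])
      · obtain ⟨j, rfl⟩ := Fin.exists_succ_eq.2 hi
        have := hαs j
        rw [e_add_smul_e_mem_starSet]
        omega

theorem extendZero_eq {k : ℕ} (B : Finset (Fin k)) :
    extendZero B = extendAlong (Function.Embedding.subtype (· ∈ B)) := by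
  funext y j
  rw [extendZero]
  split_ifs with h
  · exact (extendAlong_apply (Function.Embedding.subtype (· ∈ B)) y ⟨j, h⟩).symm
  · symm
    refine extendAlong_of_notMem _ _ fun w hw => h ?_
    rw [← hw]
    exact w.2

theorem univ_map_subtype (B : Finset V) :
    (Finset.univ : Finset B).map (Function.Embedding.subtype (· ∈ B)) = B := by
  ext x
  simp

theorem isHydralOn_of_hydralData {n m : ℕ} (hn : 1 ≤ n) (D : HydralData n m)
    {l : Finset (Fin n → ℕ)} (hl : (l : Set (Fin n → ℕ)) = D.shape) :
    IsHydralOn Finset.univ l m := by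
  let S : Fin D.r ⊕ Fin D.s ⊕ Fin D.t → Finset (Fin n) :=
    Sum.elim (fun i => {D.a i}) (Sum.elim D.B D.C)
  let L : Fin D.r ⊕ Fin D.s ⊕ Fin D.t → Finset (Fin n → ℕ) :=
    Sum.elim (fun i => Finset.Iic ((D.mA i + 3) • e (D.a i)))
      (Sum.elim (fun i => (D.pieces i).image (extendZero (D.B i)))
        fun i => Finset.Iic (∑ j ∈ D.C i, e j))
  let M : Fin D.r ⊕ Fin D.s ⊕ Fin D.t → ℕ :=
    Sum.elim (fun i => D.mA i + 1) (Sum.elim (fun i => D.nB i + (D.B i).card - 1) fun _ => 1)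
  have h : ∀ k, IsHydralOn (S k) (L k) (M k) := by
    rintro (i | i | i)
    · exact isHydralOn_singleton_iff.2 ⟨Nat.le_add_left _ _, rfl⟩
    · have hne : Nonempty (D.B i) := by
        have := D.two_le_card_B i
        obtain ⟨x, hx⟩ := Finset.card_pos.1 (by omega : 0 < (D.B i).card)
        exact ⟨⟨x, hx⟩⟩
      have h1 := isMPartition_iff.1 (D.headstrong i).1
      rw [← isHydralOn_image_extendAlong (f := Function.Embedding.subtype (· ∈ D.B i)),
        univ_map_subtype, ← extendZero_eq] at h1
      exact h1
    · exact IsCubicOn.isHydralOn ⟨D.card_C i, rfl, rfl⟩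
  have h1 := isHydralOn_biUnion Finset.univ S (fun i _ j _ hij => D.disjoint hij) L M
    fun k _ => h k
  have hS : Finset.univ.biUnion S = Finset.univ := by
    ext x
    simp only [Finset.mem_biUnion, Finset.mem_univ, true_and, iff_true]
    rcases D.cover x with ⟨i, hi⟩ | ⟨i, hi⟩ | ⟨i, hi⟩
    · exact ⟨Sum.inl i, by simp [S, hi]⟩
    · exact ⟨Sum.inr (Sum.inl i), hi⟩
    · exact ⟨Sum.inr (Sum.inr i), hi⟩
  have hL : insert 0 (Finset.univ.biUnion L) = l := by
    -- As `n ≥ 1` there is at least one piece, and it contains `0`, so the inserted `0` can be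
    -- dropped.
    obtain ⟨k, -, -⟩ : ∃ k, k ∈ Finset.univ ∧ (⟨0, hn⟩ : Fin n) ∈ S k := by
      rw [← Finset.mem_biUnion, hS]
      exact Finset.mem_univ _
    rw [Finset.insert_eq_self.2 (Finset.mem_biUnion.2 ⟨k, Finset.mem_univ k, (h k).zero_mem⟩),
      ← Finset.coe_inj, hl]
    simp only [HydralData.shape, apolar_singleton]
    ext y
    simp only [Finset.coe_biUnion, Finset.coe_univ, Set.mem_univ, Set.iUnion_true, Set.mem_iUnion,
      Sum.exists, Set.mem_union, L, Sum.elim_inl, Sum.elim_inr, Finset.coe_image, or_assoc]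
  -- The pieces have `m_i + 1`, `n_i + |B_i| - 1` and `1` elements of degree at least three, which
  -- accounts for the correction `r + t - s + ∑ |B_i|`.
  have hM : ∑ k, M k = m := by
    have h2 := D.sum_eq
    have h3 : ((∑ k, M k : ℕ) : ℤ) = m := by
      have h4 : ∀ i, ((D.nB i + (D.B i).card - 1 : ℕ) : ℤ) = D.nB i + (D.B i).card - 1 := by
        intro i
        have := D.two_le_card_B i
        omega
      simp only [Fintype.sum_sum_type, M, Sum.elim_inl, Sum.elim_inr]
      push_cast
      simp only [h4, Finset.sum_add_distrib, Finset.sum_sub_distrib, Finset.sum_const,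
        Finset.card_univ, Fintype.card_fin, nsmul_eq_mul, mul_one]
      linarith
    exact_mod_cast h3
  rwa [hS, hL, hM] at h1

/-- `B` is the set of variables of a connected piece of `l`. -/
def IsComponent (l : Finset (V → ℕ)) (B : Finset V) : Prop :=
  B.Nonempty ∧ IsSeparated l B ∧ ∃ c i, IsBlock B c (restrict l B) i

theorem IsComponent.disjoint {l : Finset (V → ℕ)} {B B' : Finset V} (h : IsComponent l B)
    (h' : IsComponent l B') (hne : B ≠ B') : Disjoint B B' := by
  rw [Finset.disjoint_left]
  intro x hx hx'
  obtain ⟨-, hs, c, i, hb⟩ := h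
  obtain ⟨-, hs', c', i', hb'⟩ := h'
  exact hne (Finset.Subset.antisymm (hb.subset_of_isSeparated hs' hx hx')
    (hb'.subset_of_isSeparated hs hx' hx))

theorem exists_family_of_finset {α : Type*} (s : Finset α) :
    ∃ g : Fin s.card → α, Function.Injective g ∧ ∀ x, x ∈ s ↔ ∃ i, g i = x := by
  refine ⟨fun i => s.equivFin.symm i, fun i j h => s.equivFin.symm.injective (Subtype.ext h),
    fun x => ⟨fun hx => ⟨s.equivFin ⟨x, hx⟩, by simp⟩, ?_⟩⟩
  rintro ⟨i, rfl⟩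
  exact (s.equivFin.symm i).2

/-- The blocks of the set partition are the components: one-element stars give the `A_i`, larger
stars the `B_i`, and loopless triangles the `C_i`. -/
theorem exists_hydralData {n m : ℕ} (hn : 1 ≤ n) {l : Finset (Fin n → ℕ)}
    (h : IsHydralOn Finset.univ l m) :
    ∃ D : HydralData n m, (l : Set (Fin n → ℕ)) = D.shape := by
  classical
  let P : Finset (Finset (Fin n)) := Finset.univ.filter (IsComponent l)
  let μ : Finset (Fin n) → ℕ := fun B => (degGe (restrict l B) 3).card
  have hblock : ∀ B, IsComponent l B → IsHydralOn B (restrict l B) (μ B) := by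
    rintro B ⟨-, -, c, i, hb⟩
    have := hb.isHydralOn
    rwa [← this.card_degGe] at this
  have hcover : ∀ x, ∃ B, IsComponent l B ∧ x ∈ B := fun x => by
    obtain ⟨B, hx, -, hs, hb⟩ := h.exists_block (Finset.mem_univ x)
    exact ⟨B, ⟨⟨x, hx⟩, hs, hb⟩, hx⟩
  have hmem : ∀ y, y ∈ l ↔ ∃ B, IsComponent l B ∧ y ∈ restrict l B := by
    intro y
    constructor
    · intro hy
      by_cases h0 : y = 0
      · subst h0
        obtain ⟨B, hB, -⟩ := hcover ⟨0, hn⟩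
        exact ⟨B, hB, (hblock B hB).zero_mem⟩
      · obtain ⟨x, hx⟩ := Function.ne_iff.1 h0
        obtain ⟨B, hB, hxB⟩ := hcover x
        exact ⟨B, hB, mem_restrict.2 ⟨hy, fun i hi =>
          hB.2.1.mem_of_mem h.isPartition hy hx hi hxB⟩⟩
    · rintro ⟨B, -, hy⟩
      exact (mem_restrict.1 hy).1
  have hμ : ∑ B ∈ P, μ B = m := by
    have h1 := isHydralOn_biUnion P id (fun B hB B' hB' hne =>
      (Finset.mem_filter.1 hB).2.disjoint (Finset.mem_filter.1 hB').2 hne) (restrict l) μ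
      fun B hB => hblock B (Finset.mem_filter.1 hB).2
    have h2 : insert 0 (P.biUnion (restrict l)) = l := by
      ext y
      rw [Finset.mem_insert, Finset.mem_biUnion, hmem]
      simp only [P, Finset.mem_filter, Finset.mem_univ, true_and]
      constructor
      · rintro (rfl | hy)
        · exact (hmem 0).1 h.zero_mem
        · exact hy
      · exact Or.inr
    rw [h2] at h1
    rw [← h1.card_degGe, h.card_degGe]
  have hcard : ∀ B, IsComponent l B → (∃ a, B = {a}) ∨
      (2 ≤ B.card ∧ ∃ v, IsStarOn B v (restrict l B) (μ B)) ∨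
        (B.card = 3 ∧ IsCubicOn B (restrict l B) (μ B)) := by
    intro B hB
    obtain ⟨hne, -, c, i, hb⟩ := id hB
    have hi : i = μ B := hb.isHydralOn.card_degGe.symm
    subst hi
    cases c with
    | none => exact Or.inr (Or.inr ⟨hb.1, hb⟩)
    | some v =>
      by_cases h1 : B.card = 1
      · exact Or.inl (Finset.card_eq_one.1 h1)
      · have := Finset.card_pos.2 hne
        exact Or.inr (Or.inl ⟨by omega, v, hb⟩)
  let PA : Finset (Fin n) := Finset.univ.filter fun a => IsComponent l {a}
  let PB : Finset (Finset (Fin n)) := Finset.univ.filter fun B =>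
    IsComponent l B ∧ 2 ≤ B.card ∧ ∃ v, IsStarOn B v (restrict l B) (μ B)
  let PC : Finset (Finset (Fin n)) := Finset.univ.filter fun B =>
    IsComponent l B ∧ B.card = 3 ∧ IsCubicOn B (restrict l B) (μ B)
  obtain ⟨a, ha, hPA⟩ := exists_family_of_finset PA
  obtain ⟨b, hb, hPB⟩ := exists_family_of_finset PB
  obtain ⟨c, hc, hPC⟩ := exists_family_of_finset PC
  have hA : ∀ i, IsComponent l {a i} := fun i =>
    (Finset.mem_filter.1 ((hPA _).2 ⟨i, rfl⟩)).2
  have hB : ∀ i, IsComponent l (b i) ∧ 2 ≤ (b i).card ∧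
      ∃ v, IsStarOn (b i) v (restrict l (b i)) (μ (b i)) := fun i =>
    (Finset.mem_filter.1 ((hPB _).2 ⟨i, rfl⟩)).2
  have hC : ∀ i, IsComponent l (c i) ∧ (c i).card = 3 ∧
      IsCubicOn (c i) (restrict l (c i)) (μ (c i)) := fun i =>
    (Finset.mem_filter.1 ((hPC _).2 ⟨i, rfl⟩)).2
  let G : Fin PA.card ⊕ Fin PB.card ⊕ Fin PC.card → Finset (Fin n) :=
    Sum.elim (fun i => {a i}) (Sum.elim b c)
  have hGcomp : ∀ k, IsComponent l (G k) := by
    rintro (i | i | i)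
    · exact hA i
    · exact (hB i).1
    · exact (hC i).1
  have hGinj : Function.Injective G := by
    have h1 : ∀ i j, ({a i} : Finset (Fin n)) ≠ b j := fun i j hij => by
      have := (hB j).2.1
      rw [← hij, Finset.card_singleton] at this
      omega
    have h2 : ∀ i j, ({a i} : Finset (Fin n)) ≠ c j := fun i j hij => by
      have := (hC j).2.1
      rw [← hij, Finset.card_singleton] at this
      omega
    -- A three-element star and a cubic have equal size, and are told apart by the loop.
    have h3 : ∀ i j, b i ≠ c j := fun i j hij => by
      obtain ⟨v, hv⟩ := (hB i).2.2
      have h4 := (hC j).2.2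
      rw [← hij] at h4
      have := IsBlock.index_unique (c := some v) (c' := none) hv h4
      simp at this
    rintro (i | i | i) (j | j | j) hij
    · rw [ha (Finset.singleton_injective hij)]
    · exact absurd hij (h1 i j)
    · exact absurd hij (h2 i j)
    · exact absurd hij.symm (h1 j i)
    · rw [hb hij]
    · exact absurd hij (h3 i j)
    · exact absurd hij.symm (h2 j i)
    · exact absurd hij.symm (h3 j i)
    · rw [hc hij]
  have hGsurj : ∀ B, IsComponent l B → ∃ k, G k = B := by
    intro B hBc
    rcases hcard B hBc with ⟨x, rfl⟩ | h1 | h1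
    · obtain ⟨i, hi⟩ := (hPA x).1 (by simp [PA, hBc])
      exact ⟨Sum.inl i, by simp [G, hi]⟩
    · obtain ⟨i, hi⟩ := (hPB B).1 (Finset.mem_filter.2 ⟨Finset.mem_univ _, hBc, h1⟩)
      exact ⟨Sum.inr (Sum.inl i), hi⟩
    · obtain ⟨i, hi⟩ := (hPC B).1 (Finset.mem_filter.2 ⟨Finset.mem_univ _, hBc, h1⟩)
      exact ⟨Sum.inr (Sum.inr i), hi⟩
  have hsum : ∑ i, μ {a i} + (∑ i, μ (b i) + ∑ i, μ (c i)) = m := by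
    rw [← hμ, ← show ∑ k, μ (G k) = ∑ i, μ {a i} + (∑ i, μ (b i) + ∑ i, μ (c i)) by
      simp [Fintype.sum_sum_type, G]]
    refine Finset.sum_bij (fun k _ => G k) (fun k _ => ?_) (fun k _ k' _ hk => hGinj hk)
      (fun B hB => ?_) fun _ _ => rfl
    · exact Finset.mem_filter.2 ⟨Finset.mem_univ _, hGcomp k⟩
    · obtain ⟨k, hk⟩ := hGsurj B (Finset.mem_filter.1 hB).2
      exact ⟨k, Finset.mem_univ _, hk⟩
  have hAμ : ∀ i, 1 ≤ μ {a i} ∧ restrict l {a i} = Finset.Iic ((μ {a i} + 2) • e (a i)) :=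
    fun i => isHydralOn_singleton_iff.1 (hblock _ (hA i))
  have hBimage : ∀ i, ((restrict l (b i)).image (· ∘ Function.Embedding.subtype (· ∈ b i))).image
      (extendAlong (Function.Embedding.subtype (· ∈ b i))) = restrict l (b i) := fun i =>
    image_extendAlong_image_comp (by
      rw [univ_map_subtype]
      exact (hblock _ (hB i).1).support)
  have hBhead : ∀ i, IsHeadstrong
      ((restrict l (b i)).image (· ∘ Function.Embedding.subtype (· ∈ b i))) (μ (b i)) := by
    intro i
    obtain ⟨h1, h2, v, hv⟩ := hB i
    have h3 : IsStarOn (Finset.univ.map (Function.Embedding.subtype (· ∈ b i)))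
        (Function.Embedding.subtype (· ∈ b i) ⟨v, hv.2.1⟩)
        (((restrict l (b i)).image (· ∘ Function.Embedding.subtype (· ∈ b i))).image
          (extendAlong (Function.Embedding.subtype (· ∈ b i)))) (μ (b i)) := by
      rw [hBimage, univ_map_subtype]
      exact hv
    exact (isStarOn_image_extendAlong.1 h3).isHeadstrong (by rwa [Fintype.card_coe])
  have hBμ : ∀ i, (b i).card ≤ μ (b i) + 1 := fun i => by
    have := (hBhead i).2.2.1
    rwa [Fintype.card_coe] at this
  refine ⟨{
    r := PA.card
    s := PB.card
    t := PC.card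
    a := a
    B := b
    C := c
    disjoint := fun i j hij => (hGcomp i).disjoint (hGcomp j) fun hG => hij (hGinj hG)
    cover := ?_
    two_le_card_B := fun i => (hB i).2.1
    card_C := fun i => (hC i).2.1
    -- Neither this subtraction nor the next is truncated: `μ {a i} ≥ 1` by `hAμ`, and `μ (b i) + 1
    -- ≥ |b i|` by `hBμ`.
    mA := fun i => μ {a i} - 1
    nB := fun i => μ (b i) + 1 - (b i).card
    sum_eq := ?_
    pieces := fun i => (restrict l (b i)).image (· ∘ Function.Embedding.subtype (· ∈ b i))
    headstrong := ?_ }, ?_⟩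
  · intro x
    obtain ⟨B, hBc, hx⟩ := hcover x
    obtain ⟨k, rfl⟩ := hGsurj B hBc
    rcases k with i | i | i
    · exact Or.inl ⟨i, Finset.mem_singleton.1 hx⟩
    · exact Or.inr (Or.inl ⟨i, hx⟩)
    · exact Or.inr (Or.inr ⟨i, hx⟩)
  · have h1 : ∀ i, ((μ {a i} - 1 : ℕ) : ℤ) = (μ {a i} : ℤ) - 1 := fun i => by
      have := (hAμ i).1
      omega
    have h2 : ∀ i, ((μ (b i) + 1 - (b i).card : ℕ) : ℤ) = (μ (b i) : ℤ) + 1 - (b i).card :=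
      fun i => by
        have := hBμ i
        omega
    have h3 : ∀ i, μ (c i) = 1 := fun i => (hC i).2.2.2.1
    rw [← hsum]
    simp only [h1, h2, h3]
    push_cast
    simp only [Finset.sum_add_distrib, Finset.sum_sub_distrib, Finset.sum_const,
      Finset.card_univ, Fintype.card_fin, nsmul_eq_mul, mul_one]
    ring
  · intro i
    have h1 : μ (b i) + 1 - (b i).card + (b i).card - 1 = μ (b i) := by
      have := hBμ i
      omega
    rw [h1]
    exact hBhead i
  · have hshapeB : ∀ i, extendZero (b i) '' (((restrict l (b i)).image
        (· ∘ Function.Embedding.subtype (· ∈ b i)) : Finset (b i → ℕ)) : Set (b i → ℕ)) =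
        (restrict l (b i) : Set (Fin n → ℕ)) := fun i => by
      rw [extendZero_eq, ← Finset.coe_image, hBimage]
    have hshapeA : ∀ i, apolar {(μ {a i} - 1 + 3) • e (a i)} =
        (restrict l {a i} : Set (Fin n → ℕ)) := fun i => by
      have := (hAμ i).1
      rw [apolar_singleton, (hAμ i).2, show μ {a i} - 1 + 3 = μ {a i} + 2 by omega]
    have hshapeC : ∀ i, apolar {∑ j ∈ c i, e j} =
        (restrict l (c i) : Set (Fin n → ℕ)) := fun i => by
      rw [apolar_singleton, (hC i).2.2.2.2]
    ext y
    simp only [HydralData.shape, hshapeA, hshapeB, hshapeC, Set.mem_union, Set.mem_iUnion,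
      Finset.mem_coe]
    rw [hmem]
    constructor
    · rintro ⟨B, hBc, hy⟩
      obtain ⟨k, rfl⟩ := hGsurj B hBc
      rcases k with i | i | i
      · exact Or.inl (Or.inl ⟨i, hy⟩)
      · exact Or.inl (Or.inr ⟨i, hy⟩)
      · exact Or.inr ⟨i, hy⟩
    · rintro ((⟨i, hy⟩ | ⟨i, hy⟩) | ⟨i, hy⟩)
      · exact ⟨_, hA i, hy⟩
      · exact ⟨_, (hB i).1, hy⟩
      · exact ⟨_, (hC i).1, hy⟩

end Structure

/-! ### Passage to the numbers `α^n_{n,m}` -/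

section Counting

theorem isMPartition_fin_iff {n m : ℕ} (hn : 1 ≤ n) {l : Finset (Fin n → ℕ)} :
    IsMPartition l n m ↔ IsHydralOn Finset.univ l m := by
  have : Nonempty (Fin n) := ⟨⟨0, hn⟩⟩
  have h := isMPartition_iff (V := Fin n) (l := l) (m := m)
  rwa [Fintype.card_fin] at h

theorem mk_alpha_eq {n : ℕ} (hn : 1 ≤ n) :
    (PowerSeries.mk fun m => (alpha n n m : ℚ)) =
      ∑ l : n.Partition, ∑ i ∈ Finset.range (tFun l.parts + 1),
        PowerSeries.C (hydralCoeff n l.parts i) * Psi (sFun^[i] l.parts) * PowerSeries.X ^ i := by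
  have h := hydralSeries_eq_factorial_mul (Finset.univ : Finset (Fin n))
  rw [Finset.card_univ, Fintype.card_fin] at h
  rw [sum_hydralCoeff_mul_Psi, ← h]
  ext m
  rw [hydralSeries, PowerSeries.coeff_mk, PowerSeries.coeff_mk, alpha, if_neg (by omega)]
  rw [Nat.card_congr (Equiv.subtypeEquivRight fun l => isMPartition_fin_iff hn)]

/-- For `m < i` both sides vanish, since `mu` is zero at negative integers; hence its integer
argument. -/
theorem coeff_Psi_mul_X_pow (l : Multiset ℕ) (i m : ℕ) :
    PowerSeries.coeff m (Psi l * PowerSeries.X ^ i) = (mu l ((m : ℤ) - i) : ℚ) := by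
  rw [PowerSeries.coeff_mul_X_pow']
  split_ifs with h
  · rw [Psi, PowerSeries.coeff_mk, Nat.cast_sub h]
  · rw [mu_eq_zero_of_neg l (by omega), Nat.cast_zero]

end Counting

end Hydral

/-! ### Assembly of the theorem -/

theorem corollary4p17 (n : ℕ) (hn : 1 ≤ n) :
    -- hydral partitions are the M-partitions of type `(n, n, m)`, `m ≥ 1`
    (∀ l : Finset (Fin n → ℕ),
      Hydral.IsHydral l ↔ ∃ m : ℕ, 1 ≤ m ∧ Hydral.IsMPartition l n m) ∧
    (∀ m : ℕ, Hydral.alpha n n m =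
      Nat.card {l : Finset (Fin n → ℕ) // Hydral.IsHydral l ∧ l.card = 1 + 2 * n + m}) ∧
    -- structure of hydral partitions
    (∀ m : ℕ, 1 ≤ m → ∀ l : Finset (Fin n → ℕ),
      Hydral.IsMPartition l n m ↔
        ∃ D : Hydral.HydralData n m, (l : Set (Fin n → ℕ)) = D.shape) ∧
    -- their number
    (∀ m : ℕ, 1 ≤ m →
      (Hydral.alpha n n m : ℚ) =
        ∑ l : n.Partition, ∑ i ∈ Finset.range (Hydral.tFun l.parts + 1),
          Hydral.hydralCoeff n l.parts i *
            (Hydral.mu (Hydral.sFun^[i] l.parts) ((m : ℤ) - i) : ℚ)) ∧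
    -- their generating function
    (PowerSeries.mk fun m => (Hydral.alpha n n m : ℚ)) =
      ∑ l : n.Partition, ∑ i ∈ Finset.range (Hydral.tFun l.parts + 1),
        PowerSeries.C (Hydral.hydralCoeff n l.parts i) *
          Hydral.Psi (Hydral.sFun^[i] l.parts) * PowerSeries.X ^ i ∧
    (∀ l : n.Partition, ∀ i ≤ Hydral.tFun l.parts,
      Hydral.IsRational (Hydral.Psi (Hydral.sFun^[i] l.parts))) ∧
    Hydral.IsRational (PowerSeries.mk fun m => (Hydral.alpha n n m : ℚ)) := by
  have hne : Nonempty (Fin n) := ⟨⟨0, hn⟩⟩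
  have hgf := Hydral.mk_alpha_eq hn
  have hrat : ∀ l : n.Partition, ∀ i, Hydral.IsRational (Hydral.Psi (Hydral.sFun^[i] l.parts)) :=
    fun l i => Hydral.isRational_Psi (Hydral.pos_of_mem_sFun_iterate l i)
  refine ⟨fun l => ?_, fun m => ?_, fun m _ l => ?_, fun m _ => ?_, hgf, fun l i _ => hrat l i, ?_⟩
  · have h := Hydral.isHydral_iff_exists (V := Fin n) (l := l)
    rwa [Fintype.card_fin] at h
  · rw [Hydral.alpha, if_neg (by omega)]
    refine Nat.card_congr (Equiv.subtypeEquivRight fun l => ?_)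
    have h := Hydral.isMPartition_iff_isHydral_and_card (V := Fin n) (l := l) (m := m)
    rwa [Fintype.card_fin] at h
  · rw [Hydral.isMPartition_fin_iff hn]
    exact ⟨Hydral.exists_hydralData hn, fun ⟨D, hD⟩ => Hydral.isHydralOn_of_hydralData hn D hD⟩
  · have h := congrArg (PowerSeries.coeff m) hgf
    rw [PowerSeries.coeff_mk] at h
    rw [h, map_sum]
    refine Finset.sum_congr rfl fun l _ => ?_
    rw [map_sum]
    refine Finset.sum_congr rfl fun i _ => ?_
    rw [mul_assoc, PowerSeries.coeff_C_mul, Hydral.coeff_Psi_mul_X_pow]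
  · rw [hgf]
    exact Hydral.isRational_sum _ _ fun l _ => Hydral.isRational_sum _ _ fun i _ =>
      ((Hydral.isRational_C _).mul (hrat l i)).mul (Hydral.isRational_X_pow i)
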